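/- Let $k$ be a field of characteristic $0$. **The dg operad $\mathcal{OC}_\infty=\mathcal L_\infty\oplus\mathcal N_\infty$.** It is the free two-coloured (spatial/planar) graded operad, with symmetric group action on the spatial inputs only, generated by operations $l_n$ ($n\ge 2$), of degree $3-2n$, with $n$ spatial inputs and spatial output, and $n_{p,q}$ ($2p+q\ge 2$), of degree $2-2p-q$, with $p$ spatial inputs, $q$ (linearly ordered) planar inputs and planar output; $l_n$ and $n_{p,q}$ are graded symmetric in their spatial inputs. Thus $\mathcal L_\infty(n)$ and $\mathcal N_\infty(p,q)$ are spanned by the partially planar trees with spatial, respectively planar, root. Its differential, of degree $+1$, is the derivation for the compositions given by $$d\,l_n=\sum_{I_1\sqcup I_2=\{1,\dots,n\}} l_{1+|I_2|}(l_{|I_1|}(I_1),I_2)\qquad(|I_1|\ge 2,\ |I_2|\ge 1),$$ $$d\,n_{n,m}=\sum_{I_1\sqcup I_2,\ |I_1|\ge2}(-1)^{m+|I_1|}\,n_{1+|I_2|,m}(l_{|I_1|}(I_1),I_2;1,\dots,m)+\sum_{I_1\sqcup I_2}\ \sum_{i+s+j=m}(-1)^{s+i+si+ms}\,n_{|I_1|,i+1+j}\bigl(I_1;1,\dots,i,\,n_{|I_2|,s}(I_2;i+1,\dots,i+s),\,i+s+1,\dots,m\bigr),$$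 where the sums run over unshuffles $I_1\sqcup I_2$ and only over terms all of whose corollae are among the generators. **The operad $\mathcal{OC}$.** Let $H_\bullet(\mathcal{SC})$ be the homology of the Swiss-cheese operad: it is generated by $l_2,m_2$ (spatial inputs and output), $n_{1,0}$, $n_{0,2}$, with $|l_2|=-1$ and the others of degree $0$ (minus the homological degree), $l_2$ and $m_2$ graded symmetric, subject to: the Jacobi identity for $l_2$; associativity of $m_2$ and the Leibniz rule of $l_2$ over $m_2$; associativity of $n_{0,2}$; $n_{0,2}(n_{1,0}(x),a)=\pm n_{0,2}(a,n_{1,0}(x))$ (Koszul sign); $n_{1,0}(m_2(x,y))=n_{0,2}(n_{1,0}(x),n_{1,0}(y))$. Then $\mathcal{OC}=\mathcal L\oplus\mathcal N$ is its suboperad generated by $l_2,n_{1,0},n_{0,2}$, with zero differential; $\mathcal L$ is the suboperad generated by $l_2$. **Module structures.** $\mathcal L_\infty$ acts on $\mathcal{OC}_\infty$ by grafting $T\circ_i l$ on spatial leaves (and $l\circ_i T$ if $T$ has spatial root). It acts on $\mathcal{OC}$ by grafting through the morphism of operads $\mathcal L_\infty\to\mathcal L$, $l_2\mapsto l_2$,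 $l_n\mapsto 0$ for $n\ge3$. **Statement.** There is a morphism of differential graded $\mathcal L_\infty$-modules $\mu:\mathcal{OC}_\infty\to\mathcal{OC}$, that is, a family of equivariant linear maps of degree $0$ which is compatible with the actions of $\mathcal L_\infty$ and satisfies $\mu(dT)=0$ for all $T$, that extends the identity on $\mathcal{OC}$: every tree built from $l_2$, $n_{1,0}$, $n_{0,2}$ is sent to its class in $\mathcal{OC}$. Moreover $$\mu(n_{1,1}\circ n_{1,0})=-\tfrac12\,n_{1,0}\circ l_2,$$ where $n_{1,0}$ is grafted on the planar leaf of $n_{1,1}$, and $\mu$ vanishes on all corollae not in $\mathcal{OC}$: $\mu(n_{p,q})=0$ for $2p+q\ge2$, $(p,q)\ne(1,0),(0,2)$, and $\mu(l_n)=0$ for $n\ge3$. -/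

import Mathlib

noncomputable section

namespace OpenClosed

/-- Kinds of syntactic objects: trees with spatial root, lists of these, trees with planar root,
lists of these. -/
inductive Kind
  | sp
  | sps
  | pl
  | pls

/-- The two kinds of vertices with spatial output: brackets `l_n` and products `m_n`. -/
inductive Vtx
  | l
  | m

/-- Partially planar trees, with spatial leaves labelled by `α` and unlabelled planar leaves
(which are ordered from left to right).  `vert w f` is a vertex `l_n` or `m_n` with spatial inputs
`f`; `pvert f g` is a vertex `n_{p,q}` with `p` spatial inputs `f` and `q` planar inputs `g`;
`leaf` and `edge` are the trees without vertices.  The order of spatial inputs is immaterial up to a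
Koszul sign, which is imposed below as a relation.  A tree stands for the word of its vertices in
prefix order; all Koszul signs refer to that word. -/
inductive PTree (α : Type) : Kind → Type
  | leaf (a : α) : PTree α .sp
  | vert (w : Vtx) (f : PTree α .sps) : PTree α .sp
  | snil : PTree α .sps
  | scons (t : PTree α .sp) (f : PTree α .sps) : PTree α .sps
  | edge : PTree α .pl
  | pvert (f : PTree α .sps) (g : PTree α .pls) : PTree α .pl
  | pnil : PTree α .pls
  | pcons (t : PTree α .pl) (g : PTree α .pls) : PTree α .pls

namespace PTree

variable {α β γ : Type}

/-- Length of a list of trees. -/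
def len : {κ : Kind} → PTree α κ → ℕ
  | _, leaf _ => 0
  | _, vert _ _ => 0
  | _, snil => 0
  | _, scons _ f => f.len + 1
  | _, edge => 0
  | _, pvert _ _ => 0
  | _, pnil => 0
  | _, pcons _ g => g.len + 1

/-- Cohomological degree, the sum over the vertices: `|l_n| = 3 - 2n`, `|m_n| = 0`,
`|n_{p,q}| = 2 - 2p - q`. -/
def deg : {κ : Kind} → PTree α κ → ℤ
  | _, leaf _ => 0
  | _, vert .l f => 3 - 2 * f.len + f.deg
  | _, vert .m f => f.deg
  | _, snil => 0
  | _, scons t f => t.deg + f.deg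
  | _, edge => 0
  | _, pvert f g => 2 - 2 * f.len - g.len + f.deg + g.deg
  | _, pnil => 0
  | _, pcons t g => t.deg + g.deg

/-- Labels of the spatial leaves. -/
def labels : {κ : Kind} → PTree α κ → Multiset α
  | _, leaf a => {a}
  | _, vert _ f => f.labels
  | _, snil => 0
  | _, scons t f => t.labels + f.labels
  | _, edge => 0
  | _, pvert f g => f.labels + g.labels
  | _, pnil => 0
  | _, pcons t g => t.labels + g.labels

/-- Number of planar leaves. -/
def planar : {κ : Kind} → PTree α κ → ℕ
  | _, leaf _ => 0
  | _, vert _ f => f.planar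
  | _, snil => 0
  | _, scons t f => t.planar + f.planar
  | _, edge => 1
  | _, pvert f g => f.planar + g.planar
  | _, pnil => 0
  | _, pcons t g => t.planar + g.planar

/-- All vertices with spatial output satisfy `S` and all vertices `n_{p,q}` satisfy `P p q`. -/
def Adm (S : Vtx → ℕ → Prop) (P : ℕ → ℕ → Prop) : {κ : Kind} → PTree α κ → Prop
  | _, leaf _ => True
  | _, vert w f => S w f.len ∧ f.Adm S P
  | _, snil => True
  | _, scons t f => t.Adm S P ∧ f.Adm S P
  | _, edge => True
  | _, pvert f g => P f.len g.len ∧ f.Adm S P ∧ g.Adm S P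
  | _, pnil => True
  | _, pcons t g => t.Adm S P ∧ g.Adm S P


/-- Relabel the spatial leaves. -/
def map (e : α → β) : {κ : Kind} → PTree α κ → PTree β κ
  | _, leaf a => leaf (e a)
  | _, vert w f => vert w (map e f)
  | _, snil => snil
  | _, scons t f => scons (map e t) (map e f)
  | _, edge => edge
  | _, pvert f g => pvert (map e f) (map e g)
  | _, pnil => pnil
  | _, pcons t g => pcons (map e t) (map e g)

variable [DecidableEq α]

/-- Graft `u` on the spatial leaves labelled `i`; relabel the other leaves by `e`. -/
def sub (i : α) (e : α → β) (u : PTree β .sp) : {κ : Kind} → PTree α κ → PTree β κ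
  | _, leaf a => if a = i then u else leaf (e a)
  | _, vert w f => vert w (sub i e u f)
  | _, snil => snil
  | _, scons t f => scons (sub i e u t) (sub i e u f)
  | _, edge => edge
  | _, pvert f g => pvert (sub i e u f) (sub i e u g)
  | _, pnil => pnil
  | _, pcons t g => pcons (sub i e u t) (sub i e u g)

/-- Total degree of the vertices that follow the leaf `i` in prefix order. -/
def after (i : α) : {κ : Kind} → PTree α κ → ℤ
  | _, leaf _ => 0
  | _, vert _ f => after i f
  | _, snil => 0
  | _, scons t f => after i t + t.labels.count i * f.deg + after i f
  | _, edge => 0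
  | _, pvert f g => after i f + f.labels.count i * g.deg + after i g
  | _, pnil => 0
  | _, pcons t g => after i t + t.labels.count i * g.deg + after i g

/-- Concatenation of lists. -/
def append : PTree α .pls → PTree α .pls → PTree α .pls
  | pnil, h => h
  | pcons t g, h => pcons t (append g h)

end PTree

open PTree

section Linear

variable (k : Type*) [Field k] {α β : Type}

/-- Formal linear combinations of trees. -/
abbrev Raw (α : Type) (κ : Kind) := PTree α κ →₀ k

/-- The sign `(-1) ^ n` in `k`. -/
def ksgn (n : ℤ) : k := ((n.negOnePow : ℤ) : k)

lemma ksgn_add (a b : ℤ) : ksgn k (a + b) = ksgn k a * ksgn k b := by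
  simp [ksgn, Int.negOnePow_add]

lemma ksgn_zero : ksgn k 0 = 1 := by simp [ksgn]

lemma ksgn_congr {a b : ℤ} (h : (a : ZMod 2) = b) : ksgn k a = ksgn k b := by
  have : a.negOnePow = b.negOnePow := by
    rw [Int.negOnePow_eq_iff]
    rw [← sub_eq_zero, ← Int.cast_sub, ZMod.intCast_zmod_eq_zero_iff_dvd] at h
    exact even_iff_two_dvd.mpr (by exact_mod_cast h)
  rw [ksgn, this, ksgn]

lemma ksgn_one : ksgn k 1 = -1 := by simp [ksgn]

/-- `free`: only the symmetry of the spatial inputs is imposed.  `swissCheese`: moreover the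
relations of the homology of the Swiss-cheese operad. -/
inductive Theory
  | free
  | swissCheese

open Finsupp (single)

/-- The defining relations, with arbitrary trees grafted on the inputs:
inputs of spatial type may be permuted up to the Koszul sign; and in the Swiss-cheese case
* `l_2` satisfies the Jacobi identity,
* `l_2` is a derivation of `m_2` (Leibniz),
* `m_2` is associative (its commutativity is part of `swap`),
* `n_{0,2}` is associative,
* `n_{1,0}` is central for `n_{0,2}`,
* `n_{1,0}` sends `m_2` to `n_{0,2}`.
As in homology, `l_2` has degree `-1` and is graded symmetric; `m_2`, `n_{1,0}`, `n_{0,2}` have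
degree `0`. -/
inductive Base {α : Type} : Theory → (κ : Kind) → Raw k α κ → Prop
  | swap (th : Theory) (a b : PTree α .sp) (f : PTree α .sps) :
      Base th .sps (single (scons a (scons b f)) 1
        - single (scons b (scons a f)) (ksgn k (a.deg * b.deg)))
  | jacobi (a b c : PTree α .sp) :
      Base .swissCheese .sp
        (single (vert .l (scons (vert .l (scons a (scons b snil))) (scons c snil))) 1
        + single (vert .l (scons (vert .l (scons b (scons c snil))) (scons a snil)))
            (ksgn k (a.deg * (b.deg + c.deg)))
        + single (vert .l (scons (vert .l (scons c (scons a snil))) (scons b snil)))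
            (ksgn k (c.deg * (a.deg + b.deg))))
  | leibniz (a b c : PTree α .sp) :
      Base .swissCheese .sp
        (single (vert .l (scons a (scons (vert .m (scons b (scons c snil))) snil))) 1
        - single (vert .m (scons (vert .l (scons a (scons b snil))) (scons c snil))) 1
        - single (vert .m (scons b (scons (vert .l (scons a (scons c snil))) snil)))
            (ksgn k ((a.deg - 1) * b.deg)))
  | assoc_m (a b c : PTree α .sp) :
      Base .swissCheese .sp
        (single (vert .m (scons (vert .m (scons a (scons b snil))) (scons c snil))) 1
        - single (vert .m (scons a (scons (vert .m (scons b (scons c snil))) snil))) 1)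
  | assoc_n (a b c : PTree α .pl) :
      Base .swissCheese .pl
        (single (pvert snil (pcons (pvert snil (pcons a (pcons b pnil))) (pcons c pnil))) 1
        - single (pvert snil (pcons a (pcons (pvert snil (pcons b (pcons c pnil))) pnil))) 1)
  | central (x : PTree α .sp) (a : PTree α .pl) :
      Base .swissCheese .pl
        (single (pvert snil (pcons (pvert (scons x snil) pnil) (pcons a pnil))) 1
        - single (pvert snil (pcons a (pcons (pvert (scons x snil) pnil) pnil)))
            (ksgn k (x.deg * a.deg)))
  | mult (x y : PTree α .sp) :
      Base .swissCheese .pl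
        (single (pvert (scons (vert .m (scons x (scons y snil))) snil) pnil) 1
        - single (pvert snil (pcons (pvert (scons x snil) pnil)
            (pcons (pvert (scons y snil) pnil) pnil))) 1)

/-- Relations inside a tree: the closure of the defining relations under all contexts. -/
inductive Relator {α : Type} (th : Theory) : (κ : Kind) → Raw k α κ → Prop
  | base (κ : Kind) (r : Raw k α κ) : Base k th κ r → Relator th κ r
  | vert (w : Vtx) (r : Raw k α .sps) :
      Relator th .sps r → Relator th .sp (r.mapDomain (PTree.vert w))
  | scons_left (r : Raw k α .sp) (f : PTree α .sps) :
      Relator th .sp r → Relator th .sps (r.mapDomain fun t => scons t f)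
  | scons_right (t : PTree α .sp) (r : Raw k α .sps) :
      Relator th .sps r → Relator th .sps (r.mapDomain fun f => scons t f)
  | pvert_left (r : Raw k α .sps) (g : PTree α .pls) :
      Relator th .sps r → Relator th .pl (r.mapDomain fun f => pvert f g)
  | pvert_right (f : PTree α .sps) (r : Raw k α .pls) :
      Relator th .pls r → Relator th .pl (r.mapDomain fun g => pvert f g)
  | pcons_left (r : Raw k α .pl) (g : PTree α .pls) :
      Relator th .pl r → Relator th .pls (r.mapDomain fun t => pcons t g)
  | pcons_right (t : PTree α .pl) (r : Raw k α .pls) :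
      Relator th .pls r → Relator th .pls (r.mapDomain fun g => pcons t g)

/-- The operadic ideal generated by the relations. -/
def RelSpan (th : Theory) (α : Type) (κ : Kind) : Submodule k (Raw k α κ) :=
  Submodule.span k {r | Relator k th κ r}



variable {k}

theorem Relator.homog {th : Theory} {κ : Kind} {r : Raw k α κ} (h : Relator k th κ r) :
    ∃ n d L q, ∀ t, r t ≠ 0 → t.len = n ∧ t.deg = d ∧ t.labels = L ∧ t.planar = q := by
  have key : ∀ {κ κ' : Kind} (F : PTree α κ → PTree α κ') (r : Raw k α κ),
      (∃ n d L q, ∀ t, r t ≠ 0 → t.len = n ∧ t.deg = d ∧ t.labels = L ∧ t.planar = q) →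
      (∀ t t', t.len = t'.len → t.deg = t'.deg → t.labels = t'.labels → t.planar = t'.planar →
        (F t).len = (F t').len ∧ (F t).deg = (F t').deg ∧ (F t).labels = (F t').labels ∧
          (F t).planar = (F t').planar) →
      (∃ n d L q, ∀ t, r.mapDomain F t ≠ 0 →
        t.len = n ∧ t.deg = d ∧ t.labels = L ∧ t.planar = q) := by
    classical
    intro κ κ' F r ⟨n, d, L, q, h⟩ hF
    by_cases hr : r = 0
    · exact ⟨0, 0, 0, 0, by simp [hr]⟩
    · obtain ⟨t₀, h₀⟩ := Finsupp.ne_iff.mp hr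
      refine ⟨(F t₀).len, (F t₀).deg, (F t₀).labels, (F t₀).planar, fun t ht => ?_⟩
      have := Finsupp.mapDomain_support (Finsupp.mem_support_iff.mpr ht)
      obtain ⟨s, hs, rfl⟩ := Finset.mem_image.mp this
      obtain ⟨h1, h2, h3, h4⟩ := h s (Finsupp.mem_support_iff.mp hs)
      obtain ⟨g1, g2, g3, g4⟩ := h t₀ h₀
      exact hF s t₀ (h1.trans g1.symm) (h2.trans g2.symm) (h3.trans g3.symm) (h4.trans g4.symm)
  induction h with
  | base κ r h =>
    classical
    have two : ∀ {κ : Kind} (a b : PTree α κ) (x y : k), a.len = b.len → a.deg = b.deg →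
        a.labels = b.labels → a.planar = b.planar →
        ∃ n d L q, ∀ t, (single a x - single b y) t ≠ 0 →
          t.len = n ∧ t.deg = d ∧ t.labels = L ∧ t.planar = q := by
      intro κ a b x y h1 h2 h3 h4
      refine ⟨a.len, a.deg, a.labels, a.planar, fun t ht => ?_⟩
      by_cases ha : a = t
      · subst ha; simp
      · by_cases hb : b = t
        · subst hb; simp [h1, h2, h3, h4]
        · simp [ha, hb] at ht
    have three : ∀ {κ : Kind} (a b c : PTree α κ) (x y z : k), a.len = b.len → a.deg = b.deg →
        a.labels = b.labels → a.planar = b.planar → a.len = c.len → a.deg = c.deg →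
        a.labels = c.labels → a.planar = c.planar →
        ∃ n d L q, ∀ t, (single a x + single b y + single c z) t ≠ 0 →
          t.len = n ∧ t.deg = d ∧ t.labels = L ∧ t.planar = q := by
      intro κ a b c x y z h1 h2 h3 h4 g1 g2 g3 g4
      refine ⟨a.len, a.deg, a.labels, a.planar, fun t ht => ?_⟩
      by_cases ha : a = t
      · subst ha; simp
      · by_cases hb : b = t
        · subst hb; simp [h1, h2, h3, h4]
        · by_cases hc : c = t
          · subst hc; simp [g1, g2, g3, g4]
          · simp [ha, hb, hc] at ht
    cases h with
    | jacobi a b c =>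
      apply three <;> simp [len, deg, labels, planar] <;> first | ring | abel
    | leibniz a b c =>
      rw [sub_eq_add_neg, sub_eq_add_neg, ← Finsupp.single_neg, ← Finsupp.single_neg]
      apply three <;> simp [len, deg, labels, planar] <;> first | ring | abel
    | _ =>
      apply two <;> simp [len, deg, labels, planar] <;> first | ring | abel
  | _ =>
    rename_i ih
    refine key _ _ ih ?_
    intro t t' h1 h2 h3 h4
    first
      | simp [len, deg, labels, planar, h1, h2, h3, h4]; done
      | (rename_i w _ _; cases w <;> simp [len, deg, labels, planar, h1, h2, h3, h4])


theorem RelSpan.mapDomain {th : Theory} {α β : Type} {κ κ' : Kind} (F : PTree α κ → PTree β κ')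
    (hF : ∀ r, Relator k th κ r → r.mapDomain F ∈ RelSpan k th β κ') {r : Raw k α κ}
    (hr : r ∈ RelSpan k th α κ) : r.mapDomain F ∈ RelSpan k th β κ' := by
  have : RelSpan k th α κ ≤ (RelSpan k th β κ').comap (Finsupp.lmapDomain k k F) :=
    Submodule.span_le.2 hF
  exact this hr

theorem linearCombination_weighted {X Y : Type} (F : X → Y) (w : X → k) (c : k) (r : X →₀ k)
    (h : ∀ t, r t ≠ 0 → w t = c) :
    Finsupp.linearCombination k (fun t => single (F t) (w t)) r = c • r.mapDomain F := by
  rw [Finsupp.linearCombination_apply, Finsupp.mapDomain, Finsupp.smul_sum]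
  refine Finsupp.sum_congr fun t ht => ?_
  rw [h t (Finsupp.mem_support_iff.mp ht)]
  simp [mul_comm]

lemma deg_map (e : α → β) {κ : Kind} (t : PTree α κ) :
    (t.map e).deg = t.deg ∧ (t.map e).len = t.len := by
  induction t with
  | vert w f ih => cases w <;> simp [map, deg, len, ih]
  | _ => simp_all [map, deg, len]

theorem Relator.map_mem {th : Theory} (e : α → β) {κ : Kind} {r : Raw k α κ}
    (h : Relator k th κ r) : r.mapDomain (PTree.map e) ∈ RelSpan k th β κ := by
  have comm : ∀ {κ κ' : Kind} (C : PTree α κ → PTree α κ') (C' : PTree β κ → PTree β κ')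
      (_ : ∀ t, (C t).map e = C' (t.map e)) (_ : ∀ r, Relator k th κ r →
        Relator k th κ' (r.mapDomain C')) (r : Raw k α κ),
      r.mapDomain (PTree.map e) ∈ RelSpan k th β κ →
      (r.mapDomain C).mapDomain (PTree.map e) ∈ RelSpan k th β κ' := by
    intro κ κ' C C' hC hC' r hr
    rw [← Finsupp.mapDomain_comp, show PTree.map e ∘ C = C' ∘ PTree.map e from funext hC,
      Finsupp.mapDomain_comp]
    exact RelSpan.mapDomain C' (fun r hr => Submodule.subset_span (hC' r hr)) hr
  induction h with
  | base κ r h =>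
    refine Submodule.subset_span (.base _ _ ?_)
    have hd : ∀ {κ : Kind} (t : PTree α κ), (t.map e).deg = t.deg := fun t => (deg_map e t).1
    cases h with
    | swap _ a b f =>
      simpa [Finsupp.mapDomain_sub, Finsupp.mapDomain_single, PTree.map, hd]
        using Base.swap (k := k) th (a.map e) (b.map e) (f.map e)
    | jacobi a b c =>
      simpa [Finsupp.mapDomain_add, Finsupp.mapDomain_single, PTree.map, hd]
        using Base.jacobi (k := k) (a.map e) (b.map e) (c.map e)
    | leibniz a b c =>
      simpa [Finsupp.mapDomain_sub, Finsupp.mapDomain_single, PTree.map, hd]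
        using Base.leibniz (k := k) (a.map e) (b.map e) (c.map e)
    | assoc_m a b c =>
      simpa [Finsupp.mapDomain_sub, Finsupp.mapDomain_single, PTree.map, hd]
        using Base.assoc_m (k := k) (a.map e) (b.map e) (c.map e)
    | assoc_n a b c =>
      simpa [Finsupp.mapDomain_sub, Finsupp.mapDomain_single, PTree.map, hd]
        using Base.assoc_n (k := k) (a.map e) (b.map e) (c.map e)
    | central a b =>
      simpa [Finsupp.mapDomain_sub, Finsupp.mapDomain_single, PTree.map, hd]
        using Base.central (k := k) (a.map e) (b.map e)
    | mult a b =>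
      simpa [Finsupp.mapDomain_sub, Finsupp.mapDomain_single, PTree.map, hd]
        using Base.mult (k := k) (a.map e) (b.map e)
  | vert w r _ ih => exact comm _ (PTree.vert w) (fun _ => rfl) (fun r => .vert w r) r ih
  | scons_left r f _ ih =>
    exact comm _ (fun t => scons t (f.map e)) (fun _ => rfl) (fun r => .scons_left r _) r ih
  | scons_right t r _ ih =>
    exact comm _ (fun f => scons (t.map e) f) (fun _ => rfl) (fun r => .scons_right _ r) r ih
  | pvert_left r g _ ih =>
    exact comm _ (fun t => pvert t (g.map e)) (fun _ => rfl) (fun r => .pvert_left r _) r ih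
  | pvert_right t r _ ih =>
    exact comm _ (fun f => pvert (t.map e) f) (fun _ => rfl) (fun r => .pvert_right _ r) r ih
  | pcons_left r g _ ih =>
    exact comm _ (fun t => pcons t (g.map e)) (fun _ => rfl) (fun r => .pcons_left r _) r ih
  | pcons_right t r _ ih =>
    exact comm _ (fun f => pcons (t.map e) f) (fun _ => rfl) (fun r => .pcons_right _ r) r ih

section Graft

variable [DecidableEq α]

lemma after_eq_zero (i : α) {κ : Kind} (t : PTree α κ) (h : t.labels.count i = 0) :
    after i t = 0 := by
  induction t <;> simp_all [after, labels]

lemma sub_eq_map (i : α) (e : α → β) (u : PTree β .sp) {κ : Kind} (t : PTree α κ)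
    (h : t.labels.count i = 0) : PTree.sub i e u t = t.map e := by
  induction t <;> simp_all [PTree.sub, PTree.map, labels]
  rintro rfl; simp_all

lemma len_sub (i : α) (e : α → β) (u : PTree β .sp) {κ : Kind} (t : PTree α κ)
    (h : κ ≠ .sp) : (PTree.sub i e u t).len = t.len := by
  induction t <;> simp_all [PTree.sub, len]

lemma deg_sub (i : α) (e : α → β) (u : PTree β .sp) {κ : Kind} (t : PTree α κ) :
    (PTree.sub i e u t).deg = t.deg + t.labels.count i * u.deg := by
  induction t with
  | leaf a =>
    by_cases h : a = i
    · simp [PTree.sub, deg, labels, h]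
    · simp [PTree.sub, deg, labels, h, Ne.symm h]
  | vert w f ih =>
    cases w <;> simp [PTree.sub, deg, labels, ih, len_sub] <;> ring
  | _ => simp_all [PTree.sub, deg, labels, len_sub] <;> ring

/-- The composition `t ∘_i u`: the word of `u` is inserted at the leaf `i`, so that `u` moves past
the vertices of `t` that follow this leaf.  (Only trees with exactly one leaf `i` matter.) -/
def graftRaw (k : Type*) [Field k] (i : α) (e : α → β) {κ : Kind} (t : PTree α κ)
    (u : PTree β .sp) : Raw k β κ :=
  if t.labels.count i = 1 then single (PTree.sub i e u t) (ksgn k (u.deg * after i t)) else 0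

lemma ksgn_mul_congr {a b c d : ℤ} (h : ((a + b : ℤ) : ZMod 2) = ((c + d : ℤ) : ZMod 2)) :
    ksgn k a * ksgn k b = ksgn k c * ksgn k d := by
  rw [← ksgn_add, ← ksgn_add]; exact ksgn_congr k h

lemma ksgn_mul_congr' {a c d : ℤ} (h : (a : ZMod 2) = ((c + d : ℤ) : ZMod 2)) :
    ksgn k a = ksgn k c * ksgn k d := by
  rw [← ksgn_add]; exact ksgn_congr k h


lemma graftRaw_eq_zero (i : α) (e : α → β) {κ : Kind} (t : PTree α κ) (u : PTree β .sp)
    (h : t.labels.count i ≠ 1) : graftRaw k i e t u = 0 := if_neg h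

lemma graftRaw_eq (i : α) (e : α → β) {κ : Kind} (t : PTree α κ) (u : PTree β .sp)
    (h : t.labels.count i = 1) : graftRaw k i e t u
      = single (PTree.sub i e u t) (ksgn k (u.deg * after i t)) := if_pos h

theorem linearCombination_eq_smul {X Y : Type} (v : X → Y →₀ k) (F : X → Y) (c : k) (r : X →₀ k)
    (h : ∀ t, r t ≠ 0 → v t = single (F t) c) :
    Finsupp.linearCombination k v r = c • r.mapDomain F := by
  rw [Finsupp.linearCombination_apply, Finsupp.mapDomain, Finsupp.smul_sum]
  refine Finsupp.sum_congr fun t ht => ?_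
  rw [h t (Finsupp.mem_support_iff.mp ht)]
  simp [mul_comm]

theorem linearCombination_eq_zero {X M : Type*} [AddCommGroup M] [Module k M] (v : X → M)
    (r : X →₀ k) (h : ∀ t, r t ≠ 0 → v t = 0) : Finsupp.linearCombination k v r = 0 := by
  rw [Finsupp.linearCombination_apply]
  exact Finset.sum_eq_zero fun t ht => by simp [h t (Finsupp.mem_support_iff.mp ht)]

theorem linearCombination_comp_linear {X M N : Type*} [AddCommGroup M] [Module k M]
    [AddCommGroup N] [Module k N] (v : X → M) (v' : X → N) (Φ : M →ₗ[k] N)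
    (r : X →₀ k) (h : ∀ t, v' t = Φ (v t)) :
    Finsupp.linearCombination k v' r = Φ (Finsupp.linearCombination k v r) := by
  rw [Finsupp.linearCombination_apply, Finsupp.linearCombination_apply, Finsupp.sum, Finsupp.sum,
    map_sum]
  exact Finset.sum_congr rfl fun t _ => by rw [h, map_smul]

theorem Relator.graft_binary {th : Theory} (i : α) (e : α → β) (u : PTree β .sp)
    {κ₁ κ₂ κ₃ : Kind} (C : PTree α κ₁ → PTree α κ₂ → PTree α κ₃)
    (C' : PTree β κ₁ → PTree β κ₂ → PTree β κ₃)
    (hl : ∀ x y, (C x y).labels.count i = x.labels.count i + y.labels.count i)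
    (hs : ∀ x y, PTree.sub i e u (C x y) = C' (PTree.sub i e u x) (PTree.sub i e u y))
    (ha : ∀ y : PTree α κ₂, y.labels.count i = 0 → ∃ d : ℤ, ∀ x, x.labels.count i = 1 →
      after i (C x y) = after i x + d)
    (ha' : ∀ y : PTree α κ₂, ∀ d : ℤ, ∃ d' : ℤ, ∀ x, x.deg = d → x.labels.count i = 0 →
      after i (C x y) = d')
    (hR : ∀ y r, Relator k th κ₁ r → Relator k th κ₃ (r.mapDomain fun x => C' x y))
    (r : Raw k α κ₁) (y : PTree α κ₂) (hr : Relator k th κ₁ r)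
    (ih : Finsupp.linearCombination k (fun t => graftRaw k i e t u) r ∈ RelSpan k th β κ₁) :
    Finsupp.linearCombination k (fun t => graftRaw k i e t u) (r.mapDomain fun x => C x y)
      ∈ RelSpan k th β κ₃ := by
  rw [Finsupp.linearCombination_mapDomain]
  by_cases hy : y.labels.count i = 0
  · obtain ⟨d, hd⟩ := ha y hy
    rw [linearCombination_comp_linear (fun t => graftRaw k i e t u) _
      (ksgn k (u.deg * d) • Finsupp.lmapDomain k k fun x => C' x (PTree.sub i e u y)) r]
    · exact Submodule.smul_mem _ _ (RelSpan.mapDomain _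
        (fun r hr => Submodule.subset_span (hR _ r hr)) ih)
    · intro t
      by_cases ht : t.labels.count i = 1
      · simp only [Function.comp]
        rw [graftRaw_eq _ _ _ _ (by rw [hl, hy, ht]), graftRaw_eq _ _ _ _ ht, hd t ht, hs]
        simp [Finsupp.mapDomain_single, ← ksgn_add]
        ring_nf
      · simp only [Function.comp]
        rw [graftRaw_eq_zero _ _ _ _ (by rw [hl, hy]; exact ht), graftRaw_eq_zero _ _ _ _ ht,
          map_zero]
  · obtain ⟨_, d, Lb, _, hd⟩ := hr.homog
    obtain ⟨d', hd'⟩ := ha' y d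
    by_cases hL : Lb.count i = 0 ∧ y.labels.count i = 1
    · rw [linearCombination_eq_smul _ (fun t => PTree.sub i e u (C t y)) (ksgn k (u.deg * d')) r]
      · refine Submodule.smul_mem _ _ ?_
        have : r.mapDomain (fun t => PTree.sub i e u (C t y))
            = (r.mapDomain (PTree.map e)).mapDomain fun x => C' x (PTree.sub i e u y) := by
          rw [← Finsupp.mapDomain_comp]
          refine Finsupp.mapDomain_congr fun t ht => ?_
          have h0 := hd t (Finsupp.mem_support_iff.mp ht)
          simp only [Function.comp, hs]
          rw [sub_eq_map i e u t (by rw [h0.2.2.1]; exact hL.1)]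
        rw [this]
        exact RelSpan.mapDomain _ (fun r hr => Submodule.subset_span (hR _ r hr)) (hr.map_mem e)
      · intro t ht
        obtain ⟨_, h2, h3, _⟩ := hd t ht
        simp only [Function.comp]
        rw [graftRaw_eq _ _ _ _ (by rw [hl, h3, hL.1, hL.2]),
          hd' t h2 (by rw [h3]; exact hL.1)]
    · rw [linearCombination_eq_zero]
      · exact Submodule.zero_mem _
      · intro t ht
        obtain ⟨_, h2, h3, _⟩ := hd t ht
        exact graftRaw_eq_zero _ _ _ _ (by rw [hl, h3]; omega)

theorem Relator.graft_mem {th : Theory} (i : α) (e : α → β) (u : PTree β .sp) {κ : Kind}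
    {r : Raw k α κ} (h : Relator k th κ r) :
    Finsupp.linearCombination k (fun t => graftRaw k i e t u) r ∈ RelSpan k th β κ := by
  induction h with
  | base κ r h =>
    have fin : ∀ {κ : Kind} (A : PTree α κ) (r : Raw k α κ) (r' : Raw k β κ),
        (∀ t, r t ≠ 0 → t.labels.count i = A.labels.count i) →
        Base k th κ r' →
        (A.labels.count i = 1 → Finsupp.linearCombination k (fun t => graftRaw k i e t u) r
          = ksgn k (u.deg * after i A) • r') →
        Finsupp.linearCombination k (fun t => graftRaw k i e t u) r ∈ RelSpan k th β κ := by
      intro κ A r r' h1 h2 h3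
      by_cases hA : A.labels.count i = 1
      · rw [h3 hA]
        exact Submodule.smul_mem _ _ (Submodule.subset_span (.base _ _ h2))
      · rw [linearCombination_eq_zero]
        · exact Submodule.zero_mem _
        · intro t ht
          exact graftRaw_eq_zero _ _ _ _ (by rw [h1 t ht]; exact hA)
    have two : ∀ {κ : Kind} (A B : PTree α κ) (s s' : k) (r' : Raw k β κ),
        A.labels.count i = B.labels.count i →
        r' = single (PTree.sub i e u A) 1 - single (PTree.sub i e u B) s' →
        Base k th κ r' →
        (A.labels.count i = 1 →
          s * ksgn k (u.deg * after i B) = ksgn k (u.deg * after i A) * s') →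
        Finsupp.linearCombination k (fun t => graftRaw k i e t u) (single A 1 - single B s)
          ∈ RelSpan k th β κ := by
      intro κ A B s s' r' h1 h2 h3 h4
      refine fin A _ r' (fun t ht => ?_) h3 fun hA => ?_
      · by_cases hA : A = t
        · rw [hA]
        · by_cases hB : B = t
          · rw [h1, hB]
          · simp [hA, hB] at ht
      · rw [h2, map_sub, Finsupp.linearCombination_single, Finsupp.linearCombination_single,
          graftRaw_eq _ _ _ _ hA, graftRaw_eq _ _ _ _ (h1 ▸ hA), smul_sub, Finsupp.smul_single,
          Finsupp.smul_single, Finsupp.smul_single, Finsupp.smul_single]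
        simp only [smul_eq_mul, h4 hA, one_mul, mul_one]
    have three : ∀ {κ : Kind} (A B C : PTree α κ) (s s' v v' : k) (r' : Raw k β κ),
        A.labels.count i = B.labels.count i → A.labels.count i = C.labels.count i →
        r' = single (PTree.sub i e u A) 1 + single (PTree.sub i e u B) s'
          + single (PTree.sub i e u C) v' →
        Base k th κ r' →
        (A.labels.count i = 1 →
          s * ksgn k (u.deg * after i B) = ksgn k (u.deg * after i A) * s') →
        (A.labels.count i = 1 →
          v * ksgn k (u.deg * after i C) = ksgn k (u.deg * after i A) * v') →
        Finsupp.linearCombination k (fun t => graftRaw k i e t u)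
          (single A 1 + single B s + single C v) ∈ RelSpan k th β κ := by
      intro κ A B C s s' v v' r' h1 h1' h2 h3 h4 h4'
      refine fin A _ r' (fun t ht => ?_) h3 fun hA => ?_
      · by_cases hA : A = t
        · rw [hA]
        · by_cases hB : B = t
          · rw [h1, hB]
          · by_cases hC : C = t
            · rw [h1', hC]
            · simp [hA, hB, hC] at ht
      · rw [h2, map_add, map_add, Finsupp.linearCombination_single,
          Finsupp.linearCombination_single, Finsupp.linearCombination_single,
          graftRaw_eq _ _ _ _ hA, graftRaw_eq _ _ _ _ (h1 ▸ hA),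
          graftRaw_eq _ _ _ _ (h1' ▸ hA), smul_add, smul_add]
        simp only [Finsupp.smul_single, smul_eq_mul, h4 hA, h4' hA, one_mul, mul_one]
    have par : ∀ x y z : ℕ, x + y + z = 1 →
      (x = 1 ∧ y = 0 ∧ z = 0) ∨ (x = 0 ∧ y = 1 ∧ z = 0) ∨ (x = 0 ∧ y = 0 ∧ z = 1) := by omega
    have par2 : ∀ x y : ℕ, x + y = 1 →
      (x = 1 ∧ y = 0) ∨ (x = 0 ∧ y = 1) := by omega
    cases h with
    | swap _ a b f =>
      refine two _ _ _ (ksgn k ((PTree.sub i e u a).deg * (PTree.sub i e u b).deg)) _ ?_ ?_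
        (.swap th (PTree.sub i e u a) (PTree.sub i e u b)
        (PTree.sub i e u f)) ?_
      · simp [labels]; omega
      · simp [PTree.sub]
      · simp only [labels, Multiset.count_add, ← add_assoc]
        intro h
        apply ksgn_mul_congr
        rcases par _ _ _ h with ⟨ha, hb, hc⟩ | ⟨ha, hb, hc⟩ | ⟨ha, hb, hc⟩ <;>
        · simp only [after, deg, deg_sub, ha, hb, hc, labels, Multiset.count_add]
          push_cast
          grind
    | jacobi a b c =>
      refine three _ _ _ _ (ksgn k ((PTree.sub i e u a).deg * ((PTree.sub i e u b).deg + (PTree.sub i e u c).deg)))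
        _ (ksgn k ((PTree.sub i e u c).deg * ((PTree.sub i e u a).deg + (PTree.sub i e u b).deg))) _ ?_ ?_ ?_
        (.jacobi (PTree.sub i e u a) (PTree.sub i e u b)
        (PTree.sub i e u c)) ?_ ?_
      · simp [labels]; omega
      · simp [labels]; omega
      · simp [PTree.sub]
      all_goals
        simp only [labels, Multiset.count_add, ← add_assoc, Multiset.count_zero, add_zero]
        intro h
        apply ksgn_mul_congr
        rcases par _ _ _ h with ⟨ha, hb, hc⟩ | ⟨ha, hb, hc⟩ | ⟨ha, hb, hc⟩ <;>
        · simp only [after, deg, deg_sub, ha, hb, hc, labels, Multiset.count_add, len,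
            Multiset.count_zero]
          push_cast
          grind
    | leibniz a b c =>
      rw [sub_eq_add_neg, sub_eq_add_neg, ← Finsupp.single_neg, ← Finsupp.single_neg]
      refine three _ _ _ _ (-1) _
        (-ksgn k (((PTree.sub i e u a).deg - 1) * (PTree.sub i e u b).deg)) _ ?_ ?_ ?_ (.leibniz (PTree.sub i e u a)
        (PTree.sub i e u b) (PTree.sub i e u c)) ?_ ?_
      · simp [labels]; omega
      · simp [labels]; omega
      · rw [sub_eq_add_neg, sub_eq_add_neg, ← Finsupp.single_neg, ← Finsupp.single_neg]
        simp only [PTree.sub]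
      all_goals
        simp only [labels, Multiset.count_add, ← add_assoc, Multiset.count_zero, add_zero]
        intro h
        simp only [neg_mul, mul_neg, neg_inj, one_mul, mul_one]
        first | apply ksgn_mul_congr | apply ksgn_congr
        rcases par _ _ _ h with ⟨ha, hb, hc⟩ | ⟨ha, hb, hc⟩ | ⟨ha, hb, hc⟩ <;>
        · simp only [after, deg, deg_sub, ha, hb, hc, labels, Multiset.count_add, len,
            Multiset.count_zero]
          push_cast
          grind
    | assoc_m a b c =>
      refine two _ _ _ 1 _ ?_ ?_ (.assoc_m (PTree.sub i e u a) (PTree.sub i e u b)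
        (PTree.sub i e u c)) ?_
      · simp [labels]; omega
      · simp [PTree.sub]
      · simp only [labels, Multiset.count_add, ← add_assoc, Multiset.count_zero, add_zero]
        intro h
        simp only [one_mul, mul_one]
        apply ksgn_congr
        rcases par _ _ _ h with ⟨ha, hb, hc⟩ | ⟨ha, hb, hc⟩ | ⟨ha, hb, hc⟩ <;>
        · simp only [after, deg, ha, hb, hc, labels, Multiset.count_add, len,
            Multiset.count_zero]
          push_cast
          grind
    | assoc_n a b c =>
      refine two _ _ _ 1 _ ?_ ?_ (.assoc_n (PTree.sub i e u a) (PTree.sub i e u b)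
        (PTree.sub i e u c)) ?_
      · simp [labels]; omega
      · simp [PTree.sub]
      · simp only [labels, Multiset.count_add, ← add_assoc, Multiset.count_zero, add_zero,
          zero_add]
        intro h
        simp only [one_mul, mul_one]
        apply ksgn_congr
        rcases par _ _ _ h with ⟨ha, hb, hc⟩ | ⟨ha, hb, hc⟩ | ⟨ha, hb, hc⟩ <;>
        · simp only [after, deg, ha, hb, hc, labels, Multiset.count_add, len,
            Multiset.count_zero]
          push_cast
          grind
    | central a b =>
      refine two _ _ _ (ksgn k ((PTree.sub i e u a).deg * (PTree.sub i e u b).deg)) _ ?_ ?_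
        (.central (PTree.sub i e u a) (PTree.sub i e u b)) ?_
      · simp [labels]; omega
      · simp [PTree.sub]
      · simp only [labels, Multiset.count_add, ← add_assoc, Multiset.count_zero, add_zero,
          zero_add]
        intro h
        apply ksgn_mul_congr
        rcases par2 _ _ h with ⟨ha, hb⟩ | ⟨ha, hb⟩ <;>
        · simp only [after, deg, deg_sub, ha, hb, labels, Multiset.count_add, len,
            Multiset.count_zero]
          push_cast
          grind
    | mult a b =>
      refine two _ _ _ 1 _ ?_ ?_ (.mult (PTree.sub i e u a) (PTree.sub i e u b)) ?_
      · simp [labels]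
      · simp [PTree.sub]
      · simp only [labels, Multiset.count_add, ← add_assoc, Multiset.count_zero, add_zero]
        intro h
        simp only [one_mul, mul_one]
        apply ksgn_congr
        rcases par2 _ _ h with ⟨ha, hb⟩ | ⟨ha, hb⟩ <;>
        · simp only [after, deg, ha, hb, labels, Multiset.count_add, len,
            Multiset.count_zero]
          push_cast
          grind
  | vert w r hr ih =>
    rw [Finsupp.linearCombination_mapDomain]
    rw [linearCombination_comp_linear (fun t => graftRaw k i e t u) _
      (Finsupp.lmapDomain k k (PTree.vert w)) r]
    · exact RelSpan.mapDomain _ (fun r hr => Submodule.subset_span (.vert w r hr)) ih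
    · intro t
      simp only [Function.comp]
      by_cases ht : t.labels.count i = 1
      · rw [graftRaw_eq _ _ _ _ ht, graftRaw_eq _ _ _ _ (by simpa [labels] using ht)]
        simp [after, PTree.sub]
      · rw [graftRaw_eq_zero _ _ _ _ ht, graftRaw_eq_zero _ _ _ _ (by simpa [labels] using ht),
          map_zero]
  | scons_left r f hr ih =>
    exact graft_binary i e u scons scons (fun _ _ => Multiset.count_add _ _ _) (fun _ _ => rfl)
      (fun y hy => ⟨y.deg, fun x hx => by simp [after, hx, after_eq_zero i y hy]⟩)
      (fun y d => ⟨after i y, fun x _ hx => by simp [after, hx, after_eq_zero i x hx]⟩)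
      (fun y r => .scons_left r y) r f hr ih
  | scons_right f r hr ih =>
    exact graft_binary i e u (fun x y => scons y x) (fun x y => scons y x)
      (fun _ _ => (Multiset.count_add _ _ _).trans (add_comm _ _)) (fun _ _ => rfl)
      (fun y hy => ⟨0, fun x hx => by simp [after, hy, after_eq_zero i y hy]⟩)
      (fun y d => ⟨after i y + y.labels.count i * d, fun x hd hx => by
        simp [after, hd, after_eq_zero i x hx]⟩)
      (fun y r => .scons_right y r) r f hr ih
  | pvert_left r f hr ih =>
    exact graft_binary i e u pvert pvert (fun _ _ => Multiset.count_add _ _ _) (fun _ _ => rfl)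
      (fun y hy => ⟨y.deg, fun x hx => by simp [after, hx, after_eq_zero i y hy]⟩)
      (fun y d => ⟨after i y, fun x _ hx => by simp [after, hx, after_eq_zero i x hx]⟩)
      (fun y r => .pvert_left r y) r f hr ih
  | pvert_right f r hr ih =>
    exact graft_binary i e u (fun x y => pvert y x) (fun x y => pvert y x)
      (fun _ _ => (Multiset.count_add _ _ _).trans (add_comm _ _)) (fun _ _ => rfl)
      (fun y hy => ⟨0, fun x hx => by simp [after, hy, after_eq_zero i y hy]⟩)
      (fun y d => ⟨after i y + y.labels.count i * d, fun x hd hx => by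
        simp [after, hd, after_eq_zero i x hx]⟩)
      (fun y r => .pvert_right y r) r f hr ih
  | pcons_left r f hr ih =>
    exact graft_binary i e u pcons pcons (fun _ _ => Multiset.count_add _ _ _) (fun _ _ => rfl)
      (fun y hy => ⟨y.deg, fun x hx => by simp [after, hx, after_eq_zero i y hy]⟩)
      (fun y d => ⟨after i y, fun x _ hx => by simp [after, hx, after_eq_zero i x hx]⟩)
      (fun y r => .pcons_left r y) r f hr ih
  | pcons_right f r hr ih =>
    exact graft_binary i e u (fun x y => pcons y x) (fun x y => pcons y x)
      (fun _ _ => (Multiset.count_add _ _ _).trans (add_comm _ _)) (fun _ _ => rfl)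
      (fun y hy => ⟨0, fun x hx => by simp [after, hy, after_eq_zero i y hy]⟩)
      (fun y d => ⟨after i y + y.labels.count i * d, fun x hd hx => by
        simp [after, hd, after_eq_zero i x hx]⟩)
      (fun y r => .pcons_right y r) r f hr ih

theorem Relator.graft_mem_right {th : Theory} (i : α) (e : α → β) {κ : Kind} (t : PTree α κ)
    {r : Raw k β .sp} (h : Relator k th .sp r) :
    Finsupp.linearCombination k (fun u => graftRaw k i e t u) r ∈ RelSpan k th β κ := by
  by_cases hc : t.labels.count i = 1
  · obtain ⟨_, d, _, _, hd⟩ := h.homog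
    rw [linearCombination_eq_smul _ (fun u => PTree.sub i e u t) (ksgn k (d * after i t)) r
      (fun u hu => by rw [graftRaw_eq _ _ _ _ hc, (hd u hu).2.1])]
    refine Submodule.smul_mem _ _ ?_
    have left : ∀ {κ₁ κ₂ κ₃ : Kind} (C : PTree β κ₁ → PTree β κ₂ → PTree β κ₃)
        (x : PTree α κ₁) (y : PTree α κ₂) (_ : y.labels.count i = 0)
        (_ : ∀ y r, Relator k th κ₁ r → Relator k th κ₃ (r.mapDomain fun x => C x y))
        (_ : r.mapDomain (fun u => PTree.sub i e u x) ∈ RelSpan k th β κ₁),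
        r.mapDomain (fun u => C (PTree.sub i e u x) (PTree.sub i e u y))
          ∈ RelSpan k th β κ₃ := by
      intro κ₁ κ₂ κ₃ C x y hy hR ih
      have : r.mapDomain (fun u => C (PTree.sub i e u x) (PTree.sub i e u y))
          = (r.mapDomain (fun u => PTree.sub i e u x)).mapDomain fun x => C x (y.map e) := by
        rw [← Finsupp.mapDomain_comp]
        exact Finsupp.mapDomain_congr fun u _ => by
          simp only [Function.comp, sub_eq_map i e u y hy]
      rw [this]
      exact RelSpan.mapDomain _ (fun r hr => Submodule.subset_span (hR _ r hr)) ih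
    clear hd
    induction t with
    | leaf a =>
      have : a = i := by
        by_contra hne
        simp [labels, Ne.symm hne] at hc
      have h2 : r.mapDomain (fun u => PTree.sub i e u (leaf a)) = r := by
        simp only [PTree.sub, this, if_true]
        exact Finsupp.mapDomain_id
      rw [h2]
      exact Submodule.subset_span h
    | vert w f ih =>
      have : r.mapDomain (fun u => PTree.sub i e u (PTree.vert w f))
          = (r.mapDomain (fun u => PTree.sub i e u f)).mapDomain (PTree.vert w) := by
        rw [← Finsupp.mapDomain_comp]; rfl
      rw [this]
      exact RelSpan.mapDomain _ (fun r hr => Submodule.subset_span (.vert w r hr)) (ih hc)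
    | snil => simp [labels] at hc
    | edge => simp [labels] at hc
    | pnil => simp [labels] at hc
    | scons x y ih1 ih2 =>
      simp only [labels, Multiset.count_add] at hc
      by_cases hy : y.labels.count i = 0
      · exact left scons x y hy (fun y r => .scons_left r y) (ih1 (by omega))
      · exact left (fun a b => scons b a) y x (by omega) (fun y r => .scons_right y r)
          (ih2 (by omega))
    | pvert x y ih1 ih2 =>
      simp only [labels, Multiset.count_add] at hc
      by_cases hy : y.labels.count i = 0
      · exact left pvert x y hy (fun y r => .pvert_left r y) (ih1 (by omega))
      · exact left (fun a b => pvert b a) y x (by omega) (fun y r => .pvert_right y r)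
          (ih2 (by omega))
    | pcons x y ih1 ih2 =>
      simp only [labels, Multiset.count_add] at hc
      by_cases hy : y.labels.count i = 0
      · exact left pcons x y hy (fun y r => .pcons_left r y) (ih1 (by omega))
      · exact left (fun a b => pcons b a) y x (by omega) (fun y r => .pcons_right y r)
          (ih2 (by omega))
  · rw [linearCombination_eq_zero]
    · exact Submodule.zero_mem _
    · exact fun u _ => graftRaw_eq_zero _ _ _ _ hc

end Graft

section Differential

variable (k)

/-- All splittings of a list of spatial trees into two sublists (unshuffles), with Koszul signs. -/
def unshuffles : PTree α .sps → (PTree α .sps × PTree α .sps →₀ k)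
  | snil => single (snil, snil) 1
  | scons t f => Finsupp.linearCombination k
      (fun z => single (scons t z.1, z.2) 1 + single (z.1, scons t z.2) (ksgn k (t.deg * z.1.deg)))
      (unshuffles f)

/-- All ways to write a list as a concatenation of two lists. -/
def cuts : PTree α .pls → (PTree α .pls × PTree α .pls →₀ k)
  | pnil => single (pnil, pnil) 1
  | pcons t g => single (pnil, pcons t g) 1 +
      Finsupp.linearCombination k (fun z => single (pcons t z.1, z.2) 1) (cuts g)

/-- The term `l_{1+b}(l_a, …)` of `d l_n`, for the splitting `z` of the inputs; `a ≥ 2`, `b ≥ 1`. -/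
def bracketTerm (z : PTree α .sps × PTree α .sps) : Raw k α .sp :=
  if 2 ≤ z.1.len ∧ 1 ≤ z.2.len then single (vert .l (scons (vert .l z.1) z.2)) 1 else 0

/-- The term `(-1)^(m+a) n_{1+b,m}(l_a, …; …)` of `d n_{n,m}`, for the splitting `z` of the spatial
inputs; `a ≥ 2`. -/
def closedTerm (g : PTree α .pls) (z : PTree α .sps × PTree α .sps) : Raw k α .pl :=
  if 2 ≤ z.1.len then
    single (pvert (scons (vert .l z.1) z.2) g) (ksgn k (g.len + z.1.len))
  else 0

/-- The term `(-1)^(s+i+si+ms) n_{p,i+1+j}(x; g₁, n_{r,s}(y; g₂), g₃)` of `d n_{n,m}` where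
`m = i + s + j`.  The remaining sign is the Koszul sign of moving `n_{r,s}` past `x, g₁`, and of
moving `y` past `g₁`. -/
def openTerm (x y : PTree α .sps) (g₁ g₂ g₃ : PTree α .pls) : Raw k α .pl :=
  if 2 ≤ 2 * y.len + g₂.len ∧ 2 ≤ 2 * x.len + (g₁.len + 1 + g₃.len) then
    single (pvert x (g₁.append (pcons (pvert y g₂) g₃)))
      (ksgn k (g₂.len + g₁.len + g₂.len * g₁.len + (g₁.len + g₂.len + g₃.len) * g₂.len
        + (2 - 2 * y.len - g₂.len) * (x.deg + g₁.deg) + y.deg * g₁.deg))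
  else 0

/-- Sum of the previous terms over all decompositions of the planar inputs in three segments. -/
def openSum (z : PTree α .sps × PTree α .sps) (g : PTree α .pls) : Raw k α .pl :=
  Finsupp.linearCombination k (fun w => Finsupp.linearCombination k
    (fun v => openTerm k z.1 z.2 w.1 v.1 v.2) (cuts k w.2)) (cuts k g)

/-- The differential of the operad of open-closed homotopy algebras: given on the vertices by
`d l_n = ∑ l_{1+b}(l_a, …)` and
`d n_{n,m} = ∑ (-1)^(m+a) n_{1+b,m}(l_a, …; …) + ∑ (-1)^(s+i+si+ms) n_{p,i+1+j}(…, n_{r,s}(…), …)`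
(sums over unshuffles and segments), and extended to all trees by the graded Leibniz rule
`d (T ∘ T') = d T ∘ T' + (-1)^|T| T ∘ d T'`. -/
def dRaw : {κ : Kind} → PTree α κ → Raw k α κ
  | _, leaf _ => 0
  | _, vert .l f => Finsupp.linearCombination k (bracketTerm k) (unshuffles k f)
      - (dRaw f).mapDomain (vert .l)
  | _, vert .m f => (dRaw f).mapDomain (vert .m)
  | _, snil => 0
  | _, scons t f => (dRaw t).mapDomain (fun s => scons s f)
      + ksgn k t.deg • (dRaw f).mapDomain (fun h => scons t h)
  | _, edge => 0
  | _, pvert f g => Finsupp.linearCombination k (closedTerm k g) (unshuffles k f)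
      + Finsupp.linearCombination k (fun z => openSum k z g) (unshuffles k f)
      + ksgn k (2 - 2 * f.len - g.len) • ((dRaw f).mapDomain (fun h => pvert h g)
        + ksgn k f.deg • (dRaw g).mapDomain (fun h => pvert f h))
  | _, pnil => 0
  | _, pcons t g => (dRaw t).mapDomain (fun s => pcons s g)
      + ksgn k t.deg • (dRaw g).mapDomain (fun h => pcons t h)

variable {k}

theorem linearCombination_mem {X M : Type*} [AddCommGroup M] [Module k M] (N : Submodule k M)
    (v : X → M) (r : X →₀ k) (h : ∀ t, r t ≠ 0 → v t ∈ N) : Finsupp.linearCombination k v r ∈ N := by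
  rw [Finsupp.linearCombination_apply]
  exact Submodule.sum_mem _ fun t ht =>
    Submodule.smul_mem _ _ (h t (Finsupp.mem_support_iff.mp ht))

theorem linearCombination_comm {X Y M : Type*} [AddCommGroup M] [Module k M]
    (Φ : X → Y → M) (r : X →₀ k) (v : Y →₀ k) :
    Finsupp.linearCombination k (fun t => Finsupp.linearCombination k (Φ t) v) r
      = Finsupp.linearCombination k (fun z => Finsupp.linearCombination k (fun t => Φ t z) r) v := by
  simp only [Finsupp.linearCombination_apply, Finsupp.smul_sum]
  rw [Finsupp.sum_comm]
  exact Finsupp.sum_congr fun _ _ => Finsupp.sum_congr fun _ _ => smul_comm _ _ _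

theorem linearCombination_congr' {X M : Type*} [AddCommGroup M] [Module k M] (v v' : X → M)
    (r : X →₀ k) (h : ∀ t, r t ≠ 0 → v t = v' t) :
    Finsupp.linearCombination k v r = Finsupp.linearCombination k v' r := by
  rw [Finsupp.linearCombination_apply, Finsupp.linearCombination_apply]
  exact Finsupp.sum_congr fun t ht => by rw [h t (Finsupp.mem_support_iff.mp ht)]

/-- Relators among pairs of trees: a relator in one of the two slots. -/
def PairSpan (k : Type*) [Field k] (th : Theory) (α : Type) (κ₁ κ₂ : Kind) :
    Submodule k (PTree α κ₁ × PTree α κ₂ →₀ k) :=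
  Submodule.span k ({s | ∃ r y, Relator k th κ₁ r ∧ s = r.mapDomain fun x => (x, y)} ∪
    {s | ∃ x r, Relator k th κ₂ r ∧ s = r.mapDomain fun y => (x, y)})

theorem PairSpan.map {th : Theory} {κ₁ κ₂ : Kind} {M : Type*} [AddCommGroup M] [Module k M]
    (N : Submodule k M) (Ψ : PTree α κ₁ × PTree α κ₂ → M)
    (h1 : ∀ r y, Relator k th κ₁ r → Finsupp.linearCombination k (fun x => Ψ (x, y)) r ∈ N)
    (h2 : ∀ r x, Relator k th κ₂ r → Finsupp.linearCombination k (fun y => Ψ (x, y)) r ∈ N)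
    {s : PTree α κ₁ × PTree α κ₂ →₀ k} (hs : s ∈ PairSpan k th α κ₁ κ₂) :
    Finsupp.linearCombination k Ψ s ∈ N := by
  have : PairSpan k th α κ₁ κ₂ ≤ N.comap (Finsupp.linearCombination k Ψ) := by
    refine Submodule.span_le.2 ?_
    rintro s (⟨r, y, hr, rfl⟩ | ⟨x, r, hr, rfl⟩)
    · simpa [Finsupp.linearCombination_mapDomain, Function.comp_def] using h1 r y hr
    · simpa [Finsupp.linearCombination_mapDomain, Function.comp_def] using h2 r x hr
  exact this hs

/-- Weighted images of relators under a map preserving relations. -/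
theorem Relator.weighted {th : Theory} {κ : Kind} {Y : Type} (N : Submodule k (Y →₀ k))
    (F : PTree α κ → Y) (w : PTree α κ → k) (v : PTree α κ → (Y →₀ k)) {r : Raw k α κ}
    (hr : Relator k th κ r)
    (hw : ∀ t t', t.len = t'.len → t.deg = t'.deg → w t = w t')
    (hv : ∀ t, v t = single (F t) (w t))
    (hF : r.mapDomain F ∈ N) : Finsupp.linearCombination k v r ∈ N := by
  obtain ⟨n, d, _, _, hd⟩ := hr.homog
  by_cases h0 : ∃ t₀, r t₀ ≠ 0
  · obtain ⟨t₀, ht₀⟩ := h0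
    rw [linearCombination_eq_smul _ F (w t₀) r fun t ht => by
      rw [hv, hw t t₀ ((hd t ht).1.trans (hd t₀ ht₀).1.symm)
        ((hd t ht).2.1.trans (hd t₀ ht₀).2.1.symm)]]
    exact Submodule.smul_mem _ _ hF
  · rw [linearCombination_eq_zero _ r fun t ht => (h0 ⟨t, ht⟩).elim]
    exact Submodule.zero_mem _

theorem PairSpan.fst {th : Theory} {κ κ₁ κ₂ : Kind} (F : PTree α κ → PTree α κ₁) (y : PTree α κ₂)
    {r : Raw k α κ} (hF : Relator k th κ₁ (r.mapDomain F)) :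
    r.mapDomain (fun t => (F t, y)) ∈ PairSpan k th α κ₁ κ₂ := by
  refine Submodule.subset_span (Or.inl ⟨_, y, hF, ?_⟩)
  rw [← Finsupp.mapDomain_comp]; rfl

theorem PairSpan.snd {th : Theory} {κ κ₁ κ₂ : Kind} (F : PTree α κ → PTree α κ₂) (x : PTree α κ₁)
    {r : Raw k α κ} (hF : Relator k th κ₂ (r.mapDomain F)) :
    r.mapDomain (fun t => (x, F t)) ∈ PairSpan k th α κ₁ κ₂ := by
  refine Submodule.subset_span (Or.inr ⟨x, _, hF, ?_⟩)
  rw [← Finsupp.mapDomain_comp]; rfl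


theorem linearCombination_sub_smul {X M : Type*} [AddCommGroup M] [Module k M] (v v' : X → M)
    (c : k) (r : X →₀ k) : Finsupp.linearCombination k v r - c • Finsupp.linearCombination k v' r
      = Finsupp.linearCombination k (fun t => v t - c • v' t) r := by
  simp only [Finsupp.linearCombination_apply, Finsupp.sum, Finset.smul_sum,
    ← Finset.sum_sub_distrib, smul_sub]
  exact Finset.sum_congr rfl fun _ _ => by rw [smul_comm]

theorem linearCombination_add_fun {X M : Type*} [AddCommGroup M] [Module k M] (v v' : X → M)
    (r : X →₀ k) : Finsupp.linearCombination k (fun t => v t + v' t) r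
      = Finsupp.linearCombination k v r + Finsupp.linearCombination k v' r := by
  simp only [Finsupp.linearCombination_apply, Finsupp.sum, ← Finset.sum_add_distrib, smul_add]

theorem Base.swap_mem (a b : PTree α .sp) (f : PTree α .sps) :
    (single (scons a (scons b f)) 1 - single (scons b (scons a f)) (ksgn k (a.deg * b.deg)))
      ∈ RelSpan k .free α .sps := Submodule.subset_span (.base _ _ (.swap _ a b f))

theorem PairSpan.fst_mem {th : Theory} {κ₁ κ₂ : Kind} (y : PTree α κ₂) {r : Raw k α κ₁}
    (hr : Relator k th κ₁ r) :
    r.mapDomain (fun t => (t, y)) ∈ PairSpan k th α κ₁ κ₂ :=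
  Submodule.subset_span (Or.inl ⟨_, y, hr, rfl⟩)

theorem PairSpan.snd_mem {th : Theory} {κ₁ κ₂ : Kind} (x : PTree α κ₁) {r : Raw k α κ₂}
    (hr : Relator k th κ₂ r) :
    r.mapDomain (fun t => (x, t)) ∈ PairSpan k th α κ₁ κ₂ :=
  Submodule.subset_span (Or.inr ⟨x, _, hr, rfl⟩)

theorem Relator.unshuffles_mem {κ : Kind} {r : Raw k α κ} (h : Relator k .free κ r)
    (hκ : κ = .sps) : Finsupp.linearCombination k (unshuffles k) (hκ ▸ r)
      ∈ PairSpan k .free α .sps .sps := by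
  induction h with
  | base κ r h =>
    cases h with
    | swap _ a b f =>
      simp only [map_sub, Finsupp.linearCombination_single, one_smul, unshuffles]
      rw [← linearCombination_comp_linear (k := k) _ (fun z => _) _ (unshuffles k f)
        (fun t => rfl), ← linearCombination_comp_linear (k := k) _ (fun z => _) _
        (unshuffles k f) (fun t => rfl), linearCombination_sub_smul]
      refine linearCombination_mem _ _ _ fun z _ => ?_
      simp only [map_add, Finsupp.linearCombination_single, smul_add, Finsupp.smul_single,
        smul_eq_mul, mul_one, one_mul, deg]
      have m1 := PairSpan.fst_mem (k := k) z.2 (.base _ _ (.swap .free a b z.1))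
      have m2 := PairSpan.snd_mem (k := k) z.1 (.base _ _ (.swap .free a b z.2))
      have m2' := Submodule.smul_mem _ (ksgn k ((a.deg + b.deg) * z.1.deg)) m2
      have := Submodule.add_mem _ m1 m2'
      simp only [Finsupp.mapDomain_sub, Finsupp.mapDomain_single, smul_sub,
        Finsupp.smul_single, smul_eq_mul, mul_one] at this
      have e1 : ksgn k (b.deg * z.1.deg) * ksgn k (a.deg * z.1.deg)
          = ksgn k ((a.deg + b.deg) * z.1.deg) := by
        rw [← ksgn_add]; apply ksgn_congr; push_cast; ring
      have e2 : ksgn k (a.deg * b.deg) * (ksgn k (a.deg * z.1.deg) * ksgn k (b.deg * z.1.deg))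
          = ksgn k ((a.deg + b.deg) * z.1.deg) * ksgn k (a.deg * b.deg) := by
        rw [← ksgn_add, ← ksgn_add, ← ksgn_add]; apply ksgn_congr; push_cast; ring
      have e3 : ksgn k (a.deg * b.deg) * ksgn k (b.deg * (a.deg + z.1.deg))
          = ksgn k (b.deg * z.1.deg) := by
        rw [← ksgn_add]; apply ksgn_congr; push_cast; grind
      have e4 : ksgn k (a.deg * (b.deg + z.1.deg))
          = ksgn k (a.deg * b.deg) * ksgn k (a.deg * z.1.deg) := by
        rw [← ksgn_add]; apply ksgn_congr; push_cast; ring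
      rw [e1, e2, e3, e4]
      convert this using 1
      abel
  | scons_left r f hr ih =>
    simp only [Finsupp.linearCombination_mapDomain, Function.comp_def, unshuffles]
    rw [linearCombination_comm]
    refine linearCombination_mem _ _ _ fun z _ => ?_
    rw [linearCombination_add_fun]
    refine Submodule.add_mem _ ?_ ?_
    · exact hr.weighted _ (fun t => (scons t z.1, z.2)) (fun _ => 1) _ (fun _ _ _ _ => rfl)
        (fun _ => rfl) (PairSpan.fst _ _ (.scons_left _ _ hr))
    · exact hr.weighted _ (fun t => (z.1, scons t z.2)) (fun t => ksgn k (t.deg * z.1.deg)) _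
        (fun _ _ _ h => by rw [h]) (fun _ => rfl) (PairSpan.snd _ _ (.scons_left _ _ hr))
  | scons_right t r hr ih =>
    simp only [Finsupp.linearCombination_mapDomain, Function.comp_def, unshuffles]
    rw [linearCombination_comp_linear (unshuffles k) _ _ r (fun _ => rfl)]
    refine PairSpan.map _ _ ?_ ?_ (ih rfl)
    · intro r y hr
      rw [linearCombination_add_fun]
      refine Submodule.add_mem _ ?_ ?_
      · exact hr.weighted _ (fun x => (scons t x, y)) (fun _ => 1) _ (fun _ _ _ _ => rfl)
          (fun _ => rfl) (PairSpan.fst _ _ (.scons_right _ _ hr))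
      · exact hr.weighted _ (fun x => (x, scons t y)) (fun x => ksgn k (t.deg * x.deg)) _
          (fun _ _ _ h => by rw [h]) (fun _ => rfl) (PairSpan.fst_mem _ hr)
    · intro r x hr
      rw [linearCombination_add_fun]
      refine Submodule.add_mem _ ?_ ?_
      · exact hr.weighted _ (fun y => (scons t x, y)) (fun _ => 1) _ (fun _ _ _ _ => rfl)
          (fun _ => rfl) (PairSpan.snd_mem _ hr)
      · exact hr.weighted _ (fun y => (x, scons t y)) (fun _ => ksgn k (t.deg * x.deg)) _
          (fun _ _ _ h => rfl) (fun _ => rfl) (PairSpan.snd _ _ (.scons_right _ _ hr))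
  | _ => cases hκ

theorem Relator.cuts_mem {κ : Kind} {r : Raw k α κ} (h : Relator k .free κ r)
    (hκ : κ = .pls) : Finsupp.linearCombination k (cuts k) (hκ ▸ r)
      ∈ PairSpan k .free α .pls .pls := by
  induction h with
  | base κ r h => cases h; cases hκ
  | pcons_left r f hr ih =>
    simp only [Finsupp.linearCombination_mapDomain, Function.comp_def, cuts]
    rw [linearCombination_add_fun]
    refine Submodule.add_mem _ ?_ ?_
    · exact hr.weighted _ (fun t => (pnil, pcons t f)) (fun _ => 1) _ (fun _ _ _ _ => rfl)
        (fun _ => rfl) (PairSpan.snd _ _ (.pcons_left _ _ hr))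
    · rw [linearCombination_comm]
      refine linearCombination_mem _ _ _ fun z _ => ?_
      exact hr.weighted _ (fun t => (pcons t z.1, z.2)) (fun _ => 1) _ (fun _ _ _ _ => rfl)
        (fun _ => rfl) (PairSpan.fst _ _ (.pcons_left _ _ hr))
  | pcons_right t r hr ih =>
    simp only [Finsupp.linearCombination_mapDomain, Function.comp_def, cuts]
    rw [linearCombination_add_fun]
    refine Submodule.add_mem _ ?_ ?_
    · exact hr.weighted _ (fun f => (pnil, pcons t f)) (fun _ => 1) _ (fun _ _ _ _ => rfl)
        (fun _ => rfl) (PairSpan.snd _ _ (.pcons_right _ _ hr))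
    · rw [linearCombination_comp_linear (cuts k) _ _ r (fun _ => rfl)]
      refine PairSpan.map _ _ ?_ ?_ (ih rfl)
      · intro r y hr
        exact hr.weighted _ (fun x => (pcons t x, y)) (fun _ => 1) _ (fun _ _ _ _ => rfl)
          (fun _ => rfl) (PairSpan.fst _ _ (.pcons_right _ _ hr))
      · intro r x hr
        exact hr.weighted _ (fun y => (pcons t x, y)) (fun _ => 1) _ (fun _ _ _ _ => rfl)
          (fun _ => rfl) (PairSpan.snd_mem _ hr)
  | _ => cases hκ


theorem linearCombination_smul_fun {X M : Type*} [AddCommGroup M] [Module k M] (v : X → M)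
    (c : k) (r : X →₀ k) : Finsupp.linearCombination k (fun t => c • v t) r
      = c • Finsupp.linearCombination k v r := by
  simp only [Finsupp.linearCombination_apply, Finsupp.sum, Finset.smul_sum]
  exact Finset.sum_congr rfl fun _ _ => by rw [smul_comm]
theorem Relator.append_left {th : Theory} {κ : Kind} {r : Raw k α κ} (h : Relator k th κ r)
    (hκ : κ = .pls) (g : PTree α .pls) :
    Relator k th .pls ((hκ ▸ r : Raw k α .pls).mapDomain fun x => x.append g) := by
  induction h with
  | base κ r h => cases h <;> cases hκ
  | pcons_left r f hr ih =>
    simp only [← Finsupp.mapDomain_comp, Function.comp_def, append]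
    exact .pcons_left r (f.append g) hr
  | pcons_right t r hr ih =>
    have := Relator.pcons_right t _ (ih rfl)
    simp only [← Finsupp.mapDomain_comp, Function.comp_def, append] at this ⊢
    exact this
  | _ => cases hκ

theorem Relator.append_right {th : Theory} {r : Raw k α .pls} (h : Relator k th .pls r)
    (g : PTree α .pls) : Relator k th .pls (r.mapDomain fun x => g.append x) := by
  match g with
  | pnil =>
    have : r.mapDomain (fun x : PTree α .pls => append pnil x) = r := by
      simp only [append]; exact Finsupp.mapDomain_id
    rwa [this]
  | pcons t g =>
    have := Relator.pcons_right t _ (h.append_right g)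
    simp only [← Finsupp.mapDomain_comp, Function.comp_def, append] at this ⊢
    exact this

theorem RelSpan.of {th : Theory} {κ : Kind} {r : Raw k α κ} (h : Relator k th κ r) :
    r ∈ RelSpan k th α κ := Submodule.subset_span h

theorem RelSpan.comp {th : Theory} {κ₁ κ₂ κ₃ : Kind} (F : PTree α κ₁ → PTree α κ₂)
    (G : PTree α κ₂ → PTree α κ₃) {r : Raw k α κ₁} (h : Relator k th κ₁ r)
    (hF : Relator k th κ₁ r → Relator k th κ₂ (r.mapDomain F))
    (hG : ∀ r, Relator k th κ₂ r → Relator k th κ₃ (r.mapDomain G)) :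
    Relator k th κ₃ (r.mapDomain fun x => G (F x)) := by
  have := hG _ (hF h)
  rwa [← Finsupp.mapDomain_comp] at this

/-- A term that is a weighted tree or zero, depending on lengths and degrees only. -/
theorem Relator.weighted_ite {th : Theory} {κ κ' : Kind}
    (F : PTree α κ → PTree α κ') (P : PTree α κ → Prop) [DecidablePred P] (w : PTree α κ → k)
    {r : Raw k α κ} (hr : Relator k th κ r)
    (hP : ∀ t t', t.len = t'.len → t.deg = t'.deg → (P t ↔ P t'))
    (hw : ∀ t t', t.len = t'.len → t.deg = t'.deg → w t = w t')
    (hF : Relator k th κ' (r.mapDomain F)) :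
    Finsupp.linearCombination k (fun t => if P t then single (F t) (w t) else 0) r
      ∈ RelSpan k th α κ' := by
  refine hr.weighted _ F (fun t => if P t then w t else 0) _ (fun t t' h1 h2 => ?_)
    (fun t => ?_) (RelSpan.of hF)
  · simp only [hP t t' h1 h2, hw t t' h1 h2]
  · split_ifs <;> simp

theorem Relator.openSum_left {r : Raw k α .sps} (hr : Relator k .free .sps r)
    (g : PTree α .pls) (y : PTree α .sps) :
    Finsupp.linearCombination k (fun x => openSum k (x, y) g) r ∈ RelSpan k .free α .pl := by
  unfold openSum
  rw [linearCombination_comm]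
  refine linearCombination_mem _ _ _ fun w _ => ?_
  rw [linearCombination_comm]
  refine linearCombination_mem _ _ _ fun v _ => ?_
  refine hr.weighted_ite _ _ _ (fun t t' h1 h2 => ?_) (fun t t' h1 h2 => ?_)
    (.pvert_left r (append w.1 (pcons (pvert y v.1) v.2)) hr)
  · simp only [h1]
  · simp only [h2]

theorem Relator.openSum_right {r : Raw k α .sps} (hr : Relator k .free .sps r)
    (g : PTree α .pls) (x : PTree α .sps) :
    Finsupp.linearCombination k (fun y => openSum k (x, y) g) r ∈ RelSpan k .free α .pl := by
  unfold openSum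
  rw [linearCombination_comm]
  refine linearCombination_mem _ _ _ fun w _ => ?_
  rw [linearCombination_comm]
  refine linearCombination_mem _ _ _ fun v _ => ?_
  refine hr.weighted_ite _ _ _ (fun t t' h1 h2 => ?_) (fun t t' h1 h2 => ?_) ?_
  · simp only [h1]
  · simp only [h1, h2]
  · exact RelSpan.comp (fun y => pcons (pvert y v.1) v.2) _ hr
      (fun hr => RelSpan.comp (fun y => pvert y v.1) _ hr (.pvert_left _ _)
        (fun r => .pcons_left r _))
      (fun r hr => RelSpan.comp (fun y => append w.1 y) _ hr (fun h => h.append_right _)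
        (fun r => .pvert_right _ r))

theorem len_append (g h : PTree α .pls) : (g.append h).len = g.len + h.len := by
  match g with
  | pnil => simp [append, len]
  | pcons t g => simp [append, len, len_append g h]; omega

theorem Relator.openSum_cuts {r : Raw k α .pls} (hr : Relator k .free .pls r)
    (z : PTree α .sps × PTree α .sps) :
    Finsupp.linearCombination k (fun g => openSum k z g) r ∈ RelSpan k .free α .pl := by
  unfold openSum
  rw [linearCombination_comp_linear (cuts k) _ _ r (fun _ => rfl)]
  refine PairSpan.map _ _ ?_ ?_ (hr.cuts_mem rfl)
  · intro r y hr
    dsimp only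
    rw [linearCombination_comm]
    refine linearCombination_mem _ _ _ fun v _ => ?_
    refine hr.weighted_ite _ _ _ (fun t t' h1 h2 => ?_) (fun t t' h1 h2 => ?_) ?_
    · simp only [h1]
    · simp only [h1, h2]
    · exact RelSpan.comp (fun y => append y _) _ hr (fun h => h.append_left rfl _)
        (fun r => .pvert_right _ r)
  · intro r y hr
    dsimp only
    rw [linearCombination_comp_linear (cuts k) _ _ r (fun _ => rfl)]
    refine PairSpan.map _ _ ?_ ?_ (hr.cuts_mem rfl)
    · intro r x hr
      refine hr.weighted_ite _ _ _ (fun t t' h1 h2 => ?_) (fun t t' h1 h2 => ?_) ?_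
      · simp only [h1]
      · simp only [h1]
      · exact RelSpan.comp (fun g => pcons (pvert z.2 g) x) _ hr
          (fun hr => RelSpan.comp (fun g => pvert z.2 g) _ hr (.pvert_right _ _)
            (fun r => .pcons_left r _))
          (fun r hr => RelSpan.comp (fun g => append y g) _ hr (fun h => h.append_right _)
            (fun r => .pvert_right _ r))
    · intro r x hr
      refine hr.weighted_ite _ _ _ (fun t t' h1 h2 => ?_) (fun t t' h1 h2 => ?_) ?_
      · simp only [h1]
      · simp only [h1]
      · exact RelSpan.comp (fun g => append y (pcons (pvert z.2 x) g)) _ hr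
          (fun hr => RelSpan.comp (fun g => pcons (pvert z.2 x) g) _ hr (.pcons_right _ _)
            (fun r h => h.append_right _))
          (fun r => .pvert_right _ r)

/-- Spatial vertices of `OC_∞`: the brackets `l_n`, `n ≥ 2`. -/
def InfVertex (w : Vtx) (n : ℕ) : Prop := w = .l ∧ 2 ≤ n

/-- Planar vertices of `OC_∞`: the corollae `n_{p,q}`, `2p + q ≥ 2`. -/
def InfCorolla (p q : ℕ) : Prop := 2 ≤ 2 * p + q

/-- The invariants shared by the terms of the differential of `t`. -/
def DTerm {κ : Kind} (t s : PTree α κ) : Prop :=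
  s.len = t.len ∧ s.deg = t.deg + 1 ∧ s.labels = t.labels ∧ s.planar = t.planar ∧
    (t.Adm InfVertex InfCorolla → s.Adm InfVertex InfCorolla)

theorem supported_mapDomain {X Y : Type} {S : Set X} {S' : Set Y} (F : X → Y)
    (hF : ∀ x ∈ S, F x ∈ S') {r : X →₀ k} (hr : r ∈ Finsupp.supported k k S) :
    r.mapDomain F ∈ Finsupp.supported k k S' := by
  classical
  rw [Finsupp.mem_supported] at hr ⊢
  intro y hy
  obtain ⟨x, hx, rfl⟩ := Finset.mem_image.mp (Finsupp.mapDomain_support hy)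
  exact hF x (hr hx)

theorem unshuffles_supp : ∀ f : PTree α .sps, unshuffles k f ∈ Finsupp.supported k k
    {z | z.1.len + z.2.len = f.len ∧ z.1.deg + z.2.deg = f.deg ∧
      z.1.labels + z.2.labels = f.labels ∧ z.1.planar + z.2.planar = f.planar ∧
      (f.Adm InfVertex InfCorolla →
        z.1.Adm InfVertex InfCorolla ∧ z.2.Adm InfVertex InfCorolla)}
  | snil => by
    rw [unshuffles]
    exact Finsupp.single_mem_supported k 1 (by simp [len, deg, labels, planar, Adm])
  | scons t f => by
    rw [unshuffles]
    refine linearCombination_mem _ _ _ fun z hz => ?_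
    obtain ⟨h1, h2, h3, h4, h5⟩ := (Finsupp.mem_supported k _).1 (unshuffles_supp f)
      (Finsupp.mem_support_iff.2 hz)
    refine Submodule.add_mem _ (Finsupp.single_mem_supported k _ ?_)
      (Finsupp.single_mem_supported k _ ?_)
    · refine ⟨?_, ?_, ?_, ?_, fun h => ?_⟩ <;> simp only [len, deg, labels, planar, Adm] at *
      · omega
      · omega
      · rw [← h3, add_assoc]
      · omega
      · exact ⟨⟨h.1, (h5 h.2).1⟩, (h5 h.2).2⟩
    · refine ⟨?_, ?_, ?_, ?_, fun h => ?_⟩ <;> simp only [len, deg, labels, planar, Adm] at *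
      · omega
      · omega
      · rw [← h3]; abel
      · omega
      · exact ⟨(h5 h.2).1, h.1, (h5 h.2).2⟩

theorem cuts_supp : ∀ f : PTree α .pls, cuts k f ∈ Finsupp.supported k k
    {z | z.1.len + z.2.len = f.len ∧ z.1.deg + z.2.deg = f.deg ∧
      z.1.labels + z.2.labels = f.labels ∧ z.1.planar + z.2.planar = f.planar ∧
      (f.Adm InfVertex InfCorolla →
        z.1.Adm InfVertex InfCorolla ∧ z.2.Adm InfVertex InfCorolla)}
  | pnil => by
    rw [cuts]
    exact Finsupp.single_mem_supported k 1 (by simp [len, deg, labels, planar, Adm])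
  | pcons t f => by
    rw [cuts]
    refine Submodule.add_mem _ (Finsupp.single_mem_supported k _ ?_)
      (linearCombination_mem _ _ _ fun z hz => ?_)
    · simp [len, deg, labels, planar, Adm]
      exact fun a b => ⟨a, b⟩
    obtain ⟨h1, h2, h3, h4, h5⟩ := (Finsupp.mem_supported k _).1 (cuts_supp f)
      (Finsupp.mem_support_iff.2 hz)
    refine Finsupp.single_mem_supported k _ ?_
    refine ⟨?_, ?_, ?_, ?_, fun h => ?_⟩ <;> simp only [len, deg, labels, planar, Adm] at *
    · omega
    · omega
    · rw [← h3, add_assoc]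
    · omega
    · exact ⟨⟨h.1, (h5 h.2).1⟩, (h5 h.2).2⟩

theorem append_invariants : ∀ g h : PTree α .pls,
    (g.append h).deg = g.deg + h.deg ∧ (g.append h).labels = g.labels + h.labels ∧
    (g.append h).planar = g.planar + h.planar ∧ ((g.append h).Adm InfVertex InfCorolla ↔
      g.Adm InfVertex InfCorolla ∧ h.Adm InfVertex InfCorolla)
  | pnil, h => by simp [append, deg, labels, planar, Adm]
  | pcons t g, h => by
    obtain ⟨h1, h2, h3, h4⟩ := append_invariants g h
    simp only [append, deg, labels, planar, Adm, h1, h2, h3, h4, add_assoc, and_assoc, and_self]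

theorem openSum_supp (f x y : PTree α .sps) (g : PTree α .pls)
    (hl : x.len + y.len = f.len) (hd : x.deg + y.deg = f.deg)
    (hL : x.labels + y.labels = f.labels) (hp : x.planar + y.planar = f.planar)
    (hA : f.Adm InfVertex InfCorolla → x.Adm InfVertex InfCorolla ∧ y.Adm InfVertex InfCorolla) :
    openSum k (x, y) g ∈ Finsupp.supported k k {s | DTerm (pvert f g) s} := by
  refine linearCombination_mem _ _ _ fun w hw => linearCombination_mem _ _ _ fun v hv => ?_
  obtain ⟨w1, w2, w3, w4, w5⟩ := (Finsupp.mem_supported k _).1 (cuts_supp g)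
    (Finsupp.mem_support_iff.2 hw)
  obtain ⟨v1, v2, v3, v4, v5⟩ := (Finsupp.mem_supported k _).1 (cuts_supp w.2)
    (Finsupp.mem_support_iff.2 hv)
  unfold openTerm
  split_ifs with hc
  swap
  · exact Submodule.zero_mem _
  refine Finsupp.single_mem_supported k _ ?_
  obtain ⟨a1, a2, a3, a4⟩ := append_invariants w.1 (pcons (pvert y v.1) v.2)
  dsimp only at *
  refine ⟨rfl, ?_, ?_, ?_, fun h => ?_⟩
  · simp only [deg, a1, len_append, len]
    push_cast [← hl, ← hd, ← w1, ← w2, ← v1, ← v2]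
    ring
  · simp only [labels, a2, ← hL, ← w3, ← v3]
    abel
  · simp only [planar, a3, ← hp, ← w4, ← v4]
    omega
  · simp only [Adm, a4, InfCorolla, len_append, len] at h ⊢
    have := hA h.2.1
    have := w5 h.2.2
    have := v5 this.2
    refine ⟨by omega, (hA h.2.1).1, (w5 h.2.2).1, ⟨hc.1, (hA h.2.1).2, this.1⟩, this.2⟩

theorem dRaw_supp {κ : Kind} (t : PTree α κ) :
    dRaw k t ∈ Finsupp.supported k k {s | DTerm t s} := by
  induction t with
  | leaf a => exact Submodule.zero_mem _
  | snil => exact Submodule.zero_mem _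
  | edge => exact Submodule.zero_mem _
  | pnil => exact Submodule.zero_mem _
  | vert w f ih =>
    cases w with
    | l =>
      rw [dRaw]
      refine Submodule.sub_mem _ (linearCombination_mem _ _ _ fun z hz => ?_)
        (supported_mapDomain _ ?_ ih)
      · obtain ⟨h1, h2, h3, h4, h5⟩ := (Finsupp.mem_supported k _).1 (unshuffles_supp f)
          (Finsupp.mem_support_iff.2 hz)
        unfold bracketTerm
        split_ifs with hc
        swap
        · exact Submodule.zero_mem _
        refine Finsupp.single_mem_supported k _ ?_
        refine ⟨rfl, ?_, ?_, ?_, fun h => ?_⟩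
        · simp only [deg, len, ← h1, ← h2]; push_cast; ring
        · simp only [labels, h3]
        · simp only [planar, h4]
        · simp only [Adm, InfVertex, len] at h ⊢
          have := h5 h.2
          refine ⟨⟨trivial, by omega⟩, ⟨⟨trivial, hc.1⟩, this.1⟩, this.2⟩
      · rintro s ⟨h1, h2, h3, h4, h5⟩
        refine ⟨rfl, ?_, ?_, ?_, fun h => ?_⟩
        · simp only [deg, h1, h2]; ring
        · simpa only [labels] using h3
        · simpa only [planar] using h4
        · exact ⟨by rw [h1]; exact h.1, h5 h.2⟩
    | m =>
      rw [dRaw]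
      refine supported_mapDomain _ ?_ ih
      rintro s ⟨h1, h2, h3, h4, h5⟩
      refine ⟨rfl, ?_, ?_, ?_, fun h => ?_⟩
      · simp only [deg, h2]
      · simpa only [labels] using h3
      · simpa only [planar] using h4
      · exact ⟨by rw [h1]; exact h.1, h5 h.2⟩
  | scons t f ih1 ih2 =>
    rw [dRaw]
    refine Submodule.add_mem _ (supported_mapDomain _ ?_ ih1)
      (Submodule.smul_mem _ _ (supported_mapDomain _ ?_ ih2)) <;>
    · rintro s ⟨h1, h2, h3, h4, h5⟩
      refine ⟨?_, ?_, ?_, ?_, fun h => ?_⟩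
      · simp only [len, h1]
      · simp only [deg, h2]; ring
      · simp only [labels, h3]
      · simp only [planar, h4]
      · simp only [Adm] at h ⊢; tauto
  | pcons t f ih1 ih2 =>
    rw [dRaw]
    refine Submodule.add_mem _ (supported_mapDomain _ ?_ ih1)
      (Submodule.smul_mem _ _ (supported_mapDomain _ ?_ ih2)) <;>
    · rintro s ⟨h1, h2, h3, h4, h5⟩
      refine ⟨?_, ?_, ?_, ?_, fun h => ?_⟩
      · simp only [len, h1]
      · simp only [deg, h2]; ring
      · simp only [labels, h3]
      · simp only [planar, h4]
      · simp only [Adm] at h ⊢; tauto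
  | pvert f g ih1 ih2 =>
    rw [dRaw]
    refine Submodule.add_mem _ (Submodule.add_mem _
      (linearCombination_mem _ _ _ fun z hz => ?_) (linearCombination_mem _ _ _ fun z hz => ?_))
      (Submodule.smul_mem _ _ (Submodule.add_mem _ (supported_mapDomain _ ?_ ih1)
        (Submodule.smul_mem _ _ (supported_mapDomain _ ?_ ih2))))
    · obtain ⟨h1, h2, h3, h4, h5⟩ := (Finsupp.mem_supported k _).1 (unshuffles_supp f)
        (Finsupp.mem_support_iff.2 hz)
      unfold closedTerm
      split_ifs with hc
      swap
      · exact Submodule.zero_mem _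
      refine Finsupp.single_mem_supported k _ ?_
      refine ⟨rfl, ?_, ?_, ?_, fun h => ?_⟩
      · simp only [deg, len, ← h1, ← h2]; push_cast; ring
      · simp only [labels, h3]
      · simp only [planar, h4]
      · simp only [Adm, InfVertex, InfCorolla, len] at h ⊢
        have := h5 h.2.1
        refine ⟨by omega, ⟨⟨⟨trivial, hc⟩, this.1⟩, this.2⟩, h.2.2⟩
    · obtain ⟨h1, h2, h3, h4, h5⟩ := (Finsupp.mem_supported k _).1 (unshuffles_supp f)
        (Finsupp.mem_support_iff.2 hz)
      exact openSum_supp f z.1 z.2 g h1 h2 h3 h4 h5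
    all_goals
      rintro s ⟨h1, h2, h3, h4, h5⟩
      refine ⟨rfl, ?_, ?_, ?_, fun h => ?_⟩
      · simp only [deg, h1, h2]; ring
      · simp only [labels, h3]
      · simp only [planar, h4]
      · simp only [Adm] at h ⊢; rw [h1]; tauto

theorem Relator.dRaw_mem {κ : Kind} {r : Raw k α κ} (h : Relator k .free κ r) :
    Finsupp.linearCombination k (dRaw k) r ∈ RelSpan k .free α κ := by
  have left : ∀ {κ₁ κ₂ κ₃ : Kind} (C : PTree α κ₁ → PTree α κ₂ → PTree α κ₃)
      (hC : ∀ r y, Relator k .free κ₁ r → Relator k .free κ₃ (r.mapDomain fun x => C x y))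
      (r : Raw k α κ₁) (y : PTree α κ₂) (_ : Relator k .free κ₁ r)
      (_ : Finsupp.linearCombination k (dRaw k) r ∈ RelSpan k .free α κ₁),
      Finsupp.linearCombination k (fun x => (dRaw k x).mapDomain (fun s => C s y)
        + ksgn k x.deg • (dRaw k y).mapDomain (fun h => C x h)) r ∈ RelSpan k .free α κ₃ := by
    intro κ₁ κ₂ κ₃ C hC r y hr ih
    rw [linearCombination_add_fun]
    refine Submodule.add_mem _ ?_ ?_
    · rw [linearCombination_comp_linear (dRaw k) (fun x => (dRaw k x).mapDomain fun s => C s y)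
        (Finsupp.lmapDomain k k fun s => C s y) r
        (fun _ => rfl)]
      exact RelSpan.mapDomain _ (fun r hr => RelSpan.of (hC r y hr)) ih
    · have : (fun x => ksgn k x.deg • (dRaw k y).mapDomain (fun h => C x h))
          = fun x => Finsupp.linearCombination k (fun h => single (C x h) (ksgn k x.deg))
            (dRaw k y) := by
        funext x
        rw [linearCombination_weighted (fun h => C x h) _ (ksgn k x.deg) _ fun _ _ => rfl]
      rw [this, linearCombination_comm]
      refine linearCombination_mem _ _ _ fun h _ => ?_
      exact hr.weighted _ (fun x => C x h) (fun x => ksgn k x.deg) _ (fun _ _ _ e => by rw [e])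
        (fun _ => rfl) (RelSpan.of (hC r h hr))
  have right : ∀ {κ₁ κ₂ κ₃ : Kind} (C : PTree α κ₂ → PTree α κ₁ → PTree α κ₃)
      (hC : ∀ r y, Relator k .free κ₁ r → Relator k .free κ₃ (r.mapDomain fun x => C y x))
      (r : Raw k α κ₁) (y : PTree α κ₂) (_ : Relator k .free κ₁ r)
      (_ : Finsupp.linearCombination k (dRaw k) r ∈ RelSpan k .free α κ₁),
      Finsupp.linearCombination k (fun x => (dRaw k y).mapDomain (fun s => C s x)
        + ksgn k y.deg • (dRaw k x).mapDomain (fun h => C y h)) r ∈ RelSpan k .free α κ₃ := by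
    intro κ₁ κ₂ κ₃ C hC r y hr ih
    rw [linearCombination_add_fun]
    refine Submodule.add_mem _ ?_ ?_
    · have : (fun x => (dRaw k y).mapDomain (fun s => C s x))
          = fun x => Finsupp.linearCombination k (fun h => single (C h x) (1 : k))
            (dRaw k y) := by
        funext x
        rw [linearCombination_weighted (fun h => C h x) _ (1 : k) _ fun _ _ => rfl, one_smul]
      rw [this, linearCombination_comm]
      refine linearCombination_mem _ _ _ fun h _ => ?_
      exact hr.weighted _ (fun x => C h x) (fun x => 1) _ (fun _ _ _ e => rfl)
        (fun _ => rfl) (RelSpan.of (hC r h hr))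
    · rw [linearCombination_comp_linear (dRaw k)
        (fun x => ksgn k y.deg • (dRaw k x).mapDomain fun h => C y h)
        (ksgn k y.deg • Finsupp.lmapDomain k k fun s => C y s) r (fun _ => rfl)]
      exact Submodule.smul_mem _ _
        (RelSpan.mapDomain _ (fun r hr => RelSpan.of (hC r y hr)) ih)
  have ones : ∀ {X Y : Type} (F : X → Y) (r : X →₀ k),
      r.mapDomain F = Finsupp.linearCombination k (fun h => single (F h) (1 : k)) r := by
    intro X Y F r
    rw [linearCombination_weighted F _ 1 _ fun _ _ => rfl, one_smul]
  induction h with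
  | base κ r h =>
    cases h with
    | swap _ a b f =>
      simp only [map_sub, Finsupp.linearCombination_single, one_smul, dRaw, smul_add,
        Finsupp.mapDomain_add, Finsupp.mapDomain_smul, ← Finsupp.mapDomain_comp,
        Function.comp_def]
      have A : (dRaw k a).mapDomain (fun s => scons s (scons b f))
          - (ksgn k (a.deg * b.deg) * ksgn k b.deg) •
            (dRaw k a).mapDomain (fun s => scons b (scons s f)) ∈ RelSpan k .free α .sps := by
        rw [ones, ones, linearCombination_sub_smul]
        refine linearCombination_mem _ _ _ fun s hs => ?_
        have hd := ((Finsupp.mem_supported k _).1 (dRaw_supp a) (Finsupp.mem_support_iff.2 hs)).2.1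
        convert Base.swap_mem (k := k) s b f using 1
        rw [Finsupp.smul_single, smul_eq_mul, mul_one, ← ksgn_add, hd]
        congr 3; ring
      have B : ksgn k a.deg • (dRaw k b).mapDomain (fun s => scons a (scons s f))
          - ksgn k (a.deg * b.deg) •
            (dRaw k b).mapDomain (fun s => scons s (scons a f)) ∈ RelSpan k .free α .sps := by
        have := Submodule.smul_mem (RelSpan k .free α .sps) (ksgn k a.deg)
          (x := (dRaw k b).mapDomain (fun s => scons a (scons s f))
            - (ksgn k a.deg * ksgn k (a.deg * b.deg)) •
              (dRaw k b).mapDomain (fun s => scons s (scons a f))) ?_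
        · rw [smul_sub, smul_smul, ← mul_assoc, ← ksgn_add k a.deg a.deg,
            ksgn_congr k (a := a.deg + a.deg) (b := 0) (by push_cast; grind), ksgn_zero,
            one_mul] at this
          exact this
        · rw [ones, ones, linearCombination_sub_smul]
          refine linearCombination_mem _ _ _ fun s hs => ?_
          have hd :=
            ((Finsupp.mem_supported k _).1 (dRaw_supp b) (Finsupp.mem_support_iff.2 hs)).2.1
          convert Base.swap_mem (k := k) a s f using 1
          rw [Finsupp.smul_single, smul_eq_mul, mul_one, ← ksgn_add, hd]
          congr 3; ring
      have D : (ksgn k a.deg * ksgn k b.deg) •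
            (dRaw k f).mapDomain (fun s => scons a (scons b s))
          - (ksgn k (a.deg * b.deg) * (ksgn k a.deg * ksgn k b.deg)) •
            (dRaw k f).mapDomain (fun s => scons b (scons a s)) ∈ RelSpan k .free α .sps := by
        rw [mul_comm (ksgn k (a.deg * b.deg)),
          ← smul_smul (ksgn k a.deg * ksgn k b.deg) (ksgn k (a.deg * b.deg)), ← smul_sub]
        refine Submodule.smul_mem _ _ ?_
        rw [ones, ones, linearCombination_sub_smul]
        refine linearCombination_mem _ _ _ fun s hs => ?_
        convert Base.swap_mem (k := k) a b s using 1
        rw [Finsupp.smul_single, smul_eq_mul, mul_one]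
      convert Submodule.add_mem _ (Submodule.add_mem _ A B) D using 1
      simp only [smul_smul]
      rw [mul_comm (ksgn k b.deg) (ksgn k a.deg)]
      abel
  | vert w r hr ih =>
    rw [Finsupp.linearCombination_mapDomain]
    cases w with
    | l =>
      have : (dRaw k ∘ PTree.vert Vtx.l : PTree α .sps → _) = fun f =>
          Finsupp.linearCombination k (bracketTerm k) (unshuffles k f)
            + (-Finsupp.lmapDomain k k (PTree.vert .l)) (dRaw k f) := by
        funext f
        simp only [Function.comp, dRaw, LinearMap.neg_apply, sub_eq_add_neg]; rfl
      rw [this, linearCombination_add_fun]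
      refine Submodule.add_mem _ ?_ ?_
      · rw [linearCombination_comp_linear (unshuffles k) _ _ r (fun _ => rfl)]
        refine PairSpan.map _ _ ?_ ?_ (hr.unshuffles_mem rfl)
        · intro r y hr
          refine hr.weighted_ite _ _ _ (fun t t' h1 h2 => ?_) (fun t t' h1 h2 => rfl) ?_
          · simp only [h1]
          · exact RelSpan.comp (fun x => scons (PTree.vert .l x) y) _ hr
              (fun hr => RelSpan.comp (PTree.vert .l) _ hr (.vert _ _)
                (fun r => .scons_left r _))
              (fun r => .vert _ r)
        · intro r x hr
          refine hr.weighted_ite _ _ _ (fun t t' h1 h2 => ?_) (fun t t' h1 h2 => rfl) ?_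
          · simp only [h1]
          · exact RelSpan.comp (fun y => scons (PTree.vert .l x) y) _ hr (.scons_right _ _)
              (fun r => .vert _ r)
      · rw [linearCombination_comp_linear (dRaw k) _ _ r (fun _ => rfl)]
        exact Submodule.neg_mem _ (RelSpan.mapDomain _ (fun r hr => RelSpan.of (.vert _ r hr)) ih)
    | m =>
      rw [linearCombination_comp_linear (dRaw k) (dRaw k ∘ PTree.vert .m)
        (Finsupp.lmapDomain k k (PTree.vert .m)) r
        (fun _ => by simp only [Function.comp, dRaw]; rfl)]
      exact RelSpan.mapDomain _ (fun r hr => RelSpan.of (.vert _ r hr)) ih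
  | scons_left r f hr ih =>
    rw [Finsupp.linearCombination_mapDomain]
    exact left scons (fun r y => .scons_left r y) r f hr ih
  | scons_right f r hr ih =>
    rw [Finsupp.linearCombination_mapDomain]
    exact right scons (fun r y => .scons_right y r) r f hr ih
  | pcons_left r f hr ih =>
    rw [Finsupp.linearCombination_mapDomain]
    exact left pcons (fun r y => .pcons_left r y) r f hr ih
  | pcons_right f r hr ih =>
    rw [Finsupp.linearCombination_mapDomain]
    exact right pcons (fun r y => .pcons_right y r) r f hr ih
  | pvert_left r g hr ih =>
    rw [Finsupp.linearCombination_mapDomain]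
    simp only [Function.comp_def, dRaw]
    rw [linearCombination_add_fun, linearCombination_add_fun]
    refine Submodule.add_mem _ (Submodule.add_mem _ ?_ ?_) ?_
    · rw [linearCombination_comp_linear (unshuffles k) _ _ r (fun _ => rfl)]
      refine PairSpan.map _ _ ?_ ?_ (hr.unshuffles_mem rfl)
      · intro r y hr
        refine hr.weighted_ite _ _ _ (fun t t' h1 h2 => ?_) (fun t t' h1 h2 => ?_) ?_
        · simp only [h1]
        · simp only [h1]
        · exact RelSpan.comp (fun x => scons (PTree.vert .l x) y) _ hr
            (fun hr => RelSpan.comp (PTree.vert .l) _ hr (.vert _ _)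
              (fun r => .scons_left r _))
            (fun r => .pvert_left r g)
      · intro r x hr
        refine hr.weighted_ite _ _ _ (fun t t' h1 h2 => ?_) (fun t t' h1 h2 => rfl) ?_
        · rfl
        · exact RelSpan.comp (fun y => scons (PTree.vert .l x) y) _ hr (.scons_right _ _)
            (fun r => .pvert_left r g)
    · rw [linearCombination_comp_linear (unshuffles k) _ _ r (fun _ => rfl)]
      exact PairSpan.map _ _ (fun r y hr => hr.openSum_left g y)
        (fun r x hr => hr.openSum_right g x) (hr.unshuffles_mem rfl)
    · obtain ⟨n, _, _, _, hn⟩ := hr.homog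
      have e : ∀ f, r f ≠ 0 → ksgn k (2 - 2 * f.len - g.len) •
          ((dRaw k f).mapDomain (fun h => pvert h g)
            + ksgn k f.deg • (dRaw k g).mapDomain fun h => pvert f h)
          = ksgn k (2 - 2 * n - g.len) • ((dRaw k f).mapDomain (fun h => pvert h g)
            + ksgn k f.deg • (dRaw k g).mapDomain fun h => pvert f h) :=
        fun f hf => by rw [(hn f hf).1]
      rw [linearCombination_congr' _ _ r e, linearCombination_smul_fun]
      exact Submodule.smul_mem _ _ (left pvert (fun r y => .pvert_left r y) r g hr ih)
  | pvert_right f r hr ih =>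
    rw [Finsupp.linearCombination_mapDomain]
    simp only [Function.comp_def, dRaw]
    rw [linearCombination_add_fun, linearCombination_add_fun]
    refine Submodule.add_mem _ (Submodule.add_mem _ ?_ ?_) ?_
    · rw [linearCombination_comm]
      refine linearCombination_mem _ _ _ fun z _ => ?_
      refine hr.weighted_ite _ _ _ (fun t t' h1 h2 => Iff.rfl) (fun t t' h1 h2 => ?_)
        (.pvert_right _ r hr)
      simp only [h1]
    · rw [linearCombination_comm]
      exact linearCombination_mem _ _ _ fun z _ => hr.openSum_cuts z
    · obtain ⟨n, _, _, _, hn⟩ := hr.homog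
      have e : ∀ g, r g ≠ 0 → ksgn k (2 - 2 * f.len - g.len) •
          ((dRaw k f).mapDomain (fun h => pvert h g)
            + ksgn k f.deg • (dRaw k g).mapDomain fun h => pvert f h)
          = ksgn k (2 - 2 * f.len - n) • ((dRaw k f).mapDomain (fun h => pvert h g)
            + ksgn k f.deg • (dRaw k g).mapDomain fun h => pvert f h) :=
        fun g hg => by rw [(hn g hg).1]
      rw [linearCombination_congr' _ _ r e, linearCombination_smul_fun]
      exact Submodule.smul_mem _ _ (right pvert (fun r y => .pvert_right y r) r f hr ih)


end Differential

section Spaces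

theorem RelSpan.le {th : Theory} {κ : Kind} {M : Type*} [AddCommGroup M] [Module k M]
    (N : Submodule k M) (F : Raw k α κ →ₗ[k] M) (h : ∀ r, Relator k th κ r → F r ∈ N) :
    RelSpan k th α κ ≤ N.comap F := Submodule.span_le.2 h

variable (k)

/-- Linear combinations of trees modulo the relations of the theory `th`. -/
abbrev Trees (th : Theory) (α : Type) (κ : Kind) := Raw k α κ ⧸ RelSpan k th α κ

/-- The class of a tree. -/
def mk (th : Theory) {κ : Kind} (t : PTree α κ) : Trees k th α κ :=
  Submodule.Quotient.mk (single t 1)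

/-- Relabelling of spatial leaves. -/
def relabel (th : Theory) {κ : Kind} (e : α → β) : Trees k th α κ →ₗ[k] Trees k th β κ :=
  Submodule.mapQ _ _ (Finsupp.lmapDomain k k (PTree.map e))
    (RelSpan.le _ _ fun _ hr => Relator.map_mem e hr)

/-- Composition with a fixed tree `t`. -/
def graftTree [DecidableEq α] (th : Theory) (i : α) (e : α → β) {κ : Kind} (t : PTree α κ) :
    Trees k th β .sp →ₗ[k] Trees k th β κ :=
  Submodule.mapQ _ _ (Finsupp.linearCombination k fun u => graftRaw k i e t u)
    (RelSpan.le _ _ fun _ hr => Relator.graft_mem_right i e t hr)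

theorem mk_surj (th : Theory) {κ : Kind} (x : Trees k th α κ) :
    x ∈ Submodule.span k (Set.range (mk k th : PTree α κ → Trees k th α κ)) := by
  obtain ⟨r, rfl⟩ := Submodule.Quotient.mk_surjective _ x
  induction r using Finsupp.induction_linear with
  | zero => exact Submodule.zero_mem _
  | add f g hf hg => exact Submodule.add_mem _ hf hg
  | single t c =>
    have : (Submodule.Quotient.mk (single t c) : Trees k th α κ) = c • mk k th t := by
      rw [mk, ← Submodule.Quotient.mk_smul, Finsupp.smul_single, smul_eq_mul, mul_one]
    rw [this]
    exact Submodule.smul_mem _ _ (Submodule.subset_span ⟨t, rfl⟩)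

theorem graftTree_mk [DecidableEq α] (th : Theory) (i : α) (e : α → β) {κ : Kind}
    (t : PTree α κ) (u : PTree β .sp) :
    graftTree k th i e t (mk k th u) = Submodule.Quotient.mk (graftRaw k i e t u) := by
  rw [graftTree, mk, Submodule.mapQ_apply, Finsupp.linearCombination_single, one_smul]

theorem graftTree_relator [DecidableEq α] (th : Theory) (i : α) (e : α → β) {κ : Kind} :
    RelSpan k th α κ ≤
      LinearMap.ker (Finsupp.linearCombination k (graftTree k th i e (κ := κ))) := by
  refine Submodule.span_le.2 fun r hr => ?_
  rw [SetLike.mem_coe, LinearMap.mem_ker]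
  ext1
  refine Finsupp.lhom_ext' fun u => LinearMap.ext_ring ?_
  have h1 : Finsupp.linearCombination k (graftTree k th i e (κ := κ)) r (mk k th u)
      = Submodule.Quotient.mk (Finsupp.linearCombination k (fun t => graftRaw k i e t u) r) := by
    rw [Finsupp.linearCombination_apply, Finsupp.linearCombination_apply, Finsupp.sum,
      Finsupp.sum, LinearMap.sum_apply]
    simp only [LinearMap.smul_apply, graftTree_mk]
    rw [← Submodule.mkQ_apply, map_sum]
    rfl
  exact h1.trans ((Submodule.Quotient.mk_eq_zero _).2 (hr.graft_mem i e u))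

/-- The bilinear composition `∘_i`. -/
def graft [DecidableEq α] (th : Theory) (i : α) (e : α → β) {κ : Kind} :
    Trees k th α κ →ₗ[k] Trees k th β .sp →ₗ[k] Trees k th β κ :=
  (RelSpan k th α κ).liftQ _ (graftTree_relator k th i e)

/-- The differential on linear combinations of trees. -/
def diff {κ : Kind} : Trees k .free α κ →ₗ[k] Trees k .free α κ :=
  Submodule.mapQ _ _ (Finsupp.linearCombination k (dRaw k))
    (RelSpan.le _ _ fun _ hr => Relator.dRaw_mem hr)

theorem graft_mk [DecidableEq α] (th : Theory) (i : α) (e : α → β) {κ : Kind}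
    (t : PTree α κ) (u : PTree β .sp) :
    graft k th i e (mk k th t) (mk k th u) = Submodule.Quotient.mk (graftRaw k i e t u) := by
  rw [← graftTree_mk, graft, mk, Submodule.liftQ_apply, Finsupp.linearCombination_single, one_smul]

theorem relabel_mk (th : Theory) (e : α → β) {κ : Kind} (t : PTree α κ) :
    relabel k th e (mk k th t) = mk k th (t.map e) := by
  rw [relabel, mk, Submodule.mapQ_apply, Finsupp.lmapDomain_apply, Finsupp.mapDomain_single, mk]

theorem mk_single (th : Theory) {κ : Kind} (t : PTree α κ) (c : k) :
    (Submodule.Quotient.mk (single t c) : Trees k th α κ) = c • mk k th t := by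
  rw [mk, ← Submodule.Quotient.mk_smul, Finsupp.smul_single, smul_eq_mul, mul_one]

/-- Colour of the root. -/
inductive Colour
  | spatial
  | planar

/-- The kind of trees with root of the given colour. -/
@[reducible] def Colour.kind : Colour → Kind
  | spatial => .sp
  | planar => .pl

/-- The spatial leaves are labelled bijectively by `0, …, p - 1`, and there are `q` planar leaves. -/
def Full (p q : ℕ) {κ : Kind} (t : PTree (Fin p) κ) : Prop :=
  t.labels = Finset.univ.val ∧ t.planar = q

/-- The span of the trees with `p` spatial and `q` planar leaves whose vertices are allowed by `S`
and `P`. -/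
def Span (th : Theory) (S : Vtx → ℕ → Prop) (P : ℕ → ℕ → Prop) (κ : Kind) (p q : ℕ) :
    Submodule k (Trees k th (Fin p) κ) :=
  Submodule.span k (mk k th '' {t | t.Adm S P ∧ Full p q t})

/-- Renumbering of the leaves `j ≠ i` of `T` in `T ∘_i U` where `U` has `m + 1` leaves. -/
def outer {p : ℕ} (i : Fin (p + 1)) (m : ℕ) (j : Fin (p + 1)) : Fin (p + m + 1) :=
  if j < i then ⟨j, by omega⟩ else ⟨j + m, by omega⟩

/-- Renumbering of the leaves of `U` in `T ∘_i U`. -/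
def inner {p : ℕ} (i : Fin (p + 1)) (m : ℕ) (j : Fin (m + 1)) : Fin (p + m + 1) :=
  ⟨i + j, by omega⟩

/-- The partial composition `T ∘_i U`, with the usual numbering of the leaves. -/
def circ (th : Theory) {κ : Kind} {p : ℕ} (i : Fin (p + 1)) (m : ℕ) :
    Trees k th (Fin (p + 1)) κ →ₗ[k] Trees k th (Fin (m + 1)) .sp →ₗ[k]
      Trees k th (Fin (p + m + 1)) κ :=
  (graft k th i (outer i m)).compl₂ (relabel k th (inner i m))

variable {k}

theorem map_invariants {S : Vtx → ℕ → Prop} {P : ℕ → ℕ → Prop} (e : α → β) {κ : Kind}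
    (t : PTree α κ) : (t.map e).labels = t.labels.map e ∧ (t.map e).planar = t.planar ∧
      ((t.map e).Adm S P ↔ t.Adm S P) := by
  induction t with
  | _ => simp_all [PTree.map, labels, planar, Adm, (deg_map e _).2]

theorem sub_invariants [DecidableEq α] {S : Vtx → ℕ → Prop} {P : ℕ → ℕ → Prop} (i : α)
    (e : α → β) (u : PTree β .sp) (hu : u.planar = 0) {κ : Kind} (t : PTree α κ) :
    (PTree.sub i e u t).labels = t.labels.bind (fun a => if a = i then u.labels else {e a}) ∧
      (PTree.sub i e u t).planar = t.planar ∧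
      (t.Adm S P → u.Adm S P → (PTree.sub i e u t).Adm S P) := by
  induction t with
  | leaf a => by_cases h : a = i <;> simp [PTree.sub, labels, planar, Adm, h, hu]
  | _ => simp_all [PTree.sub, labels, planar, Adm, len_sub]

theorem planar_eq_zero {κ : Kind} (t : PTree α κ) (h : κ = .sp ∨ κ = .sps) : t.planar = 0 := by
  induction t <;> simp_all [planar]

theorem splice_labels {p m : ℕ} (i : Fin (p + 1)) :
    ((Finset.univ : Finset (Fin (p + 1))).val.bind fun a =>
      if a = i then (Finset.univ : Finset (Fin (m + 1))).val.map (inner i m) else {outer i m a})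
      = (Finset.univ : Finset (Fin (p + m + 1))).val := by
  symm
  refine Multiset.eq_of_le_of_card_le
    ((Multiset.le_iff_subset Finset.univ.nodup).2 fun b _ => ?_) ?_
  · rw [Multiset.mem_bind]
    by_cases h1 : b.val < i.val
    · refine ⟨⟨b, by omega⟩, Finset.mem_univ (α := Fin _) _, ?_⟩
      rw [if_neg (by rw [Fin.ext_iff]; simp only; omega), Multiset.mem_singleton, outer,
        if_pos (by rw [Fin.lt_def]; exact h1)]
    · by_cases h2 : b.val ≤ i.val + m
      · refine ⟨i, Finset.mem_univ (α := Fin _) _, ?_⟩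
        rw [if_pos rfl, Multiset.mem_map]
        exact ⟨⟨b - i, by omega⟩, Finset.mem_univ (α := Fin _) _, by
          rw [inner, Fin.ext_iff]; simp only; omega⟩
      · refine ⟨⟨b - m, by omega⟩, Finset.mem_univ (α := Fin _) _, ?_⟩
        rw [if_neg (by rw [Fin.ext_iff]; simp only; omega), Multiset.mem_singleton, outer,
          if_neg (by rw [Fin.lt_def]; simp only; omega), Fin.ext_iff]
        simp only; omega
  · rw [Multiset.card_bind]
    change (∑ a : Fin (p + 1), _) ≤ _
    rw [Fin.sum_univ_succAbove _ i]
    simp [Fin.succAbove_ne]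
    omega

theorem mem_Span {th : Theory} {S : Vtx → ℕ → Prop} {P : ℕ → ℕ → Prop} {κ : Kind} {p q : ℕ}
    {t : PTree (Fin p) κ} (h : t.Adm S P) (h' : Full p q t) :
    mk k th t ∈ Span k th S P κ p q := Submodule.subset_span ⟨t, ⟨h, h'⟩, rfl⟩

theorem relabel_mem {th : Theory} {S : Vtx → ℕ → Prop} {P : ℕ → ℕ → Prop} {κ : Kind} {p q : ℕ}
    (σ : Equiv.Perm (Fin p)) {x : Trees k th (Fin p) κ} (hx : x ∈ Span k th S P κ p q) :
    relabel k th σ x ∈ Span k th S P κ p q := by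
  have : Span k th S P κ p q ≤ (Span k th S P κ p q).comap (relabel k th σ) := by
    refine Submodule.span_le.2 ?_
    rintro _ ⟨t, ⟨h1, h2, h3⟩, rfl⟩
    obtain ⟨g1, g2, g3⟩ := map_invariants (S := S) (P := P) σ t
    rw [SetLike.mem_coe, Submodule.mem_comap, relabel_mk]
    refine mem_Span (g3.2 h1) ⟨?_, g2.trans h3⟩
    rw [g1, h2]
    have := congrArg Finset.val (Finset.map_univ_equiv σ)
    rwa [Finset.map_val] at this
  exact this hx

theorem circ_mem {th : Theory} {S : Vtx → ℕ → Prop} {P : ℕ → ℕ → Prop} {κ : Kind} {p q m : ℕ}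
    (i : Fin (p + 1)) {x : Trees k th (Fin (p + 1)) κ} {y : Trees k th (Fin (m + 1)) .sp}
    (hx : x ∈ Span k th S P κ (p + 1) q) (hy : y ∈ Span k th S P .sp (m + 1) 0) :
    circ k th i m x y ∈ Span k th S P κ (p + m + 1) q := by
  induction hx using Submodule.span_induction with
  | zero => simp
  | add a b _ _ ha hb => rw [map_add]; exact Submodule.add_mem _ ha hb
  | smul c a _ ha => rw [map_smul]; exact Submodule.smul_mem _ _ ha
  | mem a ha =>
    obtain ⟨t, ⟨h1, h2, h3⟩, rfl⟩ := ha
    induction hy using Submodule.span_induction with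
    | zero => simp
    | add a b _ _ ha hb => rw [map_add]; exact Submodule.add_mem _ ha hb
    | smul c a _ ha => rw [map_smul]; exact Submodule.smul_mem _ _ ha
    | mem a ha =>
      obtain ⟨u, ⟨g1, g2, g3⟩, rfl⟩ := ha
      rw [circ, LinearMap.compl₂_apply, relabel_mk, graft_mk,
        graftRaw_eq _ _ _ _ (by rw [h2]; exact Multiset.count_univ i), mk_single]
      refine Submodule.smul_mem _ _ ?_
      obtain ⟨e1, e2, e3⟩ := map_invariants (S := S) (P := P) (inner i m) u
      obtain ⟨f1, f2, f3⟩ := sub_invariants (S := S) (P := P) i (outer i m) (u.map (inner i m))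
        (planar_eq_zero _ (Or.inl rfl)) t
      refine mem_Span (f3 h1 (e3.2 g1)) ⟨?_, f2.trans h3⟩
      rw [f1, e1, h2, g2]
      exact splice_labels i

end Spaces

section Collapse

variable (k)

/-- Spatial vertices of `OC`: the bracket `l_2`. -/
def OCVertex (w : Vtx) (n : ℕ) : Prop := w = .l ∧ n = 2

/-- Planar vertices of `OC`: `n_{1,0}` and `n_{0,2}`. -/
def OCCorolla (p q : ℕ) : Prop := (p = 1 ∧ q = 0) ∨ (p = 0 ∧ q = 2)

variable {k}

theorem Relator.adm {κ : Kind} {r : Raw k α κ} (h : Relator k .free κ r) :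
    ∃ P : Prop, ∀ t, r t ≠ 0 → (t.Adm OCVertex OCCorolla ↔ P) := by
  have key : ∀ {κ κ' : Kind} (F : PTree α κ → PTree α κ') (r : Raw k α κ) (A : ℕ → Prop → Prop)
      (_ : ∀ x, (F x).Adm OCVertex OCCorolla ↔ A x.len (x.Adm OCVertex OCCorolla))
      (_ : Relator k .free κ r)
      (_ : ∃ P : Prop, ∀ t, r t ≠ 0 → (t.Adm OCVertex OCCorolla ↔ P)),
      ∃ P : Prop, ∀ t, r.mapDomain F t ≠ 0 → (t.Adm OCVertex OCCorolla ↔ P) := by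
    classical
    intro κ κ' F r A hA hr ⟨P, hP⟩
    obtain ⟨n, _, _, _, hn⟩ := hr.homog
    refine ⟨A n P, fun t ht => ?_⟩
    obtain ⟨s, hs, rfl⟩ := Finset.mem_image.mp
      (Finsupp.mapDomain_support (Finsupp.mem_support_iff.mpr ht))
    rw [Finsupp.mem_support_iff] at hs
    rw [hA, (hn s hs).1, propext (hP s hs)]
  induction h with
  | base κ r h =>
    cases h with
    | swap _ a b f =>
      refine ⟨(scons a (scons b f)).Adm OCVertex OCCorolla, fun t ht => ?_⟩
      by_cases h1 : scons a (scons b f) = t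
      · rw [h1]
      · by_cases h2 : scons b (scons a f) = t
        · rw [← h2]; simp only [Adm]; tauto
        · simp [h1, h2] at ht
  | vert w r hr ih => exact key _ _ (fun n P => OCVertex w n ∧ P) (fun _ => Iff.rfl) hr ih
  | scons_left r f hr ih =>
    exact key _ _ (fun _ P => P ∧ f.Adm OCVertex OCCorolla) (fun _ => Iff.rfl) hr ih
  | scons_right t r hr ih =>
    exact key _ _ (fun _ P => t.Adm OCVertex OCCorolla ∧ P) (fun _ => Iff.rfl) hr ih
  | pvert_left r g hr ih =>
    exact key _ _ (fun n P => OCCorolla n g.len ∧ P ∧ g.Adm OCVertex OCCorolla)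
      (fun _ => Iff.rfl) hr ih
  | pvert_right f r hr ih =>
    exact key _ _ (fun n P => OCCorolla f.len n ∧ f.Adm OCVertex OCCorolla ∧ P)
      (fun _ => Iff.rfl) hr ih
  | pcons_left r g hr ih =>
    exact key _ _ (fun _ P => P ∧ g.Adm OCVertex OCCorolla) (fun _ => Iff.rfl) hr ih
  | pcons_right t r hr ih =>
    exact key _ _ (fun _ P => t.Adm OCVertex OCCorolla ∧ P) (fun _ => Iff.rfl) hr ih

theorem Relator.toSwissCheese {κ : Kind} {r : Raw k α κ} (h : Relator k .free κ r) :
    Relator k .swissCheese κ r := by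
  induction h with
  | base κ r h => cases h with | swap _ a b f => exact .base _ _ (.swap _ a b f)
  | vert w r _ ih => exact .vert w r ih
  | scons_left r f _ ih => exact .scons_left r f ih
  | scons_right t r _ ih => exact .scons_right t r ih
  | pvert_left r g _ ih => exact .pvert_left r g ih
  | pvert_right f r _ ih => exact .pvert_right f r ih
  | pcons_left r g _ ih => exact .pcons_left r g ih
  | pcons_right t r _ ih => exact .pcons_right t r ih

variable (k)

open Classical in
/-- A tree built from `l_2`, `n_{1,0}`, `n_{0,2}` is sent to its class, any other tree to zero. -/
def collapseTree {κ : Kind} (t : PTree α κ) : Trees k .swissCheese α κ :=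
  if t.Adm OCVertex OCCorolla then mk k .swissCheese t else 0

theorem collapse_relator {κ : Kind} :
    RelSpan k .free α κ ≤ LinearMap.ker (Finsupp.linearCombination k
      (collapseTree k : PTree α κ → Trees k .swissCheese α κ)) := by
  refine RelSpan.le ⊥ _ fun r hr => ?_
  rw [Submodule.mem_bot]
  obtain ⟨P, hP⟩ := hr.adm
  by_cases h : P
  · have : ∀ t, r t ≠ 0 → (collapseTree k t : Trees k .swissCheese α κ) =
        (RelSpan k .swissCheese α κ).mkQ (single t 1) :=
      fun t ht => if_pos ((hP t ht).2 h)
    rw [linearCombination_congr' _ _ r this,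
      linearCombination_comp_linear (fun t => single t (1 : k)) _ _ r (fun _ => rfl)]
    have e : Finsupp.linearCombination k (fun t => single t (1 : k)) r = r := by
      rw [Finsupp.linearCombination_apply]
      simp
    rw [e, Submodule.mkQ_apply, Submodule.Quotient.mk_eq_zero]
    exact Submodule.subset_span hr.toSwissCheese
  · exact linearCombination_eq_zero _ _ fun t ht => if_neg fun h' => h ((hP t ht).1 h')

/-- The linear extension of `collapseTree`. -/
def collapse {κ : Kind} : Trees k .free α κ →ₗ[k] Trees k .swissCheese α κ :=
  (RelSpan k .free α κ).liftQ _ (collapse_relator k)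

theorem collapse_mk {κ : Kind} (t : PTree α κ) :
    collapse k (mk k .free t) = collapseTree k t := by
  rw [collapse, mk, Submodule.liftQ_apply, Finsupp.linearCombination_single, one_smul]

end Collapse

section Main

variable (k)

/-- `OC_∞` with root of colour `x`, `p` spatial and `q` planar leaves.  For `x = spatial` this is
`L_∞(p)` (if `q = 0`, otherwise it vanishes), for `x = planar` it is `N_∞(p,q)`. -/
abbrev OCinf (x : Colour) (p q : ℕ) : Submodule k (Trees k .free (Fin p) x.kind) :=
  Span k .free InfVertex InfCorolla x.kind p q

/-- The suboperad `OC` of the homology of the Swiss-cheese operad generated by `l_2`, `n_{1,0}` and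
`n_{0,2}`; its differential is zero. -/
abbrev OC (x : Colour) (p q : ℕ) : Submodule k (Trees k .swissCheese (Fin p) x.kind) :=
  Span k .swissCheese OCVertex OCCorolla x.kind p q

/-- The operad `L_∞`. -/
abbrev Linf (p : ℕ) := OCinf k .spatial p 0

/-- The operad `L` of (degree `-1`) Lie brackets, the spatial part of `OC`. -/
abbrev Lie (p : ℕ) := OC k .spatial p 0

/-- Elements of degree `n`. -/
def degreePart (th : Theory) (α : Type) (κ : Kind) (n : ℤ) : Submodule k (Trees k th α κ) :=
  Submodule.span k (mk k th '' {t | t.deg = n})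

variable {k} {x : Colour} {p q m : ℕ}

/-- A tree as element of `OC_∞`. -/
def OCinf.tree (t : PTree (Fin p) x.kind) (h : t.Adm InfVertex InfCorolla) (h' : Full p q t) :
    OCinf k x p q := ⟨mk k .free t, mem_Span h h'⟩

/-- A tree as element of `OC`. -/
def OC.tree (t : PTree (Fin p) x.kind) (h : t.Adm OCVertex OCCorolla) (h' : Full p q t) :
    OC k x p q := ⟨mk k .swissCheese t, mem_Span h h'⟩

/-- Action of the symmetric group on the spatial leaves. -/
def OCinf.perm (σ : Equiv.Perm (Fin p)) (T : OCinf k x p q) : OCinf k x p q :=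
  ⟨relabel k .free σ T.1, relabel_mem σ T.2⟩

/-- Action of the symmetric group on the spatial leaves. -/
def OC.perm (σ : Equiv.Perm (Fin p)) (T : OC k x p q) : OC k x p q :=
  ⟨relabel k .swissCheese σ T.1, relabel_mem σ T.2⟩

/-- The action of `L_∞` on `OC_∞` by grafting on a spatial leaf. -/
def OCinf.comp (T : OCinf k x (p + 1) q) (i : Fin (p + 1)) (l : Linf k (m + 1)) :
    OCinf k x (p + m + 1) q := ⟨circ k .free i m T.1 l.1, circ_mem i T.2 l.2⟩

/-- The action of `L` on `OC` by grafting on a spatial leaf. -/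
def OC.comp (T : OC k x (p + 1) q) (i : Fin (p + 1)) (l : Lie k (m + 1)) :
    OC k x (p + m + 1) q := ⟨circ k .swissCheese i m T.1 l.1, circ_mem i T.2 l.2⟩

theorem diff_mem {T : Trees k .free (Fin p) x.kind} (hT : T ∈ OCinf k x p q) :
    diff k T ∈ OCinf k x p q := by
  have : OCinf k x p q ≤ (OCinf k x p q).comap (diff k) := by
    refine Submodule.span_le.2 ?_
    rintro _ ⟨t, ⟨h1, h2, h3⟩, rfl⟩
    rw [SetLike.mem_coe, Submodule.mem_comap, diff, mk, Submodule.mapQ_apply,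
      Finsupp.linearCombination_single, one_smul]
    have hs := dRaw_supp (k := k) t
    rw [← Finsupp.sum_single (dRaw k t), Finsupp.sum, ← Submodule.mkQ_apply, map_sum]
    refine Submodule.sum_mem _ fun s hs' => ?_
    obtain ⟨_, _, g1, g2, g3⟩ := (Finsupp.mem_supported k _).1 hs hs'
    rw [Submodule.mkQ_apply, mk_single]
    exact Submodule.smul_mem _ _ (mem_Span (g3 h1) ⟨g1.trans h2, g2.trans h3⟩)
  exact this hT

/-- The differential of `OC_∞`. -/
def OCinf.d (T : OCinf k x p q) : OCinf k x p q := ⟨diff k T.1, diff_mem T.2⟩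

theorem adm_mono {κ : Kind} (t : PTree α κ) (h : t.Adm OCVertex OCCorolla) :
    t.Adm InfVertex InfCorolla := by
  induction t with
  | vert w f ih => exact ⟨⟨h.1.1, h.1.2.ge⟩, ih h.2⟩
  | pvert f g ih1 ih2 =>
    exact ⟨by have := h.1; unfold OCCorolla at this; unfold InfCorolla; omega, ih1 h.2.1, ih2 h.2.2⟩
  | scons t f ih1 ih2 => exact ⟨ih1 h.1, ih2 h.2⟩
  | pcons t f ih1 ih2 => exact ⟨ih1 h.1, ih2 h.2⟩
  | _ => trivial

theorem collapse_mem {l : Trees k .free (Fin p) .sp} (hl : l ∈ Linf k p) :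
    collapse k l ∈ Lie k p := by
  have : Linf k p ≤ (Lie k p).comap (collapse k) := by
    refine Submodule.span_le.2 ?_
    rintro _ ⟨t, ⟨_, h⟩, rfl⟩
    rw [SetLike.mem_coe, Submodule.mem_comap]
    erw [collapse_mk]
    unfold collapseTree
    split_ifs with ht
    · exact mem_Span ht h
    · exact Submodule.zero_mem _
  exact this hl

/-- The standard morphism `L_∞ → L` with `l_2 ↦ l_2` and `l_n ↦ 0` for `n ≥ 3`. -/
def Linf.toLie (l : Linf k p) : Lie k p := ⟨collapse k l.1, collapse_mem l.2⟩

/-- The action of `L_∞` on `OC`, through `L_∞ → L`. -/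
def OC.act (T : OC k x (p + 1) q) (i : Fin (p + 1)) (l : Linf k (m + 1)) :
    OC k x (p + m + 1) q := OC.comp T i (Linf.toLie l)

variable (k)

/-- Morphisms `OC_∞ → OC` of differential graded `L_∞`-modules: linear maps of degree zero that
are equivariant, commute with the differentials (that of `OC` is zero), and commute with grafting
elements of `L_∞` on spatial leaves and, for spatial roots, with grafting on elements of `L_∞`. -/
structure ModuleHom where
  toFun : ∀ {x : Colour} {p q : ℕ}, OCinf k x p q →ₗ[k] OC k x p q
  map_degree : ∀ {x : Colour} {p q : ℕ} (n : ℤ) (T : OCinf k x p q),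
    T.1 ∈ degreePart k .free (Fin p) x.kind n →
      (toFun T).1 ∈ degreePart k .swissCheese (Fin p) x.kind n
  map_perm : ∀ {x : Colour} {p q : ℕ} (σ : Equiv.Perm (Fin p)) (T : OCinf k x p q),
    toFun (OCinf.perm σ T) = OC.perm σ (toFun T)
  map_d : ∀ {x : Colour} {p q : ℕ} (T : OCinf k x p q), toFun (OCinf.d T) = 0
  map_right : ∀ {x : Colour} {p q m : ℕ} (T : OCinf k x (p + 1) q) (i : Fin (p + 1))
    (l : Linf k (m + 1)), toFun (OCinf.comp T i l) = OC.act (toFun T) i l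
  map_left : ∀ {p m : ℕ} (l : Linf k (p + 1)) (i : Fin (p + 1)) (T : Linf k (m + 1)),
    toFun (OCinf.comp l i T) = OC.comp (Linf.toLie l) i (toFun T)

/-- Spatial leaves with the given labels. -/
def leaves : List α → PTree α .sps
  | [] => snil
  | a :: s => scons (leaf a) (leaves s)

/-- A row of planar leaves. -/
def edges : ℕ → PTree α .pls
  | 0 => pnil
  | n + 1 => pcons edge (edges n)

variable {k}

theorem leaves_invariants {S : Vtx → ℕ → Prop} {P : ℕ → ℕ → Prop} (s : List α) :
    (leaves s).len = s.length ∧ (leaves s).labels = s ∧ (leaves s).planar = 0 ∧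
      (leaves s).Adm S P := by
  induction s with
  | nil => exact ⟨rfl, rfl, rfl, trivial⟩
  | cons a s ih =>
    obtain ⟨h1, h2, h3, h4⟩ := ih
    refine ⟨?_, ?_, ?_, trivial, h4⟩
    · simp [leaves, len, h1]
    · simp [leaves, labels, h2]
    · simp [leaves, planar, h3]

theorem edges_invariants {S : Vtx → ℕ → Prop} {P : ℕ → ℕ → Prop} (q : ℕ) :
    (edges q : PTree α .pls).len = q ∧ (edges q : PTree α .pls).labels = 0 ∧
      (edges q : PTree α .pls).planar = q ∧ (edges q : PTree α .pls).Adm S P := by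
  induction q with
  | zero => exact ⟨rfl, rfl, rfl, trivial⟩
  | succ q ih =>
    obtain ⟨h1, h2, h3, h4⟩ := ih
    refine ⟨?_, ?_, ?_, trivial, h4⟩
    · simp [edges, len, h1]
    · simp [edges, labels, h2]
    · simp [edges, planar, h3]; omega

/-- The corolla `l_n`. -/
def OCinf.l (n : ℕ) (h : 2 ≤ n) : OCinf k .spatial n 0 :=
  OCinf.tree (x := .spatial) (vert .l (leaves (List.finRange n)))
    (by
      obtain ⟨h1, _, _, h4⟩ := leaves_invariants (S := InfVertex) (P := InfCorolla)
        (List.finRange n)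
      exact ⟨⟨rfl, by rw [h1, List.length_finRange]; exact h⟩, h4⟩)
    (by
      obtain ⟨_, h2, h3, _⟩ := leaves_invariants (S := InfVertex) (P := InfCorolla)
        (List.finRange n)
      exact ⟨h2, h3⟩)

/-- The corolla `n_{p,q}`. -/
def OCinf.n (p q : ℕ) (h : 2 ≤ 2 * p + q) : OCinf k .planar p q :=
  OCinf.tree (x := .planar) (pvert (leaves (List.finRange p)) (edges q))
    (by
      obtain ⟨h1, _, _, h4⟩ := leaves_invariants (S := InfVertex) (P := InfCorolla)
        (List.finRange p)
      obtain ⟨g1, _, _, g4⟩ := edges_invariants (α := Fin p) (S := InfVertex) (P := InfCorolla) q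
      exact ⟨by rw [h1, g1, List.length_finRange]; exact h, h4, g4⟩)
    (by
      obtain ⟨_, h2, h3, _⟩ := leaves_invariants (S := InfVertex) (P := InfCorolla)
        (List.finRange p)
      obtain ⟨_, g2, g3, _⟩ := edges_invariants (α := Fin p) (S := InfVertex) (P := InfCorolla) q
      exact ⟨by simp only [labels, h2, g2, add_zero]; rfl, by simp only [planar, h3, g3, zero_add]⟩)

/-- The tree `n_{1,1} ∘ n_{1,0}`: `n_{1,0}` grafted on the planar leaf of `n_{1,1}`. -/
def OCinf.n11n10 : OCinf k .planar 2 0 :=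
  OCinf.tree (x := .planar)
    (pvert (leaves [0]) (pcons (pvert (leaves [1]) pnil) pnil))
    ⟨by unfold InfCorolla; decide, ⟨trivial, trivial⟩,
      ⟨by unfold InfCorolla; decide, ⟨trivial, trivial⟩, trivial⟩, trivial⟩
    ⟨by decide, rfl⟩

/-- The tree `n_{1,0} ∘ l_2`. -/
def OC.n10l2 : OC k .planar 2 0 :=
  OC.tree (x := .planar) (pvert (scons (vert .l (leaves [0, 1])) snil) pnil)
    ⟨Or.inl ⟨rfl, rfl⟩, ⟨⟨⟨rfl, rfl⟩, trivial, trivial, trivial⟩, trivial⟩, trivial⟩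
    ⟨by decide, rfl⟩

end Main

end Linear

end OpenClosed

end

/-! On spatial trees the map is the projection `L_∞ → L`. On planar trees only the vertices
`n_{1,0}`, `n_{0,2}` and `n_{1,1}` survive; a tree with any other planar corolla, or with some
`l_n`, `n ≥ 3`, goes to zero. The operations `n_{1,0}` and `n_{0,2}` keep their meaning, and
`n_{1,1}(x; -)` acts as a derivation `D_x` of the product `n_{0,2}` which vanishes on the bare
planar edge. It remains to choose `e` in `D_{x_r} ⋯ D_{x_1} n_{1,0}(z) = n_{1,0}(e(U; z))`, where `U
= [x_1, …, x_r]` and `e` takes values in the Lie algebra `L` of spatial trees.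

The value of `dT` can be nonzero a priori only where the root vertex is one of five corollae. For
`n_{0,3}`, `n_{1,1}`, `n_{1,2}` the conditions are associativity, centrality of `n_{1,0}`, and the
derivation rule. For `n_{2,1}` the condition is that `D` represents `L` up to signs, so that words
`U` matter only through their class in the enveloping algebra `U(L)`. For `n_{2,0}` it is `e(x U; y)
± e(y U; x) + e(U; [x,y]) = 0`, with `e(∅; z) = z`. If `e(U; z)` is read as a function of the
product `z U`, the last condition is again the defining relation of `U(L)`, applied to the first two
letters. Hence a linear retraction `U(L) → L`, natural in `L`, is all that is needed. In
characteristic zero the first Eulerian idempotent is one: the coefficient of `N` in the convolution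
power `Ψ^N` of the identity of `U(L)`. It sends `z x` to `½[z,x]`, which gives the constant `-1/2`
of the theorem.

The enveloping algebra is never constructed; everything is done on lists of homogeneous entries,
with Koszul signs of desuspensions. The formula `Ψ^N(x U) = ∑ (∑_{j<N} Ψ^j(U')·x) Ψ^N(U'')`, where
`U' ⊗ U''` is the shuffle coproduct and the dot is the adjoint action, gives the recursion
`psi_cons` for the action `psi` of `Ψ^N(U)`. The partial sums `lam` are polynomials in `N` without
constant term (`lam_poly`), and `eulerian` is their linear coefficient. The required identities are
`psi_br` (`Ψ^N(U)` acts on brackets through the coproduct), `psi_enveloping` (words act through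
`U(L)`), and `lam_cons_add_lam_cons`: the failure of the `n_{2,0}` condition before extracting
coefficients is a bracket of two partial sums, divisible by `N²`, whence
`eulerian_cons_add_eulerian_cons`.

The five root conditions are collected in `muRaw_topTerms`, and `dRaw_killed` adds the terms of the
differential inside the inputs by induction. Compatibility with grafting and relabelling is
naturality of the construction, proved with signs in `Twist.map_eulerian` and
`Substitution.map_muTree`. -/

noncomputable section

namespace OpenClosed

/-! ### Vector-valued polynomial functions of `N` and their linear coefficient. -/

section PolynomialFunctions

open Finset

variable {k : Type*} [Field k]
variable {V W Z : Type*} [AddCommGroup V] [Module k V] [AddCommGroup W] [Module k W]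
  [AddCommGroup Z] [Module k Z]

variable (k V) in
/-- The polynomial function `N ↦ ∑ N ^ i • c i` with coefficients `c`. -/
def polyFun : (ℕ →₀ V) →ₗ[k] (ℕ → V) :=
  Finsupp.lsum k fun i => LinearMap.pi fun N => (N : k) ^ i • LinearMap.id

theorem polyFun_apply (c : ℕ →₀ V) (N : ℕ) :
    polyFun k V c N = c.sum fun i v => (N : k) ^ i • v := by
  simp only [polyFun, Finsupp.coe_lsum, Finsupp.sum, Finset.sum_apply, LinearMap.pi_apply,
    LinearMap.smul_apply, LinearMap.id_apply]

/-- A linear functional turns a vanishing polynomial function into a scalar polynomial having all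
natural numbers as roots; these are infinitely many in characteristic zero. Functionals separate the
coefficients. -/
theorem polyFun_ker [CharZero k] : LinearMap.ker (polyFun k V) = ⊥ := by
  rw [LinearMap.ker_eq_bot']
  intro c hc
  ext i
  rw [Finsupp.zero_apply, ← Module.forall_dual_apply_eq_zero_iff k]
  intro φ
  let p : Polynomial k := c.sum fun i v => Polynomial.monomial i (φ v)
  have hp : p = 0 := by
    refine Polynomial.eq_zero_of_infinite_isRoot p
      (Set.Infinite.mono ?_ (Set.infinite_range_of_injective (Nat.cast_injective (R := k))))
    rintro _ ⟨N, rfl⟩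
    have := congrArg φ (congrFun hc N)
    rw [polyFun_apply] at this
    simp only [Finsupp.sum, map_sum, map_smul, Pi.zero_apply, map_zero, smul_eq_mul] at this
    simp only [Set.mem_ofPred_eq, Polynomial.IsRoot.def, p, Finsupp.sum,
      Polynomial.eval_finsetSum, Polynomial.eval_monomial]
    rw [← this]
    exact Finset.sum_congr rfl fun _ _ => mul_comm _ _
  have := congrArg (fun q => Polynomial.coeff q i) hp
  simp only [p, Finsupp.sum, Polynomial.finsetSum_coeff, Polynomial.coeff_monomial,
    Polynomial.coeff_zero, Finset.sum_ite_eq'] at this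
  by_cases h : c i = 0
  · rw [h, map_zero]
  · rwa [if_pos (Finsupp.mem_support_iff.2 h)] at this

variable (k V) in
/-- The coefficient of `N` of a polynomial function. -/
def linCoeff [CharZero k] : (ℕ → V) →ₗ[k] V :=
  Finsupp.lapply 1 ∘ₗ
    (LinearMap.exists_leftInverse_of_injective (polyFun k V) polyFun_ker).choose

theorem linCoeff_polyFun [CharZero k] (c : ℕ →₀ V) : linCoeff k V (polyFun k V c) = c 1 := by
  have := (LinearMap.exists_leftInverse_of_injective (polyFun k V) polyFun_ker).choose_spec
  rw [linCoeff, LinearMap.comp_apply, ← LinearMap.comp_apply _ (polyFun k V), this]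
  rfl

variable (k V) in
/-- Polynomial functions all of whose monomials have degree at least `n`. -/
def PolyFrom (n : ℕ) : Submodule k (ℕ → V) :=
  Submodule.span k {f | ∃ i, n ≤ i ∧ ∃ v : V, f = fun N : ℕ => (N : k) ^ i • v}

theorem pow_smul_mem {n i : ℕ} (h : n ≤ i) (v : V) :
    (fun N : ℕ => (N : k) ^ i • v) ∈ PolyFrom k V n := Submodule.subset_span ⟨i, h, v, rfl⟩

theorem linCoeff_pow [CharZero k] (i : ℕ) (v : V) :
    linCoeff k V (fun N : ℕ => (N : k) ^ i • v) = if i = 1 then v else 0 := by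
  have : (fun N : ℕ => (N : k) ^ i • v) = polyFun k V (Finsupp.single i v) := by
    funext N
    rw [polyFun_apply, Finsupp.sum_single_index (h := fun i v => (N : k) ^ i • v) (smul_zero _)]
  rw [this, linCoeff_polyFun, Finsupp.single_apply]

theorem PolyFrom.mono {m n : ℕ} (h : m ≤ n) : PolyFrom k V n ≤ PolyFrom k V m := by
  refine Submodule.span_mono ?_
  rintro _ ⟨i, hi, v, rfl⟩
  exact ⟨i, h.trans hi, v, rfl⟩

theorem const_mem_PolyFrom (v : V) : (fun _ : ℕ => v) ∈ PolyFrom k V 0 := by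
  simpa using pow_smul_mem (k := k) (le_refl 0) v

theorem PolyFrom.apply_mem {n : ℕ} (Φ : (ℕ → V) →ₗ[k] W) (S : Submodule k W)
    (h : ∀ i v, n ≤ i → Φ (fun N : ℕ => (N : k) ^ i • v) ∈ S) {f : ℕ → V}
    (hf : f ∈ PolyFrom k V n) : Φ f ∈ S := by
  have : PolyFrom k V n ≤ S.comap Φ := by
    refine Submodule.span_le.2 ?_
    rintro _ ⟨i, hi, v, rfl⟩
    exact h i v hi
  exact this hf

/-- Orders of vanishing at `N = 0` add. With `m = n = 1` this shows that a bracket of two partial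
sums has no linear coefficient. -/
theorem PolyFrom.bilin (B : V →ₗ[k] W →ₗ[k] Z) {m n : ℕ} {f : ℕ → V} {g : ℕ → W}
    (hf : f ∈ PolyFrom k V m) (hg : g ∈ PolyFrom k W n) :
    (fun N => B (f N) (g N)) ∈ PolyFrom k Z (m + n) := by
  refine PolyFrom.apply_mem (LinearMap.pi fun N => B.flip (g N) ∘ₗ LinearMap.proj N) _
    (fun i v hi => ?_) hf
  refine PolyFrom.apply_mem (LinearMap.pi fun N : ℕ => B ((N : k) ^ i • v) ∘ₗ LinearMap.proj N) _
    (fun j w hj => ?_) hg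
  convert pow_smul_mem (k := k) (add_le_add hi hj) (B v w) using 1
  funext N
  simp [smul_smul, pow_add]

/-- Summation of a polynomial over `j < N` is polynomial in `N` and vanishes at `N = 0`. -/
theorem PolyFrom.sum_range [CharZero k] {f : ℕ → V} (hf : f ∈ PolyFrom k V 0) :
    (fun N => ∑ j ∈ range N, f j) ∈ PolyFrom k V 1 := by
  have e : (fun N => ∑ j ∈ range N, f j)
      = (LinearMap.pi fun N => ∑ j ∈ range N, LinearMap.proj j : (ℕ → V) →ₗ[k] (ℕ → V)) f := by
    funext N
    simp
  rw [e]
  refine PolyFrom.apply_mem _ _ (fun p v _ => ?_) hf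
  -- Faulhaber's formula. The exponents `p + 1 - i` with `i ≤ p` are all positive.
  have e : (LinearMap.pi fun N => ∑ j ∈ range N, LinearMap.proj j : (ℕ → V) →ₗ[k] (ℕ → V))
      (fun N : ℕ => (N : k) ^ p • v) = ∑ i ∈ range (p + 1),
        ((bernoulli i * (p + 1).choose i / (p + 1) : ℚ) : k) •
          fun N : ℕ => ((N : k) ^ (p + 1 - i) • v) := by
    funext N
    have := congrArg (fun q : ℚ => (q : k)) (sum_range_pow N p)
    push_cast at this
    simp only [LinearMap.pi_apply, LinearMap.sum_apply, LinearMap.proj_apply, Finset.sum_apply,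
      Pi.smul_apply]
    rw [← Finset.sum_smul, this, Finset.sum_smul]
    refine Finset.sum_congr rfl fun i _ => ?_
    rw [smul_smul]
    push_cast
    congr 1
    ring
  rw [e]
  refine Submodule.sum_mem _ fun i hi => Submodule.smul_mem _ _ (pow_smul_mem ?_ v)
  have := Finset.mem_range.1 hi
  omega

theorem linCoeff_eq_zero [CharZero k] {f : ℕ → V} (hf : f ∈ PolyFrom k V 2) :
    linCoeff k V f = 0 := by
  rw [← Submodule.mem_bot k]
  refine PolyFrom.apply_mem _ _ (fun i v hi => ?_) hf
  rw [linCoeff_pow, if_neg (by omega)]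
  exact Submodule.zero_mem _

/-- The left inverses chosen for `V` and for `W` are unrelated outside polynomial functions, so
naturality holds for polynomial `f` only and is checked on monomials. -/
theorem linCoeff_map [CharZero k] (φ : V →ₗ[k] W) {f : ℕ → V} (hf : f ∈ PolyFrom k V 0) :
    linCoeff k W (fun N => φ (f N)) = φ (linCoeff k V f) := by
  rw [← sub_eq_zero, ← Submodule.mem_bot k]
  refine PolyFrom.apply_mem (linCoeff k W ∘ₗ (LinearMap.pi fun N => φ ∘ₗ LinearMap.proj N)
    - φ ∘ₗ linCoeff k V) _ (fun i v hi => ?_) hf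
  rw [Submodule.mem_bot, LinearMap.sub_apply, LinearMap.comp_apply, LinearMap.comp_apply,
    linCoeff_pow]
  have : (LinearMap.pi fun N => φ ∘ₗ LinearMap.proj N : (ℕ → V) →ₗ[k] (ℕ → W))
      (fun N : ℕ => (N : k) ^ i • v) = fun N : ℕ => (N : k) ^ i • φ v := by
    funext N
    simp
  rw [this, linCoeff_pow]
  split_ifs <;> simp

/-- Modulo `S` the function is zero, and the linear coefficient is natural for the quotient map. -/
theorem linCoeff_mem [CharZero k] (S : Submodule k V) {f : ℕ → V} (hf : f ∈ PolyFrom k V 0)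
    (h : ∀ N, f N ∈ S) : linCoeff k V f ∈ S := by
  rw [← Submodule.Quotient.mk_eq_zero, ← Submodule.mkQ_apply, ← linCoeff_map _ hf]
  have : (fun N => S.mkQ (f N)) = 0 := by
    funext N
    exact (Submodule.Quotient.mk_eq_zero _).2 (h N)
  rw [this, map_zero]

theorem linCoeff_sum_const [CharZero k] (v : V) :
    linCoeff k V (fun N => ∑ _j ∈ range N, v) = v := by
  have : (fun N => ∑ _j ∈ range N, v) = fun N : ℕ => (N : k) ^ 1 • v := by
    funext N
    rw [Finset.sum_const, Finset.card_range, pow_one, Nat.cast_smul_eq_nsmul]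
  rw [this, linCoeff_pow, if_pos rfl]

/-- The sum of `j < N` is `(N² - N)/2`; its linear coefficient is the origin of `-1/2` in the
theorem. -/
theorem linCoeff_sum_id [CharZero k] (v : V) :
    linCoeff k V (fun N => ∑ j ∈ range N, j • v) = (-(1 / 2) : k) • v := by
  have : (fun N => ∑ j ∈ range N, j • v) = (1 / 2 : k) • (fun N : ℕ => (N : k) ^ 2 • v)
      + (-(1 / 2) : k) • (fun N : ℕ => (N : k) ^ 1 • v) := by
    funext N
    rw [← Finset.sum_smul, ← Nat.cast_smul_eq_nsmul k]
    simp only [Pi.add_apply, Pi.smul_apply, smul_smul, ← add_smul]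
    congr 1
    have : ((∑ i ∈ range N, i : ℕ) : k) * 2 = N * ((N : k) - 1) := by
      induction N with
      | zero => simp
      | succ n ih => rw [Finset.sum_range_succ]; push_cast at ih ⊢; rw [add_mul, ih]; ring
    field_simp
    linear_combination this
  rw [this, map_add, map_smul, map_smul, linCoeff_pow, linCoeff_pow]
  simp

end PolynomialFunctions

/-! ### The signed shuffle coproduct on lists of homogeneous entries. -/

section Shuffles

/-- An element of a graded module together with its degree and a label. -/
structure Entry (Γ G : Type*) where
  lab : Γ
  deg : ℤ
  val : G

variable {k : Type*} [Field k] {Γ G M M' : Type*}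
  [AddCommGroup M] [Module k M] [AddCommGroup M'] [Module k M']

/-- Total degree of the desuspensions of the entries. -/
def sdeg : List (Entry Γ G) → ℤ
  | [] => 0
  | x :: U => (x.deg - 1) + sdeg U

theorem sdeg_append (U V : List (Entry Γ G)) : sdeg (U ++ V) = sdeg U + sdeg V := by
  induction U with
  | nil => simp [sdeg]
  | cons x U ih => simp only [List.cons_append, sdeg, ih]; ring

theorem sdeg_perm {U V : List (Entry Γ G)} (h : U.Perm V) : sdeg U = sdeg V := by
  induction h with
  | nil => rfl
  | cons x _ ih => simp only [sdeg, ih]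
  | swap x y l => simp only [sdeg]; ring
  | trans _ _ h1 h2 => exact h1.trans h2

variable (k) in
/-- Signed sum over all splittings of a list in two sublists. The lists are in reversed order, and
the entries carry the Koszul signs of their desuspensions. -/
def shuf : List (Entry Γ G) → (List (Entry Γ G) → List (Entry Γ G) → M) → M
  | [], Φ => Φ [] []
  | x :: U, Φ => shuf U fun A B => ksgn k ((x.deg - 1) * sdeg B) • Φ (x :: A) B + Φ A (x :: B)

theorem perm_length_le {X : Type*} {A B U : List X} (h : (A ++ B).Perm U) :
    A.length ≤ U.length ∧ B.length ≤ U.length := by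
  have := h.length_eq
  rw [List.length_append] at this
  omega

/-- Only pairs whose concatenation is a permutation of `U` occur. This permutation is how lengths,
degrees, labels and homogeneity of the two parts are recovered later. -/
theorem shuf_congr (U : List (Entry Γ G)) {Φ Ψ : List (Entry Γ G) → List (Entry Γ G) → M}
    (h : ∀ A B, (A ++ B).Perm U → Φ A B = Ψ A B) : shuf k U Φ = shuf k U Ψ := by
  induction U generalizing Φ Ψ with
  | nil => exact h [] [] (List.Perm.refl _)
  | cons x U ih =>
    refine ih fun A B hAB => ?_
    rw [h (x :: A) B (hAB.cons x), h A (x :: B) (List.perm_middle.trans (hAB.cons x))]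

theorem shuf_add (U : List (Entry Γ G)) (Φ Ψ : List (Entry Γ G) → List (Entry Γ G) → M) :
    shuf k U (fun A B => Φ A B + Ψ A B) = shuf k U Φ + shuf k U Ψ := by
  induction U generalizing Φ Ψ with
  | nil => rfl
  | cons x U ih =>
    simp only [shuf, ← ih]
    congr 1
    funext A B
    rw [smul_add]
    abel

theorem shuf_map (f : M →ₗ[k] M') (U : List (Entry Γ G))
    (Φ : List (Entry Γ G) → List (Entry Γ G) → M) :
    shuf k U (fun A B => f (Φ A B)) = f (shuf k U Φ) := by
  induction U generalizing Φ with
  | nil => rfl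
  | cons x U ih => simp only [shuf, ← ih, map_add, map_smul]

theorem shuf_smul (c : k) (U : List (Entry Γ G)) (Φ : List (Entry Γ G) → List (Entry Γ G) → M) :
    shuf k U (fun A B => c • Φ A B) = c • shuf k U Φ := by
  simpa using shuf_map (c • (LinearMap.id : M →ₗ[k] M)) U Φ

theorem shuf_zero (U : List (Entry Γ G)) : shuf k U (fun _ _ => (0 : M)) = 0 := by
  simpa using shuf_smul (k := k) 0 U (fun _ _ => (0 : M))

theorem shuf_sub (U : List (Entry Γ G)) (Φ Ψ : List (Entry Γ G) → List (Entry Γ G) → M) :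
    shuf k U (fun A B => Φ A B - Ψ A B) = shuf k U Φ - shuf k U Ψ := by
  have := shuf_map (-(LinearMap.id : M →ₗ[k] M)) U Ψ
  simp only [LinearMap.neg_apply, LinearMap.id_apply] at this
  simp only [sub_eq_add_neg, shuf_add, this]

theorem shuf_sum {ι : Type*} (I : Finset ι) (U : List (Entry Γ G))
    (Φ : ι → List (Entry Γ G) → List (Entry Γ G) → M) :
    shuf k U (fun A B => ∑ i ∈ I, Φ i A B) = ∑ i ∈ I, shuf k U (Φ i) := by
  classical
  induction I using Finset.induction_on with
  | empty => simpa using shuf_zero U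
  | insert i I hi ih => simp only [Finset.sum_insert hi, shuf_add, ih]

/-- Modulo `S`, membership becomes equality with the zero function, so `shuf_congr` applies. -/
theorem shuf_mem (S : Submodule k M) (U : List (Entry Γ G))
    {Φ : List (Entry Γ G) → List (Entry Γ G) → M} (h : ∀ A B, (A ++ B).Perm U → Φ A B ∈ S) :
    shuf k U Φ ∈ S := by
  rw [← Submodule.Quotient.mk_eq_zero, ← Submodule.mkQ_apply, ← shuf_map, ← shuf_zero (k := k) U]
  exact shuf_congr U fun A B hAB => (Submodule.Quotient.mk_eq_zero _).2 (h A B hAB)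

theorem shuf_apply {X : Type*} (U : List (Entry Γ G))
    (Φ : List (Entry Γ G) → List (Entry Γ G) → X → M) (N : X) :
    shuf k U Φ N = shuf k U fun A B => Φ A B N :=
  (shuf_map (LinearMap.proj N : (X → M) →ₗ[k] M) U Φ).symm

theorem ksgn_smul_smul (a b : ℤ) (x : M) : ksgn k a • ksgn k b • x = ksgn k (a + b) • x := by
  rw [smul_smul, ksgn_add]

theorem neg_eq_ksgn_smul (x : M) : -x = ksgn k 1 • x := by rw [ksgn_one, neg_one_smul]

theorem ksgn_smul_congr {a b : ℤ} (h : (a : ZMod 2) = b) (x : M) :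
    ksgn k a • x = ksgn k b • x := by rw [ksgn_congr k h]

theorem ksgn_smul_self (a : ℤ) (x : M) : ksgn k a • ksgn k a • x = x := by
  rw [ksgn_smul_smul, ksgn_congr k (b := 0) (by push_cast; grind), ksgn_zero, one_smul]

/-- Graded cocommutativity of the coproduct. -/
theorem shuf_comm (U : List (Entry Γ G)) (Φ : List (Entry Γ G) → List (Entry Γ G) → M) :
    shuf k U Φ = shuf k U fun A B => ksgn k (sdeg A * sdeg B) • Φ B A := by
  induction U generalizing Φ with
  | nil => simp [shuf, sdeg, ksgn_zero]
  | cons x U ih =>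
    simp only [shuf]
    rw [ih]
    refine shuf_congr U fun A B _ => ?_
    simp only [smul_add, ksgn_smul_smul, sdeg]
    rw [add_comm]
    congr 1
    · exact ksgn_smul_congr (by push_cast; grind) _
    · exact ksgn_smul_congr (by push_cast; grind) _

/-- Coassociativity of the coproduct. -/
theorem shuf_assoc (U : List (Entry Γ G))
    (Φ : List (Entry Γ G) → List (Entry Γ G) → List (Entry Γ G) → M) :
    (shuf k U fun D C => shuf k D fun A B => Φ A B C)
      = shuf k U fun A D => shuf k D fun B C => Φ A B C := by
  induction U generalizing Φ with
  | nil => rfl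
  | cons x U ih =>
    simp only [shuf]
    -- The head `x` lands in one of the three parts, with the sign of passing the parts to the right
    -- of that one. Both iterated splittings produce this same sum.
    have := ih fun A B C => ksgn k ((x.deg - 1) * (sdeg B + sdeg C)) • Φ (x :: A) B C
      + ksgn k ((x.deg - 1) * sdeg C) • Φ A (x :: B) C + Φ A B (x :: C)
    refine Eq.trans (shuf_congr U fun D C _ => ?_)
      (this.trans (shuf_congr U fun A D _ => ?_))
    · rw [← shuf_smul, ← shuf_add]
      refine shuf_congr D fun A B _ => ?_
      rw [smul_add, ksgn_smul_smul]
      congr 3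
      rw [← ksgn_congr k]
      push_cast
      ring
    · rw [← shuf_smul, ← shuf_add]
      refine shuf_congr D fun B C h => ?_
      rw [← sdeg_perm h, sdeg_append, add_assoc]

variable (k) in
/-- Signed sum over all splittings of a list in three sublists. -/
def shuf₃ (U : List (Entry Γ G))
    (Φ : List (Entry Γ G) → List (Entry Γ G) → List (Entry Γ G) → M) : M :=
  shuf k U fun A D => shuf k D fun B C => Φ A B C

theorem shuf₃_left (U : List (Entry Γ G))
    (Φ : List (Entry Γ G) → List (Entry Γ G) → List (Entry Γ G) → M) :
    (shuf k U fun D C => shuf k D fun A B => Φ A B C) = shuf₃ k U Φ := shuf_assoc U Φ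

theorem shuf₃_congr (U : List (Entry Γ G))
    {Φ Ψ : List (Entry Γ G) → List (Entry Γ G) → List (Entry Γ G) → M}
    (h : ∀ A B C, (A ++ (B ++ C)).Perm U → Φ A B C = Ψ A B C) : shuf₃ k U Φ = shuf₃ k U Ψ :=
  shuf_congr U fun A _ h1 => shuf_congr _ fun B C h2 => h A B C ((h2.append_left A).trans h1)

theorem shuf₃_add (U : List (Entry Γ G))
    (Φ Ψ : List (Entry Γ G) → List (Entry Γ G) → List (Entry Γ G) → M) :
    shuf₃ k U (fun A B C => Φ A B C + Ψ A B C) = shuf₃ k U Φ + shuf₃ k U Ψ := by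
  simp only [shuf₃, shuf_add]

/-- The first two of three parts can be exchanged: bracket them together by coassociativity and
apply cocommutativity there. -/
theorem shuf₃_swap (U : List (Entry Γ G))
    (Φ : List (Entry Γ G) → List (Entry Γ G) → List (Entry Γ G) → M) :
    shuf₃ k U Φ = shuf₃ k U fun A B C => ksgn k (sdeg A * sdeg B) • Φ B A C := by
  rw [← shuf₃_left, ← shuf₃_left]
  exact shuf_congr U fun D C _ => shuf_comm D _

end Shuffles

/-! ### Convolution powers of the identity of the enveloping algebra, acting on the Lie algebra. -/

section Logarithm

open Finset

variable {k : Type*} [Field k] {Γ G : Type*} [AddCommGroup G] [Module k G]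

/-- Auxiliary recursion for `psi`; the first argument bounds the length of the list. -/
def psiAux (br : G →ₗ[k] G →ₗ[k] G) : ℕ → List (Entry Γ G) → G → ℕ → G
  | 0, _, z, _ => z
  | _ + 1, [], z, _ => z
  | n + 1, x :: U, z, N => shuf k U fun A B => ksgn k (sdeg A + sdeg B * (1 + x.deg)) •
      br (∑ i ∈ range N, psiAux br n A x.val i) (psiAux br n B z N)

/-- The action of the `N`-th convolution power of the identity of the enveloping algebra. -/
def psi (br : G →ₗ[k] G →ₗ[k] G) (U : List (Entry Γ G)) (z : G) (N : ℕ) : G :=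
  psiAux br U.length U z N

/-- The partial sums of `psi`. -/
def lam (br : G →ₗ[k] G →ₗ[k] G) (U : List (Entry Γ G)) (z : G) (N : ℕ) : G :=
  ∑ i ∈ range N, psi br U z i

variable (br : G →ₗ[k] G →ₗ[k] G)

/-- Any bound at least the length gives the same value. The bound is needed because the recursion
passes to sublists produced by `shuf`, which are not structurally smaller. -/
theorem psiAux_eq (n : ℕ) : ∀ (m : ℕ) (U : List (Entry Γ G)) (z : G), U.length ≤ n →
    U.length ≤ m → psiAux br n U z = psiAux br m U z := by
  induction n with
  | zero =>
    intro m U z h _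
    rw [List.length_eq_zero_iff.1 (Nat.le_zero.1 h)]
    cases m <;> rfl
  | succ n ih =>
    intro m U z h h'
    match U, m with
    | [], 0 => rfl
    | [], _ + 1 => rfl
    | x :: U, m + 1 =>
      simp only [List.length_cons, add_le_add_iff_right] at h h'
      funext N
      simp only [psiAux]
      refine shuf_congr U fun A B hAB => ?_
      obtain ⟨h1, h2⟩ := perm_length_le hAB
      rw [ih m A _ (by omega) (by omega), ih m B _ (by omega) (by omega)]

@[simp] theorem psi_nil (z : G) (N : ℕ) : psi br ([] : List (Entry Γ G)) z N = z := rfl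

theorem lam_nil (z : G) (N : ℕ) : lam br ([] : List (Entry Γ G)) z N = N • z := by
  simp [lam]

/-- In `Ψ^N(x U)` the letter `x` stands in front of one of the `N` tensor factors of `U`, which
gives `∑_{j<N} Ψ^j(U') x Ψ^{N-j}(U'')`. Moving `x` to the left through `Ψ^j(U')` replaces it by its
image under the adjoint action of one part of `U'`; the other part recombines with `Ψ^{N-j}` to
`Ψ^N`. -/
theorem psi_cons (x : Entry Γ G) (U : List (Entry Γ G)) (z : G) (N : ℕ) :
    psi br (x :: U) z N = shuf k U fun A B => ksgn k (sdeg A + sdeg B * (1 + x.deg)) •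
      br (lam br A x.val N) (psi br B z N) := by
  simp only [psi, List.length_cons, psiAux]
  refine shuf_congr U fun A B hAB => ?_
  obtain ⟨h1, h2⟩ := perm_length_le hAB
  rw [psiAux_eq br _ B.length B _ h2 le_rfl]
  simp only [lam, psi]
  rw [psiAux_eq br _ A.length A _ h1 le_rfl]

theorem list_length_induction {X : Type*} {P : List X → Prop}
    (h : ∀ U, (∀ V : List X, V.length < U.length → P V) → P U) (U : List X) : P U := by
  induction hn : U.length using Nat.strong_induction_on generalizing U with
  | _ n ih => exact h U fun V hV => ih V.length (hn ▸ hV) V rfl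

variable (k Γ G) in
/-- A Lie bracket of degree `-1`, graded symmetric, on a module with a family of submodules
consisting of the elements of given label and degree. -/
structure ShiftedLie [AddCommMonoid Γ] where
  br : G →ₗ[k] G →ₗ[k] G
  part : Γ → ℤ → Submodule k G
  br_mem : ∀ {K L : Γ} {a b : ℤ} {x y : G}, x ∈ part K a → y ∈ part L b →
    br x y ∈ part (K + L) (a + b - 1)
  br_symm : ∀ {K L : Γ} {a b : ℤ} {x y : G}, x ∈ part K a → y ∈ part L b →
    br x y = ksgn k (a * b) • br y x
  jacobi : ∀ {K L J : Γ} {a b c : ℤ} {x y z : G}, x ∈ part K a → y ∈ part L b → z ∈ part J c →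
    br (br x y) z = ksgn k (a + 1) • br x (br y z) + ksgn k ((a - 1) * b + 1) • br y (br x z)

namespace ShiftedLie

variable [AddCommMonoid Γ] (𝔏 : ShiftedLie k Γ G)

/-- All entries of the list are elements of their label and degree. -/
def Homog (U : List (Entry Γ G)) : Prop := ∀ e ∈ U, e.val ∈ 𝔏.part e.lab e.deg

variable {𝔏}

theorem Homog.head {x : Entry Γ G} {U : List (Entry Γ G)} (h : 𝔏.Homog (x :: U)) :
    x.val ∈ 𝔏.part x.lab x.deg := h x List.mem_cons_self

theorem Homog.tail {x : Entry Γ G} {U : List (Entry Γ G)} (h : 𝔏.Homog (x :: U)) :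
    𝔏.Homog U := fun e he => h e (List.mem_cons_of_mem _ he)

theorem Homog.cons {x : Entry Γ G} {U : List (Entry Γ G)} (hx : x.val ∈ 𝔏.part x.lab x.deg)
    (h : 𝔏.Homog U) : 𝔏.Homog (x :: U) := by
  intro e he
  rcases List.mem_cons.1 he with rfl | he
  exacts [hx, h e he]

theorem Homog.nil : 𝔏.Homog [] := fun _ h => absurd h List.not_mem_nil

theorem Homog.perm {U V : List (Entry Γ G)} (h : 𝔏.Homog U) (p : V.Perm U) : 𝔏.Homog V :=
  fun e he => h e (p.subset he)

theorem Homog.left {A B U : List (Entry Γ G)} (h : 𝔏.Homog U) (p : (A ++ B).Perm U) :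
    𝔏.Homog A := fun e he => h.perm p e (List.mem_append_left _ he)

theorem Homog.right {A B U : List (Entry Γ G)} (h : 𝔏.Homog U) (p : (A ++ B).Perm U) :
    𝔏.Homog B := fun e he => h.perm p e (List.mem_append_right _ he)

variable (𝔏)

theorem psi_mem : ∀ (U : List (Entry Γ G)) {z : G} {L : Γ} {d : ℤ}
    (_ : 𝔏.Homog U) (_ : z ∈ 𝔏.part L d) (N : ℕ),
    psi 𝔏.br U z N ∈ 𝔏.part ((U.map Entry.lab).sum + L) (sdeg U + d) := by
  refine list_length_induction fun U ih => ?_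
  intro z L d hU hz N
  match U with
  | [] => simpa [sdeg] using hz
  | x :: U =>
    rw [psi_cons]
    refine shuf_mem _ U fun A B h => Submodule.smul_mem _ _ ?_
    have hl := perm_length_le h
    have h1 : lam 𝔏.br A x.val N ∈ 𝔏.part ((A.map Entry.lab).sum + x.lab) (sdeg A + x.deg) :=
      Submodule.sum_mem _ fun i _ => ih A (by simp; omega) (hU.tail.left h) hU.head i
    have h2 := ih B (by simp; omega) (hU.tail.right h) hz N
    convert 𝔏.br_mem h1 h2 using 1
    have e := (h.map Entry.lab).sum_eq
    rw [List.map_append, List.sum_append] at e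
    rw [← sdeg_perm (show (x :: (A ++ B)).Perm _ from h.cons x)]
    simp only [List.map_cons, List.sum_cons, ← e, sdeg, sdeg_append]
    congr 1
    · abel
    · ring

theorem lam_mem {L : Γ} {d : ℤ} (U : List (Entry Γ G)) {z : G} (hU : 𝔏.Homog U)
    (hz : z ∈ 𝔏.part L d) (N : ℕ) :
    lam 𝔏.br U z N ∈ 𝔏.part ((U.map Entry.lab).sum + L) (sdeg U + d) :=
  Submodule.sum_mem _ fun i _ => 𝔏.psi_mem U hU hz i

/-- The Jacobi identity solved for the nested bracket: bracketing with `x` is a graded derivation.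
-/
theorem jacobi' {K L J : Γ} {a b c : ℤ} {x y z : G} (hx : x ∈ 𝔏.part K a) (hy : y ∈ 𝔏.part L b)
    (hz : z ∈ 𝔏.part J c) : 𝔏.br x (𝔏.br y z) = ksgn k (a + 1) • 𝔏.br (𝔏.br x y) z
      + ksgn k (a + 1 + (a - 1) * b) • 𝔏.br y (𝔏.br x z) := by
  rw [𝔏.jacobi hx hy hz, smul_add, ksgn_smul_self, ksgn_smul_smul, add_assoc, ← add_smul,
    show a + 1 + ((a - 1) * b + 1) = (a + 1 + (a - 1) * b) + 1 by ring, ksgn_add k _ 1, ksgn_one]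
  simp

/-- `psi` is a coalgebra map acting by derivations. -/
theorem psi_br (N : ℕ) : ∀ (U : List (Entry Γ G)) {x y : G} {K L : Γ} {a b : ℤ} (_ : 𝔏.Homog U)
    (_ : x ∈ 𝔏.part K a) (_ : y ∈ 𝔏.part L b), psi 𝔏.br U (𝔏.br x y) N
      = shuf k U fun A B => ksgn k (sdeg A + sdeg B * (1 + a)) •
        𝔏.br (psi 𝔏.br A x N) (psi 𝔏.br B y N) := by
  refine list_length_induction fun U ih => ?_
  intro x y K L a b hU hx hy
  match U with
  | [] => simp [shuf, sdeg, ksgn_zero]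
  | w :: U =>
    -- All three expressions are brought to sums over the same triples: `w` acts on the whole
    -- bracket in `e1`, on the first argument in `e2`, on the second in `e3`. The derivation
    -- property of the bracket with `lam A w` then compares them term by term.
    have e1 : psi 𝔏.br (w :: U) (𝔏.br x y) N = shuf₃ k U fun A B C =>
        ksgn k (sdeg A + (sdeg B + sdeg C) * (1 + w.deg) + (sdeg B + sdeg C * (1 + a))) •
          𝔏.br (lam 𝔏.br A w.val N) (𝔏.br (psi 𝔏.br B x N) (psi 𝔏.br C y N)) := by
      rw [psi_cons]
      refine shuf_congr U fun A D h => ?_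
      have hl := perm_length_le h
      rw [ih D (by simp; omega) (hU.tail.right h) hx hy, ← shuf_map, ← shuf_smul]
      refine shuf_congr D fun B C h' => ?_
      rw [map_smul, ksgn_smul_smul, ← sdeg_perm h', sdeg_append]
    have e2 : (shuf k U fun D C => ksgn k ((w.deg - 1) * sdeg C) •
        ksgn k (sdeg (w :: D) + sdeg C * (1 + a)) •
          𝔏.br (psi 𝔏.br (w :: D) x N) (psi 𝔏.br C y N)) = shuf₃ k U fun A B C =>
        ksgn k ((w.deg - 1) * sdeg C + (w.deg - 1 + (sdeg A + sdeg B) + sdeg C * (1 + a))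
          + (sdeg A + sdeg B * (1 + w.deg))) •
          𝔏.br (𝔏.br (lam 𝔏.br A w.val N) (psi 𝔏.br B x N)) (psi 𝔏.br C y N) := by
      rw [← shuf₃_left]
      refine shuf_congr U fun D C h => ?_
      rw [psi_cons, ksgn_smul_smul, ← LinearMap.flip_apply 𝔏.br, ← shuf_map, ← shuf_smul]
      refine shuf_congr D fun A B h' => ?_
      rw [map_smul, ksgn_smul_smul, sdeg, ← sdeg_perm h', sdeg_append, LinearMap.flip_apply]
    have e3 : (shuf k U fun B D => ksgn k (sdeg B + sdeg (w :: D) * (1 + a)) •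
          𝔏.br (psi 𝔏.br B x N) (psi 𝔏.br (w :: D) y N)) = shuf₃ k U fun A B C =>
        ksgn k (sdeg A * sdeg B + (sdeg B + (w.deg - 1 + (sdeg A + sdeg C)) * (1 + a)
          + (sdeg A + sdeg C * (1 + w.deg)))) •
          𝔏.br (psi 𝔏.br B x N) (𝔏.br (lam 𝔏.br A w.val N) (psi 𝔏.br C y N)) := by
      have := shuf₃_swap (k := k) U fun B A C =>
        ksgn k (sdeg B + (w.deg - 1 + (sdeg A + sdeg C)) * (1 + a)
          + (sdeg A + sdeg C * (1 + w.deg))) •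
          𝔏.br (psi 𝔏.br B x N) (𝔏.br (lam 𝔏.br A w.val N) (psi 𝔏.br C y N))
      simp only [ksgn_smul_smul] at this
      rw [← this]
      refine shuf_congr U fun B D h => ?_
      rw [psi_cons, ← shuf_map, ← shuf_smul]
      refine shuf_congr D fun A C h' => ?_
      rw [map_smul, ksgn_smul_smul, sdeg, ← sdeg_perm h', sdeg_append]
    simp only [shuf]
    rw [e1, shuf_add, e2, e3, ← shuf₃_add]
    refine shuf₃_congr U fun A B C h => ?_
    have hA := hU.tail.left h
    have hBC := hU.tail.right h
    have hB := hBC.left (List.Perm.refl _)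
    have hC := hBC.right (List.Perm.refl _)
    rw [𝔏.jacobi' (𝔏.lam_mem A hA hU.head N) (𝔏.psi_mem B hB hx N)
      (𝔏.psi_mem C hC hy N), smul_add, ksgn_smul_smul, ksgn_smul_smul]
    congr 1
    · exact ksgn_smul_congr (by push_cast; grind) _
    · exact ksgn_smul_congr (by push_cast; grind) _

/-- Pairs of indices below `N` are sorted by their maximum `j`: the first index is smaller, or the
second is smaller, or both equal `j`. -/
theorem sum_range_bilin (B : G →ₗ[k] G →ₗ[k] G) (f g : ℕ → G) (N : ℕ) :
    B (∑ i ∈ range N, f i) (∑ i ∈ range N, g i) = ∑ j ∈ range N, (B (∑ i ∈ range j, f i) (g j)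
      + B (f j) (∑ i ∈ range j, g i) + B (f j) (g j)) := by
  induction N with
  | zero => simp
  | succ n ih => rw [sum_range_succ, sum_range_succ, sum_range_succ, ← ih]; simp only [map_add, LinearMap.add_apply]; abel

/-- The product of two partial sums on the right splits by `sum_range_bilin`. The part with smaller
first index is `lam (x :: U) y` by `psi_cons`, the part with smaller second index is `lam (y :: U)
x` after cocommutativity and symmetry of the bracket, and the diagonal is `lam U [x,y]` by `psi_br`.
-/
theorem lam_cons_add_lam_cons (x y : Entry Γ G) (U : List (Entry Γ G)) (hU : 𝔏.Homog U)
    (hx : x.val ∈ 𝔏.part x.lab x.deg) (hy : y.val ∈ 𝔏.part y.lab y.deg) (N : ℕ) :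
    lam 𝔏.br (x :: U) y.val N + ksgn k (x.deg * y.deg) • lam 𝔏.br (y :: U) x.val N
      + lam 𝔏.br U (𝔏.br x.val y.val) N
      = shuf k U fun A B => ksgn k (sdeg A + sdeg B * (1 + x.deg)) •
        𝔏.br (lam 𝔏.br A x.val N) (lam 𝔏.br B y.val N) := by
  have e2 : ksgn k (x.deg * y.deg) • lam 𝔏.br (y :: U) x.val N = shuf k U fun A B =>
      ksgn k (sdeg A + sdeg B * (1 + x.deg)) •
        ∑ j ∈ range N, 𝔏.br (psi 𝔏.br A x.val j) (lam 𝔏.br B y.val j) := by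
    rw [lam]
    simp only [psi_cons]
    rw [← shuf_sum, ← shuf_smul, shuf_comm]
    refine shuf_congr U fun A B h => ?_
    rw [smul_sum, smul_sum, smul_sum]
    refine sum_congr rfl fun j _ => ?_
    rw [𝔏.br_symm (𝔏.lam_mem B (hU.right h) hy j)
      (𝔏.psi_mem A (hU.left h) hx j)]
    simp only [ksgn_smul_smul]
    exact ksgn_smul_congr (by push_cast; grind) _
  rw [e2, lam, lam]
  simp only [psi_cons, 𝔏.psi_br _ U hU hx hy]
  rw [← shuf_sum, ← shuf_sum, ← shuf_add, ← shuf_add]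
  refine shuf_congr U fun A B h => ?_
  rw [lam, lam, sum_range_bilin, ← smul_sum, ← smul_sum, ← smul_add, ← smul_add, sum_add_distrib,
    sum_add_distrib]
  rfl

end ShiftedLie
end Logarithm

/-! ### The first Eulerian idempotent as linear coefficient in `N`. -/

section Eulerian

open Finset

variable {k : Type*} [Field k] {Γ G : Type*} [AddCommGroup G] [Module k G]

namespace ShiftedLie

variable (k) in
/-- The first Eulerian idempotent: the retraction of the enveloping algebra onto the Lie algebra,
with values in the suspended Lie algebra. -/
def eulerian [CharZero k] (br : G →ₗ[k] G →ₗ[k] G) (U : List (Entry Γ G)) (z : G) : G :=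
  linCoeff k G (lam br U z)

/-- Polynomials are stable under brackets and under summation over `j < N`, the two operations in
the recursion `psi_cons`. -/
theorem psi_poly [CharZero k] (br : G →ₗ[k] G →ₗ[k] G) : ∀ (U : List (Entry Γ G)) (z : G),
    psi br U z ∈ PolyFrom k G 0 := by
  refine list_length_induction fun U ih z => ?_
  match U with
  | [] => exact const_mem_PolyFrom z
  | x :: U =>
    have : psi br (x :: U) z = shuf k U fun A B N => ksgn k (sdeg A + sdeg B * (1 + x.deg)) •
        br (lam br A x.val N) (psi br B z N) := by
      funext N
      rw [psi_cons, shuf_apply]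
    rw [this]
    refine shuf_mem _ U fun A B h => Submodule.smul_mem _ (ksgn k _) ?_
    have hl := perm_length_le h
    exact PolyFrom.mono (Nat.zero_le _) (PolyFrom.bilin br
      (PolyFrom.sum_range (ih A (by simp; omega) x.val)) (ih B (by simp; omega) z))

theorem lam_poly [CharZero k] (br : G →ₗ[k] G →ₗ[k] G) (U : List (Entry Γ G)) (z : G) :
    lam br U z ∈ PolyFrom k G 1 := PolyFrom.sum_range (psi_poly br U z)

theorem eulerian_nil [CharZero k] (br : G →ₗ[k] G →ₗ[k] G) (z : G) :
    eulerian k br ([] : List (Entry Γ G)) z = z :=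
  linCoeff_sum_const z

/-- Here `psi [x] z j` is `j` times the bracket, so `linCoeff_sum_id` applies. -/
theorem eulerian_singleton [CharZero k] (br : G →ₗ[k] G →ₗ[k] G) (x : Entry Γ G) (z : G) :
    eulerian k br [x] z = (-(1 / 2) : k) • br x.val z := by
  rw [eulerian, ← linCoeff_sum_id]
  congr 1
  funext N
  refine sum_congr rfl fun j _ => ?_
  rw [psi_cons, shuf]
  simp [sdeg, ksgn_zero, lam_nil]

end ShiftedLie

end Eulerian

/-! ### Functions of words that factor through the enveloping algebra. -/

section Enveloping

open Finset

variable {k : Type*} [Field k] {Γ G M M' : Type*} [AddCommGroup G] [Module k G]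
  [AddCommGroup M] [Module k M] [AddCommGroup M'] [Module k M'] [AddCommMonoid Γ]

namespace ShiftedLie

variable (𝔏 : ShiftedLie k Γ G)

/-- The bracket of two entries. -/
def brEntry (x y : Entry Γ G) : Entry Γ G := ⟨x.lab + y.lab, x.deg + y.deg - 1, 𝔏.br x.val y.val⟩

/-- The function `F` of lists of length at most `n` respects the relations of the enveloping
algebra. -/
def Enveloping (n : ℕ) (F : List (Entry Γ G) → M) : Prop :=
  ∀ (V : List (Entry Γ G)) (x y : Entry Γ G) (U : List (Entry Γ G)),
    V.length + U.length + 2 ≤ n → 𝔏.Homog (V ++ y :: x :: U) →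
      F (V ++ y :: x :: U) = ksgn k ((x.deg - 1) * (y.deg - 1)) • F (V ++ x :: y :: U)
        + ksgn k x.deg • F (V ++ 𝔏.brEntry x y :: U)

variable {𝔏}

theorem Enveloping.mono {m n : ℕ} (h : m ≤ n) {F : List (Entry Γ G) → M}
    (hF : 𝔏.Enveloping n F) : 𝔏.Enveloping m F :=
  fun V x y U hl hH => hF V x y U (hl.trans h) hH

theorem Enveloping.map {n : ℕ} {F : List (Entry Γ G) → M} (hF : 𝔏.Enveloping n F)
    (φ : M →ₗ[k] M') : 𝔏.Enveloping n fun U => φ (F U) := by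
  intro V x y U hl hH
  simp only [hF V x y U hl hH, map_add, map_smul]

theorem Enveloping.add {n : ℕ} {F F' : List (Entry Γ G) → M} (hF : 𝔏.Enveloping n F)
    (hF' : 𝔏.Enveloping n F') : 𝔏.Enveloping n fun U => F U + F' U := by
  intro V x y U hl hH
  simp only [hF V x y U hl hH, hF' V x y U hl hH, smul_add]
  abel

theorem Enveloping.sum {n : ℕ} {ι : Type*} (I : Finset ι) {F : ι → List (Entry Γ G) → M}
    (hF : ∀ i, 𝔏.Enveloping n (F i)) : 𝔏.Enveloping n fun U => ∑ i ∈ I, F i U := by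
  intro V x y U hl hH
  simp only [fun i => hF i V x y U hl hH, Finset.sum_add_distrib, smul_sum]

theorem Enveloping.cons {n : ℕ} {F : List (Entry Γ G) → M} (hF : 𝔏.Enveloping (n + 1) F)
    (v : Entry Γ G) (hv : v.val ∈ 𝔏.part v.lab v.deg) :
    𝔏.Enveloping n fun U => F (v :: U) := by
  intro V x y U hl hH
  have := hF (v :: V) x y U (by simp; omega) (Homog.cons hv hH)
  simpa using this

/-- Multiplication by a sign depending on the degree. -/
theorem Enveloping.ksgn_smul {n : ℕ} {F : List (Entry Γ G) → M} (hF : 𝔏.Enveloping n F) (f : ℤ → ℤ) :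
    𝔏.Enveloping n fun U => ksgn k (f (sdeg U)) • F U := by
  intro V x y U hl hH
  simp only [hF V x y U hl hH, smul_add]
  have e1 : sdeg (V ++ x :: y :: U) = sdeg (V ++ y :: x :: U) := by
    simp only [sdeg_append, sdeg]; ring
  have e2 : sdeg (V ++ 𝔏.brEntry x y :: U) = sdeg (V ++ y :: x :: U) := by
    simp only [sdeg_append, sdeg, ShiftedLie.brEntry]; ring
  rw [e1, e2, smul_comm, smul_comm (ksgn k (f _)) (ksgn k x.deg)]

/-- The coproduct of the enveloping algebra is well defined. -/
theorem Enveloping.shuffle : ∀ (n : ℕ) {Φ : List (Entry Γ G) → List (Entry Γ G) → M}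
    (_ : ∀ B, 𝔏.Homog B → 𝔏.Enveloping (n - B.length) fun A => Φ A B)
    (_ : ∀ A, 𝔏.Homog A → 𝔏.Enveloping (n - A.length) fun B => Φ A B),
    𝔏.Enveloping n fun U => shuf k U Φ := by
  intro n Φ h1 h2 V
  induction V generalizing n Φ with
  | nil =>
    intro x y U hl hH
    simp only [List.nil_append, shuf]
    rw [← shuf_smul, ← shuf_smul, ← shuf_add]
    refine shuf_congr U fun A B h => ?_
    have hlen := h.length_eq
    rw [List.length_append] at hlen
    simp only [List.length_nil] at hl
    have hU := hH.tail.tail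
    -- If `x` and `y` fall in the same part, the relation is used in that part; the coproduct of the
    -- bracket supplies the two bracket terms because all letters are primitive. If they fall in
    -- different parts, the two orders agree up to a sign and no relation is needed.
    have a := h1 B (hU.right h) [] x y A (by simp; omega)
      (Homog.cons hH.head (Homog.cons hH.tail.head (hU.left h)))
    have b := h2 A (hU.left h) [] x y B (by simp; omega)
      (Homog.cons hH.head (Homog.cons hH.tail.head (hU.right h)))
    simp only [List.nil_append] at a b
    rw [a, b]
    simp only [smul_add, ksgn_smul_smul, sdeg, ShiftedLie.brEntry]
    have c1 : ksgn k ((x.deg - 1) * sdeg B + ((y.deg - 1) * sdeg B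
        + (x.deg - 1) * (y.deg - 1))) = ksgn k ((x.deg - 1) * (y.deg - 1)
        + ((y.deg - 1) * sdeg B + (x.deg - 1) * sdeg B)) := ksgn_congr k (by push_cast; ring)
    have c2 : ksgn k ((x.deg - 1) * sdeg B + ((y.deg - 1) * sdeg B + x.deg))
        = ksgn k (x.deg + (x.deg + y.deg - 1 - 1) * sdeg B) :=
      ksgn_congr k (by push_cast; ring)
    have c3 : ksgn k ((x.deg - 1) * (y.deg - 1) + (x.deg - 1) * (y.deg - 1 + sdeg B))
        = ksgn k ((x.deg - 1) * sdeg B) := ksgn_congr k (by push_cast; grind)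
    have c4 : ksgn k ((x.deg - 1) * (y.deg - 1) + (y.deg - 1) * sdeg B)
        = ksgn k ((y.deg - 1) * (x.deg - 1 + sdeg B)) :=
      ksgn_congr k (by push_cast; ring)
    rw [c1, c2, c3, c4]
    abel
  | cons v V ih =>
    intro x y U hl hH
    simp only [List.cons_append, shuf]
    simp only [List.length_cons, List.cons_append] at hl hH
    have hv := hH.head
    refine ih (n - 1) (fun B hB => ?_) (fun A hA => ?_) x y U (by omega) hH.tail
    -- Subtraction is truncated: when `B` has length at least `n`, the bound is zero and the
    -- relation to be shown is vacuous.
    · by_cases hn : B.length + 1 ≤ n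
      · refine Enveloping.add (Enveloping.map (Enveloping.cons ((h1 B hB).mono ?_) v hv)
          (ksgn k _ • LinearMap.id)) ((h1 (v :: B) (hB.cons hv)).mono ?_)
        · omega
        · simp; omega
      · intro V' _ _ U' h' _
        omega
    · by_cases hn : A.length + 1 ≤ n
      · refine Enveloping.add (Enveloping.ksgn_smul ((h2 (v :: A) (hA.cons hv)).mono ?_)
          (fun s => (v.deg - 1) * s)) (Enveloping.cons ((h2 A hA).mono ?_) v hv)
        · simp; omega
        · omega
      · intro V' _ _ U' h' _
        omega

variable (𝔏)

/-- Exchanging the first letter with the argument satisfies the relation of the enveloping algebra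
up to an error, a bracket of partial sums. In the proof of `psi_enveloping` this error is absorbed
by the Jacobi identity; in the linear coefficient it disappears. -/
theorem lam_cons_eq (x y : Entry Γ G) (U : List (Entry Γ G)) (hU : 𝔏.Homog U)
    (hx : x.val ∈ 𝔏.part x.lab x.deg) (hy : y.val ∈ 𝔏.part y.lab y.deg) (N : ℕ) :
    lam 𝔏.br (x :: U) y.val N = ksgn k (x.deg * y.deg + 1) • lam 𝔏.br (y :: U) x.val N
      + ksgn k 1 • lam 𝔏.br U (𝔏.br x.val y.val) N
      + shuf k U fun A B => ksgn k (sdeg A + sdeg B * (1 + x.deg)) •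
        𝔏.br (lam 𝔏.br A x.val N) (lam 𝔏.br B y.val N) := by
  rw [← 𝔏.lam_cons_add_lam_cons x y U hU hx hy N, ksgn_add, ksgn_one]
  module

/-- The convolution power `Ψ^N` is well defined on the enveloping algebra. The bound on the length
makes an induction possible: removing the first letter leaves a function of shorter words, for which
the coproduct and both factors respect the relations. -/
theorem psi_enveloping : ∀ (n N : ℕ) {z : G} {L : Γ} {d : ℤ} (_ : z ∈ 𝔏.part L d),
    𝔏.Enveloping n fun U => psi 𝔏.br U z N := by
  intro n
  induction n with
  | zero => intro N z L d hz V x y U h; omega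
  | succ n ih => ?_
  intro N z L d hz V x y U hl hH
  match V with
  | v :: V =>
    simp only [List.cons_append, psi_cons]
    simp only [List.cons_append] at hH
    refine Enveloping.shuffle (𝔏 := 𝔏) n (Φ := fun A B =>
      ksgn k (sdeg A + sdeg B * (1 + v.deg)) •
        𝔏.br (lam 𝔏.br A v.val N) (psi 𝔏.br B z N)) (fun B hB => ?_) (fun A hA => ?_) V x y U
      (by simp at hl; omega) hH.tail
    · refine Enveloping.ksgn_smul (f := fun s => s + sdeg B * (1 + v.deg)) ?_
      have : 𝔏.Enveloping (n - B.length) fun U => lam 𝔏.br U v.val N :=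
        Enveloping.sum _ fun i => (ih i hH.head).mono (by omega)
      exact this.map (𝔏.br.flip (psi 𝔏.br B z N))
    · refine Enveloping.ksgn_smul (f := fun s => sdeg A + s * (1 + v.deg)) ?_
      exact ((ih N hz).mono (by omega)).map (𝔏.br (lam 𝔏.br A v.val N))
  -- The exchanged letters `y`, `x` come first. Unfolding `y` sends `x` into the argument of `lam`
  -- (`e1`) or of `psi` (`e4`).
  | [] =>
    simp only [List.nil_append] at hH ⊢
    have hy := hH.head
    have hx := hH.tail.head
    have hU := hH.tail.tail
    -- By `lam_cons_eq`, this yields the term with `x` and `y` exchanged, the term of the bracket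
    -- entry, and an error with a double bracket over triples.
    have e1 : (shuf k U fun A B => ksgn k ((x.deg - 1) * sdeg B) •
        ksgn k (sdeg (x :: A) + sdeg B * (1 + y.deg)) •
          𝔏.br (lam 𝔏.br (x :: A) y.val N) (psi 𝔏.br B z N))
        = (shuf k U fun A B => ksgn k (sdeg A + x.deg * y.deg + x.deg
              + sdeg B * (x.deg + y.deg)) •
            𝔏.br (lam 𝔏.br (y :: A) x.val N) (psi 𝔏.br B z N))
          + (shuf k U fun A B => ksgn k (sdeg A + x.deg + sdeg B * (x.deg + y.deg)) •
            𝔏.br (lam 𝔏.br A (𝔏.br x.val y.val) N) (psi 𝔏.br B z N))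
          + shuf₃ k U fun A B C => ksgn k (x.deg + 1 + sdeg B * x.deg
              + sdeg C * (x.deg + y.deg)) •
            𝔏.br (𝔏.br (lam 𝔏.br A x.val N) (lam 𝔏.br B y.val N)) (psi 𝔏.br C z N) := by
      rw [← shuf₃_left, ← shuf_add, ← shuf_add]
      refine shuf_congr U fun D C h => ?_
      rw [𝔏.lam_cons_eq x y D (hU.left h) hx hy N]
      simp only [map_add, map_smul, LinearMap.add_apply, LinearMap.smul_apply, smul_add,
        ksgn_smul_smul, sdeg]
      rw [← LinearMap.flip_apply 𝔏.br (shuf k D _), ← shuf_map, ← shuf_smul]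
      congr 1
      · congr 1
        · exact ksgn_smul_congr (by push_cast; grind) _
        · exact ksgn_smul_congr (by push_cast; grind) _
      · refine shuf_congr D fun A B h' => ?_
        rw [map_smul, ksgn_smul_smul, LinearMap.flip_apply, ← sdeg_perm h', sdeg_append]
        exact ksgn_smul_congr (by push_cast; grind) _
    have e4 : (shuf k U fun A B => ksgn k (sdeg A + sdeg (x :: B) * (1 + y.deg)) •
          𝔏.br (lam 𝔏.br A y.val N) (psi 𝔏.br (x :: B) z N))
        = shuf₃ k U fun A B C => ksgn k (sdeg A * sdeg B + (sdeg B + (x.deg - 1 + (sdeg A + sdeg C))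
              * (1 + y.deg) + (sdeg A + sdeg C * (1 + x.deg)))) •
            𝔏.br (lam 𝔏.br B y.val N) (𝔏.br (lam 𝔏.br A x.val N) (psi 𝔏.br C z N)) := by
      have := shuf₃_swap (k := k) U fun B A C =>
        ksgn k (sdeg B + (x.deg - 1 + (sdeg A + sdeg C)) * (1 + y.deg)
          + (sdeg A + sdeg C * (1 + x.deg))) •
            𝔏.br (lam 𝔏.br B y.val N) (𝔏.br (lam 𝔏.br A x.val N) (psi 𝔏.br C z N))
      simp only [ksgn_smul_smul] at this
      rw [← this]
      refine shuf_congr U fun B D h => ?_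
      rw [psi_cons, ← shuf_map, ← shuf_smul]
      refine shuf_congr D fun A C h' => ?_
      rw [map_smul, ksgn_smul_smul, sdeg, ← sdeg_perm h', sdeg_append]
    have e5 : (shuf k U fun A B => ksgn k (sdeg A + sdeg (y :: B) * (1 + x.deg)) •
          𝔏.br (lam 𝔏.br A x.val N) (psi 𝔏.br (y :: B) z N))
        = shuf₃ k U fun A B C => ksgn k (sdeg A + (y.deg - 1 + (sdeg B + sdeg C))
              * (1 + x.deg) + (sdeg B + sdeg C * (1 + y.deg))) •
            𝔏.br (lam 𝔏.br A x.val N) (𝔏.br (lam 𝔏.br B y.val N) (psi 𝔏.br C z N)) := by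
      refine shuf_congr U fun B D h => ?_
      rw [psi_cons, ← shuf_map, ← shuf_smul]
      refine shuf_congr D fun A C h' => ?_
      rw [map_smul, ksgn_smul_smul, sdeg, ← sdeg_perm h', sdeg_append]
    -- The Jacobi identity turns the error into two nested brackets. One cancels `e4`; the other is
    -- `e5`, the remaining term of the exchanged word.
    have e3 : (shuf₃ k U fun A B C => ksgn k (x.deg + 1 + sdeg B * x.deg
              + sdeg C * (x.deg + y.deg)) •
            𝔏.br (𝔏.br (lam 𝔏.br A x.val N) (lam 𝔏.br B y.val N)) (psi 𝔏.br C z N))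
        + (shuf₃ k U fun A B C => ksgn k (sdeg A * sdeg B + (sdeg B + (x.deg - 1 + (sdeg A + sdeg C))
              * (1 + y.deg) + (sdeg A + sdeg C * (1 + x.deg)))) •
            𝔏.br (lam 𝔏.br B y.val N) (𝔏.br (lam 𝔏.br A x.val N) (psi 𝔏.br C z N)))
        = ksgn k ((x.deg - 1) * (y.deg - 1)) • shuf₃ k U fun A B C =>
            ksgn k (sdeg A + (y.deg - 1 + (sdeg B + sdeg C))
              * (1 + x.deg) + (sdeg B + sdeg C * (1 + y.deg))) •
            𝔏.br (lam 𝔏.br A x.val N) (𝔏.br (lam 𝔏.br B y.val N) (psi 𝔏.br C z N)) := by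
      simp only [shuf₃]
      simp only [← shuf_smul, ← shuf_add]
      refine shuf₃_congr U fun A B C h => ?_
      have hA := hU.left h
      have hBC := hU.right h
      have hB := hBC.left (List.Perm.refl _)
      have hC := hBC.right (List.Perm.refl _)
      rw [𝔏.jacobi (𝔏.lam_mem A hA hx N) (𝔏.lam_mem B hB hy N) (𝔏.psi_mem C hC hz N), smul_add,
        ksgn_smul_smul, ksgn_smul_smul, ksgn_smul_smul, add_assoc, ← add_smul]
      have c : ksgn k (x.deg + 1 + sdeg B * x.deg + sdeg C * (x.deg + y.deg)
            + ((sdeg A + x.deg - 1) * (sdeg B + y.deg) + 1))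
          + ksgn k (sdeg A * sdeg B + (sdeg B + (x.deg - 1 + (sdeg A + sdeg C))
              * (1 + y.deg) + (sdeg A + sdeg C * (1 + x.deg)))) = 0 := by
        rw [ksgn_congr k (b := sdeg A * sdeg B + (sdeg B + (x.deg - 1 + (sdeg A + sdeg C))
              * (1 + y.deg) + (sdeg A + sdeg C * (1 + x.deg))) + 1) (by push_cast; grind),
          ksgn_add k _ 1, ksgn_one]
        ring
      rw [c, zero_smul, add_zero]
      exact ksgn_smul_congr (by push_cast; grind) _
    simp only [psi_cons 𝔏.br y, psi_cons 𝔏.br (𝔏.brEntry x y), shuf, shuf_add]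
    rw [psi_cons 𝔏.br x (y :: U)]
    simp only [shuf, shuf_add]
    rw [e1, e4, e5, smul_add, ← e3, ← shuf_smul, ← shuf_smul]
    simp only [ksgn_smul_smul, sdeg, ShiftedLie.brEntry]
    have c1 : (shuf k U fun A B => ksgn k (sdeg A + x.deg * y.deg + x.deg
              + sdeg B * (x.deg + y.deg)) •
            𝔏.br (lam 𝔏.br (y :: A) x.val N) (psi 𝔏.br B z N))
        = shuf k U fun A B => ksgn k ((x.deg - 1) * (y.deg - 1) + ((y.deg - 1) * sdeg B
            + (y.deg - 1 + sdeg A + sdeg B * (1 + x.deg)))) •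
            𝔏.br (lam 𝔏.br (y :: A) x.val N) (psi 𝔏.br B z N) :=
      shuf_congr U fun A B _ => ksgn_smul_congr (by push_cast; grind) _
    have c2 : (shuf k U fun A B => ksgn k (sdeg A + x.deg + sdeg B * (x.deg + y.deg)) •
            𝔏.br (lam 𝔏.br A (𝔏.br x.val y.val) N) (psi 𝔏.br B z N))
        = shuf k U fun A B => ksgn k (x.deg + (sdeg A + sdeg B * (1 + (x.deg + y.deg - 1)))) •
            𝔏.br (lam 𝔏.br A (𝔏.br x.val y.val) N) (psi 𝔏.br B z N) :=
      shuf_congr U fun A B _ => ksgn_smul_congr (by push_cast; grind) _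
    rw [c1, c2]
    abel

theorem eulerian_mem [CharZero k] {L : Γ} {d : ℤ} (U : List (Entry Γ G)) {z : G}
    (hU : 𝔏.Homog U) (hz : z ∈ 𝔏.part L d) :
    eulerian k 𝔏.br U z ∈ 𝔏.part ((U.map Entry.lab).sum + L) (sdeg U + d) :=
  linCoeff_mem _ (PolyFrom.mono (Nat.zero_le _) (lam_poly 𝔏.br U z)) fun N => 𝔏.lam_mem U hU hz N

/-- The right hand side of `lam_cons_add_lam_cons` is a bracket of two polynomials vanishing at `N =
0`, hence is divisible by `N²`. This identity is the condition imposed by `d n_{2,0}`. -/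
theorem eulerian_cons_add_eulerian_cons [CharZero k] (x y : Entry Γ G) (U : List (Entry Γ G))
    (hU : 𝔏.Homog U) (hx : x.val ∈ 𝔏.part x.lab x.deg) (hy : y.val ∈ 𝔏.part y.lab y.deg) :
    eulerian k 𝔏.br (x :: U) y.val + ksgn k (x.deg * y.deg) • eulerian k 𝔏.br (y :: U) x.val
      + eulerian k 𝔏.br U (𝔏.br x.val y.val) = 0 := by
  rw [eulerian, eulerian, eulerian, ← map_smul, ← map_add, ← map_add]
  refine linCoeff_eq_zero ?_
  have : lam 𝔏.br (x :: U) y.val + ksgn k (x.deg * y.deg) • lam 𝔏.br (y :: U) x.val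
      + lam 𝔏.br U (𝔏.br x.val y.val) = shuf k U fun A B N =>
        ksgn k (sdeg A + sdeg B * (1 + x.deg)) •
        𝔏.br (lam 𝔏.br A x.val N) (lam 𝔏.br B y.val N) := by
    funext N
    rw [shuf_apply]
    exact 𝔏.lam_cons_add_lam_cons x y U hU hx hy N
  rw [this]
  refine shuf_mem _ U fun A B _ => ?_
  have h : (fun N => 𝔏.br (lam 𝔏.br A x.val N) (lam 𝔏.br B y.val N)) ∈ PolyFrom k G (1 + 1) :=
    PolyFrom.bilin 𝔏.br (lam_poly 𝔏.br A x.val) (lam_poly 𝔏.br B y.val)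
  exact Submodule.smul_mem _ (ksgn k (sdeg A + sdeg B * (1 + x.deg))) h

theorem eulerian_enveloping [CharZero k] (n : ℕ) {z : G} {L : Γ} {d : ℤ} (hz : z ∈ 𝔏.part L d) :
    𝔏.Enveloping n fun U => eulerian k 𝔏.br U z := by
  intro V x y U hl hH
  have h : lam 𝔏.br (V ++ y :: x :: U) z
      = ksgn k ((x.deg - 1) * (y.deg - 1)) • lam 𝔏.br (V ++ x :: y :: U) z
        + ksgn k x.deg • lam 𝔏.br (V ++ 𝔏.brEntry x y :: U) z := by
    funext N
    have hN : ∀ i, psi 𝔏.br (V ++ y :: x :: U) z i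
      = ksgn k ((x.deg - 1) * (y.deg - 1)) • psi 𝔏.br (V ++ x :: y :: U) z i
        + ksgn k x.deg • psi 𝔏.br (V ++ 𝔏.brEntry x y :: U) z i :=
      fun i => by
        have := 𝔏.psi_enveloping n i hz
        exact this V x y U hl hH
    rw [Pi.add_apply, Pi.smul_apply, Pi.smul_apply, lam, lam, lam, smul_sum, smul_sum,
      ← sum_add_distrib]
    exact sum_congr rfl fun i _ => hN i
  simp only [eulerian]
  rw [h, map_add, map_smul, map_smul]

end ShiftedLie
end Enveloping

/-! ### Linearity of functions of words in each letter. -/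

section EntryLinear

open Finset

variable {k : Type*} [Field k] {Γ G M M' : Type*} [AddCommGroup G] [Module k G]
  [AddCommGroup M] [Module k M] [AddCommGroup M'] [Module k M']

variable (k) in
/-- The function `F` of lists of length at most `n` is linear in each entry. -/
def EntryLinear (n : ℕ) (F : List (Entry Γ G) → M) : Prop :=
  ∀ (V : List (Entry Γ G)) (L : Γ) (d : ℤ) (U : List (Entry Γ G)), V.length + U.length + 1 ≤ n →
    IsLinearMap k fun v => F (V ++ ⟨L, d, v⟩ :: U)

theorem EntryLinear.mono {m n : ℕ} (h : m ≤ n) {F : List (Entry Γ G) → M}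
    (hF : EntryLinear k n F) : EntryLinear k m F :=
  fun V L d U hl => hF V L d U (hl.trans h)

theorem EntryLinear.map {n : ℕ} {F : List (Entry Γ G) → M} (hF : EntryLinear k n F)
    (φ : M →ₗ[k] M') : EntryLinear k n fun U => φ (F U) := by
  intro V L d U hl
  have h := hF V L d U hl
  exact ⟨fun x y => by simp only [h.map_add, map_add],
    fun c x => by simp only [h.map_smul, map_smul]⟩

theorem EntryLinear.add {n : ℕ} {F F' : List (Entry Γ G) → M} (hF : EntryLinear k n F)
    (hF' : EntryLinear k n F') : EntryLinear k n fun U => F U + F' U := by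
  intro V L d U hl
  have h := hF V L d U hl
  have h' := hF' V L d U hl
  exact ⟨fun x y => by simp only [h.map_add, h'.map_add]; abel,
    fun c x => by simp only [h.map_smul, h'.map_smul, smul_add]⟩

theorem EntryLinear.sum {n : ℕ} {ι : Type*} (I : Finset ι) {F : ι → List (Entry Γ G) → M}
    (hF : ∀ i, EntryLinear k n (F i)) : EntryLinear k n fun U => ∑ i ∈ I, F i U := by
  intro V L d U hl
  have h := fun i => hF i V L d U hl
  exact ⟨fun x y => by simp only [fun i => (h i).map_add, sum_add_distrib],
    fun c x => by simp only [fun i => (h i).map_smul, smul_sum]⟩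

theorem EntryLinear.cons {n : ℕ} {F : List (Entry Γ G) → M} (hF : EntryLinear k (n + 1) F)
    (v : Entry Γ G) : EntryLinear k n fun U => F (v :: U) :=
  fun V L d U hl => hF (v :: V) L d U (by simp; omega)

theorem EntryLinear.ksgn_smul {n : ℕ} {F : List (Entry Γ G) → M} (hF : EntryLinear k n F)
    (f : ℤ → ℤ) : EntryLinear k n fun U => ksgn k (f (sdeg U)) • F U := by
  intro V L d U hl
  have h := hF V L d U hl
  exact ⟨fun x y => by simp only [h.map_add, smul_add, sdeg_append, sdeg],
    fun c x => by simp only [h.map_smul, sdeg_append, sdeg]; rw [smul_comm]⟩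

theorem EntryLinear.shuffle : ∀ (n : ℕ) {Φ : List (Entry Γ G) → List (Entry Γ G) → M}
    (_ : ∀ B, EntryLinear k (n - B.length) fun A => Φ A B)
    (_ : ∀ A, EntryLinear k (n - A.length) fun B => Φ A B),
    EntryLinear k n fun U => shuf k U Φ := by
  intro n Φ h1 h2 V
  induction V generalizing n Φ with
  | nil =>
    intro L d U hl
    simp only [List.nil_append, shuf]
    simp only [List.length_nil] at hl
    have key : ∀ A B, (A ++ B).Perm U → IsLinearMap k (fun v =>
        ksgn k ((d - 1) * sdeg B) • Φ (⟨L, d, v⟩ :: A) B + Φ A (⟨L, d, v⟩ :: B)) := by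
      intro A B h
      have hlen := h.length_eq
      rw [List.length_append] at hlen
      have a := h1 B [] L d A (by simp; omega)
      have b := h2 A [] L d B (by simp; omega)
      simp only [List.nil_append] at a b
      exact ⟨fun x y => by simp only [a.map_add, b.map_add, smul_add]; abel,
        fun c x => by simp only [a.map_smul, b.map_smul, smul_add]; rw [smul_comm]⟩
    refine ⟨fun x y => ?_, fun c x => ?_⟩
    · rw [← shuf_add]
      exact shuf_congr U fun A B h => (key A B h).map_add x y
    · rw [← shuf_smul]
      exact shuf_congr U fun A B h => (key A B h).map_smul c x
  | cons v V ih =>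
    intro L d U hl
    simp only [List.cons_append, shuf]
    simp only [List.length_cons] at hl
    refine ih (n - 1) (fun B => ?_) (fun A => ?_) L d U (by omega)
    -- As for `Enveloping.shuffle`, a too long `B` makes the claim vacuous.
    · by_cases hn : B.length + 1 ≤ n
      · refine EntryLinear.add (EntryLinear.map (EntryLinear.cons ((h1 B).mono ?_) v)
          (ksgn k _ • LinearMap.id)) ((h1 (v :: B)).mono ?_)
        · omega
        · simp; omega
      · intro V' _ _ U' h'
        omega
    · by_cases hn : A.length + 1 ≤ n
      · refine EntryLinear.add (EntryLinear.ksgn_smul ((h2 (v :: A)).mono ?_)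
          (fun s => (v.deg - 1) * s)) (EntryLinear.cons ((h2 A).mono ?_) v)
        · simp; omega
        · omega
      · intro V' _ _ U' h'
        omega

theorem psi_isLinearMap (br : G →ₗ[k] G →ₗ[k] G) (N : ℕ) : ∀ (U : List (Entry Γ G)),
    IsLinearMap k fun z => psi br U z N := by
  refine list_length_induction fun U ih => ?_
  match U with
  | [] => exact ⟨fun _ _ => rfl, fun _ _ => rfl⟩
  | x :: U =>
    simp only [psi_cons]
    refine ⟨fun y z => ?_, fun c z => ?_⟩
    · rw [← shuf_add]
      refine shuf_congr U fun A B h => ?_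
      have hl := perm_length_le h
      rw [(ih B (by simp; omega)).map_add, map_add, smul_add]
    · rw [← shuf_smul]
      refine shuf_congr U fun A B h => ?_
      have hl := perm_length_le h
      rw [(ih B (by simp; omega)).map_smul, map_smul, smul_comm]

theorem lam_isLinearMap (br : G →ₗ[k] G →ₗ[k] G) (N : ℕ) (U : List (Entry Γ G)) :
    IsLinearMap k fun z => lam br U z N :=
  ⟨fun x y => by simp only [lam, (psi_isLinearMap br _ U).map_add, sum_add_distrib],
    fun c x => by simp only [lam, (psi_isLinearMap br _ U).map_smul, smul_sum]⟩

theorem psi_entryLinear (br : G →ₗ[k] G →ₗ[k] G) : ∀ (n N : ℕ) (z : G),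
    EntryLinear k n fun U : List (Entry Γ G) => psi br U z N := by
  intro n
  induction n with
  | zero => intro N z V L d U h; omega
  | succ n ih => ?_
  intro N z V L d U hl
  match V with
  | v :: V =>
    simp only [List.cons_append, psi_cons]
    refine EntryLinear.shuffle n (Φ := fun A B =>
      ksgn k (sdeg A + sdeg B * (1 + v.deg)) •
        br (lam br A v.val N) (psi br B z N)) (fun B => ?_) (fun A => ?_) V L d U
      (by simp at hl; omega)
    · refine EntryLinear.ksgn_smul (f := fun s => s + sdeg B * (1 + v.deg)) ?_
      have : EntryLinear k (n - B.length) fun U => lam br U v.val N :=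
        EntryLinear.sum _ fun i => (ih i v.val).mono (by omega)
      exact this.map (br.flip (psi br B z N))
    · refine EntryLinear.ksgn_smul (f := fun s => sdeg A + s * (1 + v.deg)) ?_
      exact ((ih N z).mono (by omega)).map (br (lam br A v.val N))
  | [] =>
    simp only [List.nil_append, psi_cons]
    refine ⟨fun y z => ?_, fun c z => ?_⟩
    · rw [← shuf_add]
      refine shuf_congr U fun A B h => ?_
      rw [(lam_isLinearMap br N A).map_add, map_add, LinearMap.add_apply, smul_add]
    · rw [← shuf_smul]
      refine shuf_congr U fun A B h => ?_
      rw [(lam_isLinearMap br N A).map_smul, map_smul, LinearMap.smul_apply, smul_comm]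

/-- The extraction `linCoeff` is linear on all functions of `N`, so polynomiality plays no role
here. -/
theorem eulerian_entryLinear [CharZero k] (br : G →ₗ[k] G →ₗ[k] G) (n : ℕ) (z : G) :
    EntryLinear k n fun U : List (Entry Γ G) => ShiftedLie.eulerian k br U z := by
  have : EntryLinear k n fun U : List (Entry Γ G) => lam br U z := by
    intro V L d U hl
    have h := fun N => EntryLinear.sum (range N) (fun i => psi_entryLinear br n i z) V L d U hl
    exact ⟨fun x y => funext fun N => (h N).map_add x y,
      fun c x => funext fun N => (h N).map_smul c x⟩
  exact this.map (linCoeff k G)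

theorem eulerian_isLinearMap [CharZero k] (br : G →ₗ[k] G →ₗ[k] G) (U : List (Entry Γ G)) :
    IsLinearMap k fun z => ShiftedLie.eulerian k br U z := by
  refine ⟨fun x y => ?_, fun c x => ?_⟩
  · simp only [ShiftedLie.eulerian]
    rw [← map_add]
    exact congrArg _ (funext fun N => (lam_isLinearMap br N U).map_add x y)
  · simp only [ShiftedLie.eulerian]
    rw [← map_smul]
    exact congrArg _ (funext fun N => (lam_isLinearMap br N U).map_smul c x)

end EntryLinear

/-! ### The operations `l_2`, `n_{1,0}`, `n_{0,2}` on classes of Swiss-cheese trees. -/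

section Contexts

open PTree

open Finsupp (single)

variable {k : Type*} [Field k] {α : Type} {κ κ₁ κ₂ κ₃ : Kind}

theorem mk_ext {th : Theory} {M : Type*} [AddCommGroup M] [Module k M]
    {f g : Trees k th α κ →ₗ[k] M} (h : ∀ t, f (mk k th t) = g (mk k th t)) : f = g := by
  refine Submodule.linearMap_qext _ (Finsupp.lhom_ext' fun t => LinearMap.ext_ring ?_)
  exact h t

/-- The map of classes induced by a unary context. -/
def unaryMap {th : Theory} (F : PTree α κ₁ → PTree α κ₂)
    (hF : ∀ r, Relator k th κ₁ r → Relator k th κ₂ (r.mapDomain F)) :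
    Trees k th α κ₁ →ₗ[k] Trees k th α κ₂ :=
  (RelSpan k th α κ₁).mapQ _ (Finsupp.lmapDomain k k F)
    (RelSpan.le _ _ fun r hr => Submodule.subset_span (hF r hr))

theorem unaryMap_mk {th : Theory} (F : PTree α κ₁ → PTree α κ₂)
    (hF : ∀ r, Relator k th κ₁ r → Relator k th κ₂ (r.mapDomain F)) (t : PTree α κ₁) :
    unaryMap F hF (mk k th t) = mk k th (F t) := by
  rw [unaryMap, mk, Submodule.mapQ_apply, Finsupp.lmapDomain_apply, Finsupp.mapDomain_single, mk]

/-- A relator in the first slot gives a linear map on the second slot; evaluated on a tree `y`, it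
is the class of a relator in the context `C - y`. -/
theorem binaryMap_relator {th : Theory} (C : PTree α κ₁ → PTree α κ₂ → PTree α κ₃)
    (hl : ∀ y r, Relator k th κ₁ r → Relator k th κ₃ (r.mapDomain fun x => C x y))
    (hr : ∀ x r, Relator k th κ₂ r → Relator k th κ₃ (r.mapDomain fun y => C x y)) :
    RelSpan k th α κ₁ ≤
      LinearMap.ker (Finsupp.linearCombination k fun x => unaryMap (k := k) (C x) (hr x)) := by
  refine Submodule.span_le.2 fun r h => ?_
  refine LinearMap.mem_ker.2 (mk_ext fun y => ?_)
  have : Finsupp.linearCombination k (fun x => unaryMap (C x) (hr x)) r (mk k th y)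
      = (RelSpan k th α κ₃).mkQ (r.mapDomain fun x => C x y) := by
    rw [Finsupp.linearCombination_apply, Finsupp.mapDomain, Finsupp.sum, Finsupp.sum,
      LinearMap.sum_apply, map_sum]
    refine Finset.sum_congr rfl fun x _ => ?_
    rw [LinearMap.smul_apply, unaryMap_mk, Submodule.mkQ_apply, mk_single]
  rw [this, LinearMap.zero_apply, Submodule.mkQ_apply, Submodule.Quotient.mk_eq_zero]
  exact Submodule.subset_span (hl y r h)

/-- The map of classes induced by a binary context. -/
def binaryMap {th : Theory} (C : PTree α κ₁ → PTree α κ₂ → PTree α κ₃)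
    (hl : ∀ y r, Relator k th κ₁ r → Relator k th κ₃ (r.mapDomain fun x => C x y))
    (hr : ∀ x r, Relator k th κ₂ r → Relator k th κ₃ (r.mapDomain fun y => C x y)) :
    Trees k th α κ₁ →ₗ[k] Trees k th α κ₂ →ₗ[k] Trees k th α κ₃ :=
  (RelSpan k th α κ₁).liftQ _ (binaryMap_relator C hl hr)

theorem binaryMap_mk {th : Theory} (C : PTree α κ₁ → PTree α κ₂ → PTree α κ₃)
    (hl : ∀ y r, Relator k th κ₁ r → Relator k th κ₃ (r.mapDomain fun x => C x y))
    (hr : ∀ x r, Relator k th κ₂ r → Relator k th κ₃ (r.mapDomain fun y => C x y))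
    (x : PTree α κ₁) (y : PTree α κ₂) :
    binaryMap C hl hr (mk k th x) (mk k th y) = mk k th (C x y) := by
  rw [binaryMap, mk, Submodule.liftQ_apply, Finsupp.linearCombination_single, one_smul,
    unaryMap_mk]

variable (k α)

/-- Classes of trees modulo the Swiss-cheese relations. -/
abbrev SCTrees (κ : Kind) := Trees k .swissCheese α κ

/-- The bracket `l_2`. -/
def bracketMap : SCTrees k α .sp →ₗ[k] SCTrees k α .sp →ₗ[k] SCTrees k α .sp :=
  binaryMap (fun s t => vert .l (scons s (scons t snil)))
    (fun y r h => by
      have := Relator.vert .l _ (h.scons_left r (scons y snil))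
      rwa [← Finsupp.mapDomain_comp] at this)
    (fun x r h => by
      have := Relator.vert .l _ (Relator.scons_right x _ (h.scons_left r snil))
      rwa [← Finsupp.mapDomain_comp, ← Finsupp.mapDomain_comp] at this)

/-- The operation `n_{1,0}`. -/
def centralMap : SCTrees k α .sp →ₗ[k] SCTrees k α .pl :=
  unaryMap (fun s => pvert (scons s snil) pnil)
    (fun r h => by
      have := Relator.pvert_left _ pnil (h.scons_left r snil)
      rwa [← Finsupp.mapDomain_comp] at this)

/-- The product `n_{0,2}`. -/
def productMap : SCTrees k α .pl →ₗ[k] SCTrees k α .pl →ₗ[k] SCTrees k α .pl :=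
  binaryMap (fun s t => pvert snil (pcons s (pcons t pnil)))
    (fun y r h => by
      have := Relator.pvert_right snil _ (h.pcons_left r (pcons y pnil))
      rwa [← Finsupp.mapDomain_comp] at this)
    (fun x r h => by
      have := Relator.pvert_right snil _ (Relator.pcons_right x _ (h.pcons_left r pnil))
      rwa [← Finsupp.mapDomain_comp, ← Finsupp.mapDomain_comp] at this)

variable {k α}

theorem bracketMap_mk (s t : PTree α .sp) :
    bracketMap k α (mk k .swissCheese s) (mk k .swissCheese t)
      = mk k .swissCheese (vert .l (scons s (scons t snil))) := binaryMap_mk _ _ _ s t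

theorem centralMap_mk (s : PTree α .sp) :
    centralMap k α (mk k .swissCheese s) = mk k .swissCheese (pvert (scons s snil) pnil) :=
  unaryMap_mk _ _ s

theorem productMap_mk (s t : PTree α .pl) :
    productMap k α (mk k .swissCheese s) (mk k .swissCheese t)
      = mk k .swissCheese (pvert snil (pcons s (pcons t pnil))) := binaryMap_mk _ _ _ s t

variable (k) in
/-- Classes of the trees built from `l_2`, `n_{1,0}` and `n_{0,2}` with the given spatial labels,
number of planar leaves and degree. -/
def piece (κ : Kind) (L : Multiset α) (q : ℕ) (d : ℤ) : Submodule k (SCTrees k α κ) :=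
  Submodule.span k (mk k .swissCheese ''
    {t | t.Adm OCVertex OCCorolla ∧ t.labels = L ∧ t.planar = q ∧ t.deg = d})

theorem piece_map {M : Type*} [AddCommGroup M] [Module k M] (N : Submodule k M)
    (f : SCTrees k α κ →ₗ[k] M) {L : Multiset α} {q : ℕ} {d : ℤ}
    (h : ∀ t : PTree α κ, t.Adm OCVertex OCCorolla → t.labels = L → t.planar = q → t.deg = d →
      f (mk k .swissCheese t) ∈ N) {x : SCTrees k α κ} (hx : x ∈ piece k κ L q d) : f x ∈ N := by
  have : piece k κ L q d ≤ N.comap f := by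
    refine Submodule.span_le.2 ?_
    rintro _ ⟨t, ⟨h1, h2, h3, h4⟩, rfl⟩
    exact h t h1 h2 h3 h4
  exact this hx

/-- Identities with Koszul signs make sense only for given degrees, and this reduces them to single
trees with prescribed labels and degree, where they are defining relations. -/
theorem piece_congr {M : Type*} [AddCommGroup M] [Module k M]
    {f g : SCTrees k α κ →ₗ[k] M} {L : Multiset α} {q : ℕ} {d : ℤ}
    (h : ∀ t : PTree α κ, t.Adm OCVertex OCCorolla → t.labels = L → t.planar = q → t.deg = d →
      f (mk k .swissCheese t) = g (mk k .swissCheese t))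
    {x : SCTrees k α κ} (hx : x ∈ piece k κ L q d) : f x = g x := by
  have := piece_map ⊥ (f - g) (fun t h1 h2 h3 h4 => by
    rw [Submodule.mem_bot, LinearMap.sub_apply, h t h1 h2 h3 h4, sub_self]) hx
  rwa [Submodule.mem_bot, LinearMap.sub_apply, sub_eq_zero] at this

theorem mk_mem_piece {t : PTree α κ} {L : Multiset α} {q : ℕ} {d : ℤ}
    (h : t.Adm OCVertex OCCorolla) (h1 : t.labels = L) (h2 : t.planar = q) (h3 : t.deg = d) :
    mk k .swissCheese t ∈ piece k κ L q d :=
  Submodule.subset_span ⟨t, ⟨h, h1, h2, h3⟩, rfl⟩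

theorem mem_piece_of_eq {x : SCTrees k α κ} {L L' : Multiset α} {q q' : ℕ} {d d' : ℤ}
    (hx : x ∈ piece k κ L q d) (hL : L' = L) (hq : q' = q) (hd : d' = d) :
    x ∈ piece k κ L' q' d' := by
  subst hL hq hd
  exact hx

theorem bracketMap_mem {L L' : Multiset α} {d d' : ℤ} {x y : SCTrees k α .sp}
    (hx : x ∈ piece k .sp L 0 d) (hy : y ∈ piece k .sp L' 0 d') :
    bracketMap k α x y ∈ piece k .sp (L + L') 0 (d + d' - 1) := by
  refine piece_map _ ((bracketMap k α).flip y) (fun s h1 h2 h3 h4 => ?_) hx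
  refine piece_map _ (bracketMap k α (mk k .swissCheese s)) (fun t g1 g2 g3 g4 => ?_) hy
  rw [bracketMap_mk]
  refine mk_mem_piece ⟨⟨rfl, rfl⟩, h1, g1, trivial⟩ ?_ ?_ ?_
  · simp [labels, h2, g2]
  · simp [planar, h3, g3]
  · simp [deg, len, h4, g4]; ring

theorem centralMap_mem {L : Multiset α} {d : ℤ} {x : SCTrees k α .sp}
    (hx : x ∈ piece k .sp L 0 d) : centralMap k α x ∈ piece k .pl L 0 d := by
  refine piece_map _ (centralMap k α) (fun s h1 h2 h3 h4 => ?_) hx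
  rw [centralMap_mk]
  refine mk_mem_piece ⟨Or.inl ⟨rfl, rfl⟩, ⟨h1, trivial⟩, trivial⟩ ?_ ?_ ?_
  · simp [labels, h2]
  · simp [planar, h3]
  · simp [deg, len, h4]

theorem productMap_mem {L L' : Multiset α} {q q' : ℕ} {d d' : ℤ} {x y : SCTrees k α .pl}
    (hx : x ∈ piece k .pl L q d) (hy : y ∈ piece k .pl L' q' d') :
    productMap k α x y ∈ piece k .pl (L + L') (q + q') (d + d') := by
  refine piece_map _ ((productMap k α).flip y) (fun s h1 h2 h3 h4 => ?_) hx
  refine piece_map _ (productMap k α (mk k .swissCheese s)) (fun t g1 g2 g3 g4 => ?_) hy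
  rw [productMap_mk]
  refine mk_mem_piece ⟨Or.inr ⟨rfl, rfl⟩, trivial, h1, g1, trivial⟩ ?_ ?_ ?_
  · simp [labels, h2, g2]
  · simp [planar, h3, g3]
  · simp [deg, len, h4, g4]

theorem mkQ_relator {th : Theory} {r : Raw k α κ} (h : Relator k th κ r) :
    (RelSpan k th α κ).mkQ r = 0 := by
  rw [Submodule.mkQ_apply, Submodule.Quotient.mk_eq_zero]
  exact Submodule.subset_span h

theorem mkQ_single {th : Theory} (t : PTree α κ) (c : k) :
    (RelSpan k th α κ).mkQ (single t c) = c • mk k th t := mk_single k th t c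

theorem bracketMap_symm {L L' : Multiset α} {d d' : ℤ} {x y : SCTrees k α .sp}
    (hx : x ∈ piece k .sp L 0 d) (hy : y ∈ piece k .sp L' 0 d') :
    bracketMap k α x y = ksgn k (d * d') • bracketMap k α y x := by
  refine piece_congr (f := (bracketMap k α).flip y) (g := ksgn k (d * d') • bracketMap k α y)
    (fun s h1 h2 h3 h4 => ?_) hx
  refine piece_congr (f := bracketMap k α (mk k .swissCheese s))
    (g := ksgn k (d * d') • (bracketMap k α).flip (mk k .swissCheese s))
    (fun t g1 g2 g3 g4 => ?_) hy
  have := mkQ_relator (k := k) (.vert .l _ (.base _ _ (.swap .swissCheese s t snil)))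
  rw [Finsupp.mapDomain_sub, Finsupp.mapDomain_single, Finsupp.mapDomain_single, map_sub,
    mkQ_single, mkQ_single, one_smul, sub_eq_zero, h4, g4] at this
  rw [LinearMap.smul_apply, LinearMap.flip_apply, bracketMap_mk, bracketMap_mk, this]

theorem bracketMap_jacobi {L L' L'' : Multiset α} {a b c : ℤ} {x y z : SCTrees k α .sp}
    (hx : x ∈ piece k .sp L 0 a) (hy : y ∈ piece k .sp L' 0 b) (hz : z ∈ piece k .sp L'' 0 c) :
    bracketMap k α (bracketMap k α x y) z
      = ksgn k (a + 1) • bracketMap k α x (bracketMap k α y z)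
        + ksgn k ((a - 1) * b + 1) • bracketMap k α y (bracketMap k α x z) := by
  have key : bracketMap k α (bracketMap k α x y) z
      + ksgn k (a * (b + c)) • bracketMap k α (bracketMap k α y z) x
      + ksgn k (c * (a + b)) • bracketMap k α (bracketMap k α z x) y = 0 := by
    refine piece_congr (g := 0) (f := (bracketMap k α).flip z ∘ₗ (bracketMap k α).flip y
      + ksgn k (a * (b + c)) • bracketMap k α (bracketMap k α y z)
      + ksgn k (c * (a + b)) • (bracketMap k α).flip y ∘ₗ bracketMap k α z)
      (fun s h1 h2 h3 h4 => ?_) hx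
    refine piece_congr (g := 0) (f := (bracketMap k α).flip z ∘ₗ bracketMap k α (mk k _ s)
      + ksgn k (a * (b + c)) • (bracketMap k α).flip (mk k _ s) ∘ₗ (bracketMap k α).flip z
      + ksgn k (c * (a + b)) • bracketMap k α (bracketMap k α z (mk k _ s)))
      (fun t g1 g2 g3 g4 => ?_) hy
    refine piece_congr (g := 0) (f := bracketMap k α (bracketMap k α (mk k _ s) (mk k _ t))
      + ksgn k (a * (b + c)) • (bracketMap k α).flip (mk k _ s) ∘ₗ bracketMap k α (mk k _ t)
      + ksgn k (c * (a + b)) • (bracketMap k α).flip (mk k _ t) ∘ₗ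
        (bracketMap k α).flip (mk k _ s)) (fun u e1 e2 e3 e4 => ?_) hz
    have := mkQ_relator (k := k) (.base _ _ (.jacobi s t u))
    rw [map_add, map_add, mkQ_single, mkQ_single, mkQ_single, one_smul, h4, g4, e4] at this
    simp only [LinearMap.add_apply, LinearMap.smul_apply, LinearMap.comp_apply,
      LinearMap.flip_apply, bracketMap_mk, LinearMap.zero_apply]
    exact this
  -- The symmetry of the bracket turns the cyclic form of the Jacobi identity into the derivation
  -- form required by `ShiftedLie`.
  rw [bracketMap_symm (bracketMap_mem hy hz) hx, bracketMap_symm (bracketMap_mem hz hx) hy,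
    bracketMap_symm hz hx, map_smul, ksgn_smul_smul, ksgn_smul_smul, ksgn_smul_smul,
    add_assoc] at key
  rw [eq_neg_of_add_eq_zero_left key, neg_add, neg_eq_ksgn_smul (k := k), neg_eq_ksgn_smul (k := k),
    ksgn_smul_smul, ksgn_smul_smul]
  congr 1
  · exact ksgn_smul_congr (k := k) (by clear key; push_cast; grind) _
  · exact ksgn_smul_congr (k := k) (by clear key; push_cast; grind) _

/-- Associativity of the degree-zero product carries no sign, so no homogeneity is assumed. -/
theorem productMap_assoc (x y z : SCTrees k α .pl) :
    productMap k α (productMap k α x y) z = productMap k α x (productMap k α y z) := by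
  obtain ⟨r, rfl⟩ := Submodule.mkQ_surjective _ x
  obtain ⟨s, rfl⟩ := Submodule.mkQ_surjective _ y
  obtain ⟨t, rfl⟩ := Submodule.mkQ_surjective _ z
  induction r using Finsupp.induction_linear with
  | zero => simp
  | add f g hf hg => simp only [map_add, LinearMap.add_apply, hf, hg]
  | single a c => ?_
  induction s using Finsupp.induction_linear with
  | zero => simp
  | add f g hf hg => simp only [map_add, LinearMap.add_apply, hf, hg]
  | single b c' => ?_
  induction t using Finsupp.induction_linear with
  | zero => simp
  | add f g hf hg => simp only [map_add, hf, hg]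
  | single d c'' => ?_
  have := mkQ_relator (k := k) (.base _ _ (.assoc_n a b d))
  rw [map_sub, mkQ_single, mkQ_single, one_smul, one_smul, sub_eq_zero] at this
  simp only [mkQ_single, map_smul, LinearMap.smul_apply, productMap_mk, this]

theorem centralMap_central {L L' : Multiset α} {q : ℕ} {d d' : ℤ} {x : SCTrees k α .sp}
    {a : SCTrees k α .pl} (hx : x ∈ piece k .sp L 0 d) (ha : a ∈ piece k .pl L' q d') :
    productMap k α (centralMap k α x) a
      = ksgn k (d * d') • productMap k α a (centralMap k α x) := by
  refine piece_congr (f := (productMap k α).flip a ∘ₗ centralMap k α)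
    (g := ksgn k (d * d') • productMap k α a ∘ₗ centralMap k α) (fun s h1 h2 h3 h4 => ?_) hx
  refine piece_congr (f := productMap k α (centralMap k α (mk k _ s)))
    (g := ksgn k (d * d') • (productMap k α).flip (centralMap k α (mk k _ s)))
    (fun t g1 g2 g3 g4 => ?_) ha
  have := mkQ_relator (k := k) (.base _ _ (.central s t))
  rw [map_sub, mkQ_single, mkQ_single, one_smul, sub_eq_zero, h4, g4] at this
  rw [LinearMap.smul_apply, LinearMap.flip_apply, centralMap_mk, productMap_mk, productMap_mk, this]

variable (k α) in
/-- The Lie algebra of spatial trees. -/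
def spatialLie : ShiftedLie k (Multiset α) (SCTrees k α .sp) where
  br := bracketMap k α
  part L d := piece k .sp L 0 d
  br_mem := bracketMap_mem
  br_symm := bracketMap_symm
  jacobi := bracketMap_jacobi

end Contexts

/-! ### The values of the morphism on trees, and their invariance under relations. -/

section TreeMap

open PTree ShiftedLie

open Finsupp (single)

variable {k : Type*} [Field k] {α : Type} {κ : Kind}

theorem eq_snil {f : PTree α .sps} (h : f.len = 0) : f = snil := by
  cases f with
  | snil => rfl
  | scons t f => simp [len] at h

theorem eq_pnil {g : PTree α .pls} (h : g.len = 0) : g = pnil := by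
  cases g with
  | pnil => rfl
  | pcons t f => simp [len] at h

theorem eq_scons {f : PTree α .sps} {n : ℕ} (h : f.len = n + 1) :
    ∃ t f', f = scons t f' ∧ f'.len = n := by
  cases f with
  | snil => simp [len] at h
  | scons t f => exact ⟨t, f, rfl, by simpa [len] using h⟩

theorem eq_pcons {g : PTree α .pls} {n : ℕ} (h : g.len = n + 1) :
    ∃ t g', g = pcons t g' ∧ g'.len = n := by
  cases g with
  | pnil => simp [len] at h
  | pcons t f => exact ⟨t, f, rfl, by simpa [len] using h⟩

variable (k)

theorem collapseTree_leaf (a : α) :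
    collapseTree k (leaf a) = mk k .swissCheese (leaf a) := if_pos trivial

theorem collapseTree_vert_eq_zero {w : Vtx} {f : PTree α .sps} (h : ¬ OCVertex w f.len) :
    collapseTree k (vert w f) = 0 := if_neg fun h' => h h'.1

/-- This holds for arbitrary trees, since a forbidden vertex in `s` or `t` makes both sides zero. -/
theorem collapseTree_bracket (s t : PTree α .sp) :
    collapseTree k (vert .l (scons s (scons t snil)))
      = bracketMap k α (collapseTree k s) (collapseTree k t) := by
  have h : (vert .l (scons s (scons t snil))).Adm OCVertex OCCorolla
      ↔ s.Adm OCVertex OCCorolla ∧ t.Adm OCVertex OCCorolla := by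
    simp [Adm, OCVertex, len]
  unfold collapseTree
  by_cases hs : s.Adm OCVertex OCCorolla
  · by_cases ht : t.Adm OCVertex OCCorolla
    · rw [if_pos (h.2 ⟨hs, ht⟩), if_pos hs, if_pos ht, bracketMap_mk]
    · rw [if_neg fun h' => ht (h.1 h').2, if_neg ht, map_zero]
  · rw [if_neg fun h' => hs (h.1 h').1, if_neg hs, map_zero, LinearMap.zero_apply]

theorem collapseTree_mem (t : PTree α .sp) :
    collapseTree k t ∈ piece k .sp t.labels 0 t.deg := by
  unfold collapseTree
  split_ifs with h
  · exact mk_mem_piece h rfl (planar_eq_zero t (Or.inl rfl)) rfl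
  · exact Submodule.zero_mem _

/-- The class of the tree in a list of length one. -/
def soleValue : PTree α .sps → SCTrees k α .sp
  | scons t snil => collapseTree k t
  | _ => 0

theorem soleValue_scons (t : PTree α .sp) (f : PTree α .sps) :
    soleValue k (scons t f) = if f.len = 0 then collapseTree k t else 0 := by
  cases f with
  | snil => rfl
  | scons s f => rw [if_neg (by simp [len])]; rfl

theorem soleValue_eq_zero {f : PTree α .sps} (h : f.len ≠ 1) : soleValue k f = 0 := by
  cases f with
  | snil => rfl
  | scons s f => rw [soleValue_scons, if_neg fun h' => h (by simp [len, h'])]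

theorem soleValue_mem (f : PTree α .sps) : soleValue k f ∈ piece k .sp f.labels 0 f.deg := by
  cases f with
  | snil => exact Submodule.zero_mem _
  | scons t f =>
    rw [soleValue_scons]
    split_ifs with h
    · rw [eq_snil h]
      simpa [labels, deg] using collapseTree_mem k t
    · exact Submodule.zero_mem _

/-- Entries with values in the spatial trees. -/
abbrev TreeEntry (k : Type*) [Field k] (α : Type) := Entry (Multiset α) (SCTrees k α .sp)

/-- A list of spatial trees of length one as entry. -/
def soleEntry (f : PTree α .sps) : TreeEntry k α := ⟨f.labels, f.deg, soleValue k f⟩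

/-- A spatial tree as entry. -/
def treeEntry (x : PTree α .sp) : TreeEntry k α := ⟨x.labels, x.deg, collapseTree k x⟩

theorem soleEntry_scons (x : PTree α .sp) : soleEntry k (scons x snil) = treeEntry k x := by
  rw [soleEntry, soleValue_scons, if_pos (by simp [len]), treeEntry]
  simp [labels, deg]

/-- The linear extension of `soleValue`. -/
abbrev soleRaw : Raw k α .sps →ₗ[k] SCTrees k α .sp := Finsupp.linearCombination k (soleValue k)

/-- The linear extension of `collapseTree`. -/
abbrev collapseRaw : Raw k α .sp →ₗ[k] SCTrees k α .sp :=
  Finsupp.linearCombination k (collapseTree k)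

variable {k}

theorem IsLinearMap.linearCombination {X M N : Type*} [AddCommGroup M] [Module k M]
    [AddCommGroup N] [Module k N] {F : M → N} (hF : IsLinearMap k F) (v : X → M) (r : X →₀ k) :
    Finsupp.linearCombination k (fun t => F (v t)) r = F (Finsupp.linearCombination k v r) :=
  linearCombination_comp_linear v _ (hF.mk' F) r fun _ => rfl

theorem linearCombination_shuf {X Γ G M : Type*} [AddCommGroup M] [Module k M]
    (U : List (Entry Γ G)) (Φ : X → List (Entry Γ G) → List (Entry Γ G) → M) (r : X →₀ k) :
    Finsupp.linearCombination k (fun t => shuf k U (Φ t)) r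
      = shuf k U fun A B => Finsupp.linearCombination k (fun t => Φ t A B) r := by
  simp only [Finsupp.linearCombination_apply, Finsupp.sum, ← shuf_smul, shuf_sum]

theorem soleRaw_scons_left (r : Raw k α .sp) (h : collapseRaw k r = 0) (f : PTree α .sps) :
    soleRaw k (r.mapDomain fun t => scons t f) = 0 := by
  rw [soleRaw, Finsupp.linearCombination_mapDomain]
  simp only [Function.comp_def, soleValue_scons]
  split_ifs
  · exact h
  · exact linearCombination_eq_zero _ _ fun _ _ => rfl

theorem soleRaw_scons_right {r : Raw k α .sps} (hr : ∀ t, r t ≠ 0 → t.len ≠ 0)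
    (t : PTree α .sp) : soleRaw k (r.mapDomain fun f => scons t f) = 0 := by
  rw [soleRaw, Finsupp.linearCombination_mapDomain]
  refine linearCombination_eq_zero _ _ fun f hf => ?_
  simp only [Function.comp_def, soleValue_scons]
  rw [if_neg (hr f hf)]

/-- A relation never involves an empty list, so it selects a single branch wherever a definition
distinguishes empty lists of inputs. -/
theorem Relator.len_ne_zero {th : Theory} {κ : Kind} {r : Raw k α κ} (h : Relator k th κ r)
    (hκ : κ = .sps ∨ κ = .pls) : ∀ t, r t ≠ 0 → t.len ≠ 0 := by
  classical
  have key : ∀ {κ' : Kind} (F : PTree α κ' → PTree α κ) (r : Raw k α κ')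
      (_ : ∀ t, (F t).len ≠ 0), ∀ t, r.mapDomain F t ≠ 0 → t.len ≠ 0 := by
    intro κ' F r hF t ht
    obtain ⟨s, _, rfl⟩ := Finset.mem_image.mp
      (Finsupp.mapDomain_support (Finsupp.mem_support_iff.mpr ht))
    exact hF s
  cases h with
  | base κ r h =>
    cases h with
    | swap _ a b f =>
      intro t ht
      by_cases h1 : scons a (scons b f) = t
      · rw [← h1]; simp [len]
      · by_cases h2 : scons b (scons a f) = t
        · rw [← h2]; simp [len]
        · simp [h1, h2] at ht
    | _ => rcases hκ with h | h <;> cases h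
  | scons_left r f _ => exact key _ r fun t => by simp [len]
  | scons_right s r _ => exact key _ r fun t => by simp [len]
  | pcons_left r f _ => exact key _ r fun t => by simp [len]
  | pcons_right s r _ => exact key _ r fun t => by simp [len]
  | _ => rcases hκ with h | h <;> cases h

variable (k) [CharZero k]

open Classical in
/-- The value of the morphism on a planar tree preceded by vertices `n_{1,1}` with the spatial
inputs `U`, the last one first.  On lists of planar trees, the second argument is the length of
the list: a list of length one is sent to the value of its member, a list of length two to the
product. -/
def muTree : {κ : Kind} → PTree α κ → ℕ → List (TreeEntry k α) → SCTrees k α .pl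
  | _, leaf _, _, _ => 0
  | _, vert _ _, _, _ => 0
  | _, snil, _, _ => 0
  | _, scons _ _, _, _ => 0
  | _, edge, _, U => if U = [] then mk k .swissCheese edge else 0
  | _, pvert f g, _, U => (if g.len = 0 then
        centralMap k α (eulerian k (bracketMap k α) U (soleValue k f)) else 0)
      + (if f.len = 0 then muTree g 2 U else 0) + muTree g 1 (soleEntry k f :: U)
  | _, pnil, _, _ => 0
  | _, pcons a g, j, U => if j = 1 then (if g.len = 0 then muTree a 0 U else 0) else
      shuf k U fun A B => ksgn k (sdeg B * a.deg) • productMap k α (muTree a 0 A) (muTree g 1 B)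

/-- A derivation kills the bare planar edge. For this reason the corolla `n_{1,1}` is sent to zero.
-/
theorem muTree_edge (j : ℕ) (U : List (TreeEntry k α)) :
    muTree k edge j U = open Classical in if U = [] then mk k .swissCheese edge else 0 := by
  simp only [muTree]

/-- The summands are the contributions of `n_{1,0}`, `n_{0,2}` and `n_{1,1}`; at most one is
nonzero. The first two absorb the word `U`, by the Eulerian idempotent or the coproduct, and
`n_{1,1}` prepends its spatial input to the word. -/
theorem muTree_pvert (f : PTree α .sps) (g : PTree α .pls) (j : ℕ) (U : List (TreeEntry k α)) :
    muTree k (pvert f g) j U = (if g.len = 0 then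
        centralMap k α (eulerian k (bracketMap k α) U (soleValue k f)) else 0)
      + (if f.len = 0 then muTree k g 2 U else 0) + muTree k g 1 (soleEntry k f :: U) := by
  simp only [muTree]

theorem muTree_pnil (j : ℕ) (U : List (TreeEntry k α)) : muTree k pnil j U = 0 := by
  simp only [muTree]

theorem muTree_pcons_one (a : PTree α .pl) (g : PTree α .pls) (U : List (TreeEntry k α)) :
    muTree k (pcons a g) 1 U = if g.len = 0 then muTree k a 0 U else 0 := by
  simp only [muTree, if_true]

/-- Derivations act on a product through the coproduct of the word; the sign comes from moving `B`
past `a`. -/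
theorem muTree_pcons (a : PTree α .pl) (g : PTree α .pls) {j : ℕ} (hj : j ≠ 1)
    (U : List (TreeEntry k α)) : muTree k (pcons a g) j U = shuf k U fun A B =>
      ksgn k (sdeg B * a.deg) • productMap k α (muTree k a 0 A) (muTree k g 1 B) := by
  simp only [muTree, if_neg hj]

theorem muTree_one_eq_zero {g : PTree α .pls} (h : g.len ≠ 1) (U : List (TreeEntry k α)) :
    muTree k g 1 U = 0 := by
  cases g with
  | pnil => exact muTree_pnil k 1 U
  | pcons a g => rw [muTree_pcons_one, if_neg fun h' => h (by simp [len, h'])]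

theorem muTree_two_eq_zero {g : PTree α .pls} (h : g.len ≠ 2) (U : List (TreeEntry k α)) :
    muTree k g 2 U = 0 := by
  cases g with
  | pnil => exact muTree_pnil k 2 U
  | pcons a g =>
    rw [muTree_pcons k a g (by decide), ← shuf_zero (k := k) U]
    refine shuf_congr U fun A B _ => ?_
    rw [muTree_one_eq_zero k fun h' => h (by simp [len, h']), map_zero, smul_zero]

variable {k}

theorem eulerian_zero (U : List (TreeEntry k α)) : eulerian k (bracketMap k α) U 0 = 0 :=
  (eulerian_isLinearMap (bracketMap k α) U).map_zero

open Classical in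
-- Entries are classes, not trees. Linearity gives zero as soon as an entry vanishes, for instance
-- on a relator or a differential, and lets signs be pulled out of entries.
theorem muTree_entryLinear {κ : Kind} (t : PTree α κ) :
    ∀ (j n : ℕ), EntryLinear k n (muTree k t j) := by
  have zero : ∀ n : ℕ, EntryLinear k n fun _ : List (TreeEntry k α) => (0 : SCTrees k α .pl) :=
    fun n V L d U _ => ⟨fun _ _ => (add_zero _).symm, fun _ _ => (smul_zero _).symm⟩
  induction t with
  | edge =>
    intro j n V L d U _
    have : ∀ v : SCTrees k α .sp, muTree k edge j (V ++ ⟨L, d, v⟩ :: U) = 0 := by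
      intro v
      rw [muTree_edge, if_neg (by simp)]
    simp only [this]
    exact ⟨fun _ _ => (add_zero _).symm, fun _ _ => (smul_zero _).symm⟩
  | pvert f g _ ih =>
    intro j n
    have e : muTree k (pvert f g) j = fun U => (if g.len = 0 then
        centralMap k α (eulerian k (bracketMap k α) U (soleValue k f)) else 0)
        + (if f.len = 0 then muTree k g 2 U else 0) + muTree k g 1 (soleEntry k f :: U) :=
      funext fun U => muTree_pvert k f g j U
    rw [e]
    refine EntryLinear.add (EntryLinear.add ?_ ?_) ?_
    · split_ifs
      · exact EntryLinear.map (eulerian_entryLinear _ n _) _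
      · exact zero n
    · split_ifs
      · exact ih 2 n
      · exact zero n
    · exact EntryLinear.cons (ih 1 (n + 1)) _
  | pcons a g iha ihg =>
    intro j n
    by_cases hj : j = 1
    · subst hj
      have e : muTree k (pcons a g) 1 = fun U => if g.len = 0 then muTree k a 0 U else 0 :=
        funext fun U => muTree_pcons_one k a g U
      rw [e]
      split_ifs
      · exact iha 0 n
      · exact zero n
    · have e : muTree k (pcons a g) j = fun U => shuf k U fun A B =>
          ksgn k (sdeg B * a.deg) • productMap k α (muTree k a 0 A) (muTree k g 1 B) :=
        funext fun U => muTree_pcons k a g hj U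
      rw [e]
      refine EntryLinear.shuffle n (fun B => ?_) (fun A => ?_)
      · exact EntryLinear.map (iha 0 _)
          (ksgn k (sdeg B * a.deg) • (productMap k α).flip (muTree k g 1 B))
      · exact EntryLinear.ksgn_smul (f := fun s => s * a.deg)
          (EntryLinear.map (ihg 1 _) (productMap k α (muTree k a 0 A)))
  | _ => intro j n; simpa only [muTree] using zero n

theorem muTree_entry_zero {κ : Kind} (t : PTree α κ) (j : ℕ) (L : Multiset α) (d : ℤ)
    (U : List (TreeEntry k α)) : muTree k t j (⟨L, d, 0⟩ :: U) = 0 :=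
  (muTree_entryLinear t j _ [] L d U le_rfl).map_zero

/-- Only `n_{1,0}`, `n_{0,2}` and `n_{1,1}` can contribute: `soleValue` vanishes unless there is
exactly one spatial input, and lists of planar trees are evaluated in lengths one and two only. -/
theorem muTree_pvert_eq_zero {f : PTree α .sps} {g : PTree α .pls} (h : ¬ (f.len = 1 ∧ g.len = 0))
    (h' : ¬ (f.len = 0 ∧ g.len = 2)) (h'' : ¬ (f.len = 1 ∧ g.len = 1)) (j : ℕ)
    (U : List (TreeEntry k α)) : muTree k (pvert f g) j U = 0 := by
  rw [muTree_pvert]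
  have e1 : (if g.len = 0 then
      centralMap k α (eulerian k (bracketMap k α) U (soleValue k f)) else 0) = 0 := by
    split_ifs with hg
    · rw [soleValue_eq_zero k fun hf => h ⟨hf, hg⟩, eulerian_zero, map_zero]
    · rfl
  have e2 : (if f.len = 0 then muTree k g 2 U else 0) = 0 := by
    split_ifs with hf
    · exact muTree_two_eq_zero k (fun hg => h' ⟨hf, hg⟩) U
    · rfl
  rw [e1, e2, add_zero, zero_add]
  by_cases hg : g.len = 1
  · rw [soleEntry, soleValue_eq_zero k fun hf => h'' ⟨hf, hg⟩, muTree_entry_zero]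
  · exact muTree_one_eq_zero k hg _

theorem muTree_central (x : PTree α .sp) (j : ℕ) (U : List (TreeEntry k α)) :
    muTree k (pvert (scons x snil) pnil) j U
      = centralMap k α (eulerian k (bracketMap k α) U (collapseTree k x)) := by
  rw [muTree_pvert, muTree_pnil, if_pos (by simp [len]), if_neg (by simp [len]), soleValue_scons,
    if_pos (by simp [len]), add_zero, muTree_pnil, add_zero]

theorem muTree_product (a b : PTree α .pl) (j : ℕ) (U : List (TreeEntry k α)) :
    muTree k (pvert snil (pcons a (pcons b pnil))) j U = shuf k U fun A B =>
      ksgn k (sdeg B * a.deg) • productMap k α (muTree k a 0 A) (muTree k b 0 B) := by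
  rw [muTree_pvert, if_neg (by simp [len]), if_pos (by simp [len]), muTree_one_eq_zero k (by simp [len]),
    add_zero, zero_add, muTree_pcons k a _ (by decide)]
  simp only [muTree_pcons_one, len, if_true]

theorem muTree_brace (x : PTree α .sp) (a : PTree α .pl) (j : ℕ) (U : List (TreeEntry k α)) :
    muTree k (pvert (scons x snil) (pcons a pnil)) j U = muTree k a 0 (treeEntry k x :: U) := by
  rw [muTree_pvert, if_neg (by simp [len]), if_neg (by simp [len]), muTree_pcons_one,
    if_pos (by simp [len]), add_zero, zero_add, soleEntry_scons]

/-- The linear extension of `muTree`. -/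
abbrev muRaw (j : ℕ) (U : List (TreeEntry k α)) {κ : Kind} : Raw k α κ →ₗ[k] SCTrees k α .pl :=
  Finsupp.linearCombination k fun t => muTree k t j U

variable (k) in
/-- The linear combination of trees is sent to zero, for all homogeneous entries. -/
def Killed : {κ : Kind} → Raw k α κ → Prop
  | .sp, r => collapseRaw k r = 0
  | .sps, r => soleRaw k r = 0
  | .pl, r => ∀ U, (spatialLie k α).Homog U → muRaw 0 U r = 0
  | .pls, r => ∀ j U, (spatialLie k α).Homog U → muRaw j U r = 0

/-- Since length, labels and degree behave uniformly on `r`, the value depends on the varying list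
only through `soleValue`, and does so linearly. -/
theorem muRaw_pvert_left {r : Raw k α .sps} {d : ℤ} {L : Multiset α}
    (hr : ∀ t, r t ≠ 0 → t.len ≠ 0 ∧ t.deg = d ∧ t.labels = L)
    (hk : soleRaw k r = 0) (g : PTree α .pls) (j : ℕ) (U : List (TreeEntry k α)) :
    muRaw j U (r.mapDomain fun f => pvert f g) = 0 := by
  rw [muRaw, Finsupp.linearCombination_mapDomain]
  have e : ∀ t, r t ≠ 0 → ((fun t => muTree k t j U) ∘ fun f => pvert f g) t
      = (if g.len = 0 then
          centralMap k α (eulerian k (bracketMap k α) U (soleValue k t)) else 0)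
        + muTree k g 1 (⟨L, d, soleValue k t⟩ :: U) := by
    intro t ht
    obtain ⟨h1, h2, h3⟩ := hr t ht
    simp only [Function.comp]
    rw [muTree_pvert, if_neg h1, add_zero, soleEntry, h2, h3]
  rw [linearCombination_congr' _ _ r e, linearCombination_add_fun,
    IsLinearMap.linearCombination (F := fun v => muTree k g 1 (⟨L, d, v⟩ :: U))
      (muTree_entryLinear g 1 _ [] L d U le_rfl)]
  have : soleRaw k r = 0 := hk
  rw [this, muTree_entry_zero, add_zero]
  split_ifs
  · have hl : IsLinearMap k fun z => centralMap k α (eulerian k (bracketMap k α) U z) :=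
      (centralMap k α ∘ₗ (eulerian_isLinearMap (bracketMap k α) U).mk' _).isLinear
    rw [IsLinearMap.linearCombination hl, this, eulerian_zero, map_zero]
  · exact linearCombination_eq_zero _ _ fun _ _ => rfl

theorem muRaw_pvert_right {r : Raw k α .pls} (hr : ∀ t, r t ≠ 0 → t.len ≠ 0)
    (f : PTree α .sps) (j : ℕ) (U : List (TreeEntry k α)) (h2 : muRaw 2 U r = 0)
    (h1 : muRaw 1 (soleEntry k f :: U) r = 0) :
    muRaw j U (r.mapDomain fun g => pvert f g) = 0 := by
  rw [muRaw, Finsupp.linearCombination_mapDomain]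
  have e : ∀ t, r t ≠ 0 → ((fun t => muTree k t j U) ∘ fun g => pvert f g) t
      = (if f.len = 0 then muTree k t 2 U else 0) + muTree k t 1 (soleEntry k f :: U) := by
    intro t ht
    simp only [Function.comp]
    rw [muTree_pvert, if_neg (hr t ht), zero_add]
  rw [linearCombination_congr' _ _ r e, linearCombination_add_fun, h1, add_zero]
  split_ifs
  · exact h2
  · exact linearCombination_eq_zero _ _ fun _ _ => rfl

theorem muRaw_pcons_left {r : Raw k α .pl} {d : ℤ} (hr : ∀ t, r t ≠ 0 → t.deg = d)
    (g : PTree α .pls) (j : ℕ) (U : List (TreeEntry k α))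
    (h : ∀ A B, (A ++ B).Perm U → muRaw 0 A r = 0) :
    muRaw j U (r.mapDomain fun a => pcons a g) = 0 := by
  rw [muRaw, Finsupp.linearCombination_mapDomain]
  by_cases hj : j = 1
  · subst hj
    simp only [Function.comp_def, muTree_pcons_one]
    split_ifs
    · exact h U [] (by simp)
    · exact linearCombination_eq_zero _ _ fun _ _ => rfl
  · have e : ∀ t, r t ≠ 0 → ((fun t => muTree k t j U) ∘ fun a => pcons a g) t
        = shuf k U fun A B =>
          ksgn k (sdeg B * d) • productMap k α (muTree k t 0 A) (muTree k g 1 B) := by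
      intro t ht
      simp only [Function.comp, muTree_pcons k t g hj, hr t ht]
    rw [linearCombination_congr' _ _ r e, linearCombination_shuf, ← shuf_zero (k := k) U]
    refine shuf_congr U fun A B hAB => ?_
    rw [linearCombination_comp_linear (fun t => muTree k t 0 A)
      (fun t => ksgn k (sdeg B * d) • productMap k α (muTree k t 0 A) (muTree k g 1 B))
      (ksgn k (sdeg B * d) • (productMap k α).flip (muTree k g 1 B)) r fun _ => rfl,
      h A B hAB, map_zero]

theorem muRaw_pcons_right {r : Raw k α .pls} (hr : ∀ t, r t ≠ 0 → t.len ≠ 0)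
    (a : PTree α .pl) (j : ℕ) (U : List (TreeEntry k α))
    (h : ∀ A B, (A ++ B).Perm U → muRaw 1 B r = 0) :
    muRaw j U (r.mapDomain fun g => pcons a g) = 0 := by
  rw [muRaw, Finsupp.linearCombination_mapDomain]
  by_cases hj : j = 1
  · subst hj
    refine linearCombination_eq_zero _ _ fun t ht => ?_
    simp only [Function.comp_def, muTree_pcons_one]
    rw [if_neg (hr t ht)]
  · simp only [Function.comp_def, muTree_pcons k a _ hj]
    rw [linearCombination_shuf, ← shuf_zero (k := k) U]
    refine shuf_congr U fun A B hAB => ?_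
    rw [linearCombination_comp_linear (fun t => muTree k t 1 B)
      (fun t => ksgn k (sdeg B * a.deg) • productMap k α (muTree k a 0 A) (muTree k t 1 B))
      (ksgn k (sdeg B * a.deg) • productMap k α (muTree k a 0 A)) r fun _ => rfl,
      h A B hAB, map_zero]

/-- The only relation is the exchange of two spatial inputs, and a list of at least two spatial
inputs has `soleValue` zero. The rest is propagation through contexts. -/
theorem Relator.killed {κ : Kind} {r : Raw k α κ} (h : Relator k .free κ r) : Killed k r := by
  have sp : ∀ {r : Raw k α .sp}, Relator k .free .sp r → Killed k r :=
    fun h => collapse_relator k (Submodule.subset_span h)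
  induction h with
  | base κ r h =>
    cases h with
    | swap _ a b f =>
      change soleRaw k _ = 0
      rw [map_sub, Finsupp.linearCombination_single, Finsupp.linearCombination_single,
        soleValue_scons, soleValue_scons, if_neg (by simp [len]), if_neg (by simp [len]),
        smul_zero, smul_zero, sub_zero]
  | vert w r h _ => exact sp (.vert w r h)
  | scons_left r f h ih => exact soleRaw_scons_left r ih f
  | scons_right t r h ih => exact soleRaw_scons_right (h.len_ne_zero (Or.inl rfl)) t
  | pvert_left r g h ih =>
    obtain ⟨_, d, L, _, hd⟩ := h.homog
    exact fun U _ => muRaw_pvert_left (fun t ht =>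
      ⟨h.len_ne_zero (Or.inl rfl) t ht, (hd t ht).2.1, (hd t ht).2.2.1⟩) ih g 0 U
  | pvert_right f r h ih =>
    -- The hypothesis is also needed for the word enlarged by the input of `n_{1,1}`, which is why
    -- `Killed` quantifies over all homogeneous words.
    exact fun U hU => muRaw_pvert_right (h.len_ne_zero (Or.inr rfl)) f 0 U (ih 2 U hU)
      (ih 1 _ (Homog.cons (soleValue_mem k f) hU))
  | pcons_left r g h ih =>
    obtain ⟨_, d, L, _, hd⟩ := h.homog
    exact fun j U hU => muRaw_pcons_left (fun t ht => (hd t ht).2.1) g j U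
      fun A _ h => ih A (hU.left h)
  | pcons_right a r h ih =>
    exact fun j U hU => muRaw_pcons_right (h.len_ne_zero (Or.inr rfl)) a j U
      fun _ B h => ih 1 B (hU.right h)

open Classical in
theorem muTree_mem {κ : Kind} (t : PTree α κ) : ∀ (j : ℕ) {U : List (TreeEntry k α)}
    (_ : (spatialLie k α).Homog U), muTree k t j U
      ∈ piece k .pl ((U.map Entry.lab).sum + t.labels) t.planar (sdeg U + t.deg) := by
  induction t with
  | edge =>
    intro j U _
    rw [muTree_edge]
    split_ifs with h
    · subst h
      exact mk_mem_piece trivial (by simp [labels]) rfl rfl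
    · exact Submodule.zero_mem _
  | pvert f g _ ih =>
    intro j U hU
    rw [muTree_pvert]
    refine Submodule.add_mem _ (Submodule.add_mem _ ?_ ?_) ?_
    · split_ifs with hg
      · by_cases hf : f.len = 1
        · have := centralMap_mem ((spatialLie k α).eulerian_mem U hU (soleValue_mem k f))
          rw [eq_pnil hg]
          refine mem_piece_of_eq this ?_ ?_ ?_
          · simp [labels]
          · simp [planar, planar_eq_zero f (Or.inr rfl)]
          · simp [deg, hf, len]
        · rw [soleValue_eq_zero k hf, eulerian_zero, map_zero]
          exact Submodule.zero_mem _
      · exact Submodule.zero_mem _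
    · split_ifs with hf
      · by_cases hg : g.len = 2
        · refine mem_piece_of_eq (ih 2 hU) ?_ ?_ ?_
          · simp [labels, eq_snil hf]
          · simp [planar, eq_snil hf]
          · simp [deg, hg, eq_snil hf, len]
        · rw [muTree_two_eq_zero k hg]
          exact Submodule.zero_mem _
      · exact Submodule.zero_mem _
    · by_cases hf : f.len = 1
      · by_cases hg : g.len = 1
        · have hU' : (spatialLie k α).Homog (soleEntry k f :: U) :=
            Homog.cons (soleValue_mem k f) hU
          refine mem_piece_of_eq (ih 1 hU') ?_ ?_ ?_
          · simp only [labels, List.map_cons, List.sum_cons, soleEntry]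
            abel
          · simp [planar, planar_eq_zero f (Or.inr rfl)]
          · simp only [deg, hg, hf, sdeg, soleEntry]
            push_cast
            ring
        · rw [muTree_one_eq_zero k hg]
          exact Submodule.zero_mem _
      · rw [soleEntry, soleValue_eq_zero k hf, muTree_entry_zero]
        exact Submodule.zero_mem _
  | pcons a g iha ihg =>
    intro j U hU
    by_cases hj : j = 1
    · subst hj
      rw [muTree_pcons_one]
      split_ifs with hg
      · rw [eq_pnil hg]
        refine mem_piece_of_eq (iha 0 hU) ?_ ?_ ?_
        · simp [labels]
        · simp [planar]
        · simp [deg]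
      · exact Submodule.zero_mem _
    · rw [muTree_pcons k a g hj]
      refine shuf_mem _ U fun A B h => Submodule.smul_mem _ _ ?_
      have h1 := iha 0 (hU.left h)
      have h2 := ihg 1 (hU.right h)
      refine mem_piece_of_eq (productMap_mem h1 h2) ?_ ?_ ?_
      · have e := (h.map Entry.lab).sum_eq
        rw [List.map_append, List.sum_append] at e
        rw [← e]
        simp only [labels]
        abel
      · simp [planar]
      · rw [← sdeg_perm h, sdeg_append]
        simp only [deg]
        ring
  | _ => intro j U _; simp only [muTree]; exact Submodule.zero_mem _

/-- Words act through the enveloping algebra: on edges trivially, on `n_{1,0}` by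
`eulerian_enveloping`, on products because the coproduct is well defined, and under `n_{1,1}`
because a fixed first letter may be added. This is the content of `d n_{2,1}`. -/
theorem muTree_enveloping {κ : Kind} (t : PTree α κ) :
    ∀ (j n : ℕ), (spatialLie k α).Enveloping n (muTree k t j) := by
  have zero : ∀ n : ℕ, (spatialLie k α).Enveloping n
      fun _ : List (TreeEntry k α) => (0 : SCTrees k α .pl) :=
    fun n V x y U _ _ => by simp
  induction t with
  | edge =>
    intro j n V x y U _ _
    rw [muTree_edge, muTree_edge, muTree_edge, if_neg (by simp), if_neg (by simp),
      if_neg (by simp), smul_zero, smul_zero, add_zero]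
  | pvert f g _ ih =>
    intro j n
    have e : muTree k (pvert f g) j = fun U => (if g.len = 0 then
        centralMap k α (eulerian k (bracketMap k α) U (soleValue k f)) else 0)
        + (if f.len = 0 then muTree k g 2 U else 0) + muTree k g 1 (soleEntry k f :: U) :=
      funext fun U => muTree_pvert k f g j U
    rw [e]
    refine Enveloping.add (Enveloping.add ?_ ?_) ?_
    · split_ifs
      · exact Enveloping.map ((spatialLie k α).eulerian_enveloping n (soleValue_mem k f)) _
      · exact zero n
    · split_ifs
      · exact ih 2 n
      · exact zero n
    · exact Enveloping.cons (ih 1 (n + 1)) _ (soleValue_mem k f)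
  | pcons a g iha ihg =>
    intro j n
    by_cases hj : j = 1
    · subst hj
      have e : muTree k (pcons a g) 1 = fun U => if g.len = 0 then muTree k a 0 U else 0 :=
        funext fun U => muTree_pcons_one k a g U
      rw [e]
      split_ifs
      · exact iha 0 n
      · exact zero n
    · have e : muTree k (pcons a g) j = fun U => shuf k U fun A B =>
          ksgn k (sdeg B * a.deg) • productMap k α (muTree k a 0 A) (muTree k g 1 B) :=
        funext fun U => muTree_pcons k a g hj U
      rw [e]
      refine Enveloping.shuffle n (fun B _ => ?_) (fun A _ => ?_)
      · exact Enveloping.map (iha 0 _)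
          (ksgn k (sdeg B * a.deg) • (productMap k α).flip (muTree k g 1 B))
      · exact Enveloping.ksgn_smul (f := fun s => s * a.deg)
          (Enveloping.map (ihg 1 _) (productMap k α (muTree k a 0 A)))
  | _ => intro j n; simpa only [muTree] using zero n

end TreeMap

/-! ### Vanishing of the differential on spatial trees. -/

section Differential

open PTree ShiftedLie

open Finsupp (single)

variable {k : Type*} [Field k] {α : Type}

theorem map_linearCombination_eq_zero {X M N : Type*} [AddCommGroup M] [Module k M]
    [AddCommGroup N] [Module k N] (φ : M →ₗ[k] N) (v : X → M) (r : X →₀ k)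
    (h : ∀ t, r t ≠ 0 → φ (v t) = 0) : φ (Finsupp.linearCombination k v r) = 0 := by
  rw [← linearCombination_comp_linear v (fun t => φ (v t)) φ r fun _ => rfl]
  exact linearCombination_eq_zero _ _ h

theorem collapseRaw_vert_scons (r : Raw k α .sp) (hr : collapseRaw k r = 0) (f : PTree α .sps) :
    collapseRaw k (r.mapDomain fun s => vert .l (scons s f)) = 0 := by
  rw [collapseRaw, Finsupp.linearCombination_mapDomain]
  by_cases h : f.len = 1
  · obtain ⟨t, f', rfl, h'⟩ := eq_scons h
    rw [eq_snil h', linearCombination_comp_linear (collapseTree k)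
      (collapseTree k ∘ fun s => vert .l (scons s (scons t snil)))
      ((bracketMap k α).flip (collapseTree k t)) r fun s => collapseTree_bracket k s t, hr, map_zero]
  · exact linearCombination_eq_zero _ _ fun s _ =>
      collapseTree_vert_eq_zero k fun h' => h (by simpa [len] using h'.2)

theorem collapseRaw_vert_scons_right (s : PTree α .sp) (r : Raw k α .sp)
    (hr : collapseRaw k r = 0) (f : PTree α .sps) :
    collapseRaw k (r.mapDomain fun t => vert .l (scons s (scons t f))) = 0 := by
  rw [collapseRaw, Finsupp.linearCombination_mapDomain]
  by_cases h : f.len = 0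
  · rw [eq_snil h, linearCombination_comp_linear (collapseTree k)
      (collapseTree k ∘ fun t => vert .l (scons s (scons t snil)))
      (bracketMap k α (collapseTree k s)) r fun t => collapseTree_bracket k s t, hr, map_zero]
  · exact linearCombination_eq_zero _ _ fun s _ =>
      collapseTree_vert_eq_zero k fun h' => h (by simpa [len] using h'.2)

variable (k) in
/-- The differentials of all members of the list are sent to zero. -/
def MembersKilled : PTree α .sps → Prop
  | snil => True
  | scons t f => collapseRaw k (dRaw k t) = 0 ∧ MembersKilled f

theorem membersKilled_scons {t : PTree α .sp} {f : PTree α .sps} :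
    MembersKilled k (scons t f) ↔ collapseRaw k (dRaw k t) = 0 ∧ MembersKilled k f := by
  simp only [MembersKilled]

theorem collapseRaw_dRaw_vert {f : PTree α .sps} (h : MembersKilled k f) :
    collapseRaw k ((dRaw k f).mapDomain (vert .l)) = 0 := by
  match f with
  | snil => simp [dRaw]
  | scons s snil =>
    rw [membersKilled_scons] at h
    rw [dRaw, dRaw, Finsupp.mapDomain_zero, smul_zero, add_zero, ← Finsupp.mapDomain_comp]
    exact collapseRaw_vert_scons _ h.1 _
  | scons s (scons t f) =>
    rw [membersKilled_scons, membersKilled_scons] at h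
    rw [dRaw, Finsupp.mapDomain_add, map_add, ← Finsupp.mapDomain_comp,
      Finsupp.mapDomain_smul, map_smul]
    have e1 : collapseRaw k ((dRaw k s).mapDomain (vert .l ∘ fun s => scons s (scons t f))) = 0 :=
      collapseRaw_vert_scons _ h.1 _
    rw [e1, zero_add, ← Finsupp.mapDomain_comp, dRaw, Finsupp.mapDomain_add, map_add,
      Finsupp.mapDomain_smul, map_smul, ← Finsupp.mapDomain_comp, ← Finsupp.mapDomain_comp]
    have e2 : collapseRaw k ((dRaw k t).mapDomain
        ((vert .l ∘ fun h => scons s h) ∘ fun t => scons t f)) = 0 :=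
      collapseRaw_vert_scons_right s _ h.2.1 f
    have e3 : collapseRaw k ((dRaw k f).mapDomain
        ((vert .l ∘ fun h => scons s h) ∘ fun h => scons t h)) = 0 := by
      cases f with
      | snil => simp [dRaw]
      | scons u f =>
        rw [collapseRaw, Finsupp.linearCombination_mapDomain]
        refine linearCombination_eq_zero _ _ fun g hg => ?_
        have hl := ((Finsupp.mem_supported k _).1 (dRaw_supp (k := k) (scons u f))
          (Finsupp.mem_support_iff.2 hg)).1
        refine collapseTree_vert_eq_zero k fun h' => ?_
        have := h'.2
        simp only [len] at this hl
        omega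
    rw [e2, e3, smul_zero, add_zero, smul_zero]

/-- A term `l_{1+b}(l_a, …)` survives only for `a = 2`, `b = 1`, that is in `d l_3`, and there the
three terms add up to the Jacobi identity. -/
theorem collapseRaw_bracketTerm (f : PTree α .sps) :
    collapseRaw k (Finsupp.linearCombination k (bracketTerm k) (unshuffles k f)) = 0 := by
  by_cases hf : f.len = 3
  · obtain ⟨a, f', rfl, hf'⟩ := eq_scons hf
    obtain ⟨b, f'', rfl, hf''⟩ := eq_scons hf'
    obtain ⟨c, f''', rfl, hf'''⟩ := eq_scons hf''
    rw [eq_snil hf''']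
    have e : collapseRaw k (Finsupp.linearCombination k (bracketTerm k)
          (unshuffles k (scons a (scons b (scons c snil)))))
        = bracketMap k α (bracketMap k α (collapseTree k a) (collapseTree k b)) (collapseTree k c)
        + ksgn k (b.deg * c.deg) • bracketMap k α (bracketMap k α (collapseTree k a)
            (collapseTree k c)) (collapseTree k b)
        + ksgn k (a.deg * (b.deg + c.deg)) • bracketMap k α (bracketMap k α (collapseTree k b)
            (collapseTree k c)) (collapseTree k a) := by
      simp only [unshuffles, bracketTerm, Finsupp.linearCombination_single, map_add, one_smul, len,
        map_smul]
      norm_num [collapseTree_bracket, deg, ksgn_zero]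
      abel
    rw [e]
    have ha := collapseTree_mem k a
    have hb := collapseTree_mem k b
    have hc := collapseTree_mem k c
    rw [bracketMap_jacobi ha hb hc, bracketMap_symm (bracketMap_mem ha hc) hb,
      bracketMap_symm (bracketMap_mem hb hc) ha, ksgn_smul_smul, ksgn_smul_smul,
      ksgn_congr k (a := b.deg * c.deg + (a.deg + c.deg - 1) * b.deg)
        (b := (a.deg - 1) * b.deg) (by clear e; push_cast; grind),
      ksgn_congr k (a := a.deg * (b.deg + c.deg) + (b.deg + c.deg - 1) * a.deg)
        (b := a.deg) (by clear e; push_cast; grind),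
      ksgn_add k a.deg 1, ksgn_add k _ 1, ksgn_one]
    module
  · refine map_linearCombination_eq_zero _ _ _ fun z hz => ?_
    have hl := ((Finsupp.mem_supported k _).1 (unshuffles_supp (k := k) f)
      (Finsupp.mem_support_iff.2 hz)).1
    rw [bracketTerm]
    split_ifs with h
    · rw [Finsupp.linearCombination_single, one_smul]
      by_cases h2 : z.2.len = 1
      · obtain ⟨t, f', e, h'⟩ := eq_scons h2
        rw [e, eq_snil h', collapseTree_bracket, collapseTree_vert_eq_zero k, map_zero,
          LinearMap.zero_apply]
        intro h''
        have := h''.2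
        omega
      · exact collapseTree_vert_eq_zero k fun h' => h2 (by simpa [len] using h'.2)
    · exact map_zero _

/-- For lists the induction hypothesis concerns every member, not `soleValue`, because a bracket has
two inputs and the differential acts on each. -/
theorem collapseRaw_dRaw {κ : Kind} (t : PTree α κ) :
    match κ, t with
    | .sp, t => collapseRaw k (dRaw k t) = 0
    | .sps, f => MembersKilled k f
    | _, _ => True := by
  induction t with
  | leaf a => simp [dRaw]
  | vert w f ih =>
    cases w with
    | l =>
      change collapseRaw k (dRaw k (vert .l f)) = 0
      rw [dRaw, map_sub, collapseRaw_bracketTerm, collapseRaw_dRaw_vert ih, sub_zero]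
    | m =>
      change collapseRaw k (dRaw k (vert .m f)) = 0
      rw [dRaw, collapseRaw, Finsupp.linearCombination_mapDomain]
      exact linearCombination_eq_zero _ _ fun h _ =>
        collapseTree_vert_eq_zero k fun h' => by simpa using h'.1
  | scons t f iht ihf => exact membersKilled_scons.2 ⟨iht, ihf⟩
  | snil => simp only [MembersKilled]
  | _ => trivial

theorem dRaw_len_ne_zero {κ : Kind} (f : PTree α κ) (hκ : κ = .sps ∨ κ = .pls) :
    ∀ t, dRaw k f t ≠ 0 → t.len ≠ 0 := by
  intro t ht
  have hl := ((Finsupp.mem_supported k _).1 (dRaw_supp (k := k) f)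
    (Finsupp.mem_support_iff.2 ht)).1
  rw [hl]
  cases f with
  | snil => simp [dRaw] at ht
  | pnil => simp [dRaw] at ht
  | scons => simp [len]
  | pcons => simp [len]
  | _ => rcases hκ with h | h <;> cases h

theorem soleRaw_dRaw (f : PTree α .sps) : soleRaw k (dRaw k f) = 0 := by
  cases f with
  | snil => simp [dRaw]
  | scons t f =>
    rw [dRaw, map_add, map_smul, soleRaw_scons_left _ (collapseRaw_dRaw t),
      soleRaw_scons_right (dRaw_len_ne_zero f (Or.inl rfl)), smul_zero, add_zero]

end Differential

/-! ### The five corollae whose differential needs an identity in `OC`. -/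

section TopTerms

open PTree ShiftedLie

open Finsupp (single)

variable {k : Type*} [Field k] {α : Type}

theorem ksgn_even {n : ℤ} (h : (n : ZMod 2) = 0) : ksgn k n = 1 := by
  rw [ksgn_congr k (b := 0) (by simpa using h), ksgn_zero]

theorem ksgn_odd {n : ℤ} (h : (n : ZMod 2) = 1) : ksgn k n = -1 := by
  rw [ksgn_congr k (b := 1) (by simpa using h), ksgn_one]

variable [CharZero k]

variable (k) in
/-- The part of the differential of `pvert f g` that changes the root vertex. -/
abbrev topTerms (f : PTree α .sps) (g : PTree α .pls) : Raw k α .pl :=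
  Finsupp.linearCombination k (closedTerm k g) (unshuffles k f)
    + Finsupp.linearCombination k (fun z => openSum k z g) (unshuffles k f)

theorem muTree_pvert_eq_zero' {f : PTree α .sps} {g : PTree α .pls} (h : f.len ≠ 1 ∨ g.len ≠ 0)
    (h' : f.len ≠ 0 ∨ g.len ≠ 2) (h'' : f.len ≠ 1 ∨ g.len ≠ 1) (j : ℕ) (U : List (TreeEntry k α)) :
    muTree k (pvert f g) j U = 0 := muTree_pvert_eq_zero (by tauto) (by tauto) (by tauto) j U

/-- The terms are the two products of `n_{1,0}(x)` with `a`; they cancel because every `n_{1,0}(e(B;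
x))` is central. Cocommutativity matches the distributions of `U`. -/
theorem muRaw_topTerms_one_one (x : PTree α .sp) (a : PTree α .pl) (U : List (TreeEntry k α))
    (hU : (spatialLie k α).Homog U) :
    muRaw 0 U (topTerms k (scons x snil) (pcons a pnil)) = 0 := by
  have e : muRaw 0 U (topTerms k (scons x snil) (pcons a pnil))
      = (shuf k U fun A B => ksgn k (sdeg B * x.deg) •
          productMap k α (centralMap k α (eulerian k (bracketMap k α) A (collapseTree k x)))
            (muTree k a 0 B))
        + ksgn k (1 + x.deg * a.deg) • shuf k U fun A B => ksgn k (sdeg B * a.deg) •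
          productMap k α (muTree k a 0 A)
            (centralMap k α (eulerian k (bracketMap k α) B (collapseTree k x))) := by
    simp only [topTerms, unshuffles, closedTerm, cuts, openSum, openTerm,
      Finsupp.linearCombination_single, map_add, one_smul, len, PTree.append, map_smul]
    norm_num [muTree_product, muTree_central, len, deg, ksgn_zero]
  rw [e, shuf_comm, ← shuf_smul, ← shuf_add, ← shuf_zero (k := k) U]
  refine shuf_congr U fun A B h => ?_
  have hB : eulerian k (bracketMap k α) B (collapseTree k x) ∈ piece k .sp _ 0 _ :=
    (spatialLie k α).eulerian_mem B (hU.right h) (collapseTree_mem k x)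
  rw [centralMap_central hB (muTree_mem a 0 (hU.left h))]
  simp only [ksgn_smul_smul, ← add_smul]
  rw [ksgn_congr k (b := 1 + x.deg * a.deg + sdeg B * a.deg + 1) (by push_cast; grind),
    ksgn_add k _ 1, ksgn_one]
  simp

/-- Associativity of the product together with coassociativity of the distribution of `U`. -/
theorem muRaw_topTerms_zero_three (a b c : PTree α .pl) (U : List (TreeEntry k α)) :
    muRaw 0 U (topTerms k snil (pcons a (pcons b (pcons c pnil)))) = 0 := by
  have e : muRaw 0 U (topTerms k snil (pcons a (pcons b (pcons c pnil))))
      = (shuf k U fun D C => ksgn k (sdeg C * (a.deg + b.deg)) • productMap k α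
          (shuf k D fun A B => ksgn k (sdeg B * a.deg) •
            productMap k α (muTree k a 0 A) (muTree k b 0 B)) (muTree k c 0 C))
        - shuf k U fun A D => ksgn k (sdeg D * a.deg) • productMap k α (muTree k a 0 A)
          (shuf k D fun B C => ksgn k (sdeg C * b.deg) •
            productMap k α (muTree k b 0 B) (muTree k c 0 C)) := by
    simp only [topTerms, unshuffles, closedTerm, cuts, openSum, openTerm,
      Finsupp.linearCombination_single, map_add, one_smul, len, PTree.append]
    norm_num [muTree_product, muTree_brace, muTree_pvert_eq_zero', len, deg]
    rw [ksgn_even (n := 8) (by decide), ksgn_odd (n := 11) (by decide), one_smul, neg_one_smul,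
      sub_eq_add_neg]
  have e1 : (shuf k U fun D C => ksgn k (sdeg C * (a.deg + b.deg)) • productMap k α
          (shuf k D fun A B => ksgn k (sdeg B * a.deg) •
            productMap k α (muTree k a 0 A) (muTree k b 0 B)) (muTree k c 0 C))
      = shuf k U fun D C => shuf k D fun A B =>
        ksgn k (sdeg C * (a.deg + b.deg) + sdeg B * a.deg) • productMap k α
          (productMap k α (muTree k a 0 A) (muTree k b 0 B)) (muTree k c 0 C) := by
    refine shuf_congr U fun D C _ => ?_
    rw [← LinearMap.flip_apply (productMap k α), ← shuf_map, ← shuf_smul]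
    refine shuf_congr D fun A B _ => ?_
    rw [map_smul, ksgn_smul_smul, LinearMap.flip_apply]
  rw [e, e1, shuf_assoc, ← shuf_sub, ← shuf_zero (k := k) U]
  refine shuf_congr U fun A D _ => ?_
  rw [← shuf_map, ← shuf_smul, ← shuf_sub, ← shuf_zero (k := k) D]
  refine shuf_congr D fun B C h => ?_
  rw [map_smul, ksgn_smul_smul, productMap_assoc, ← sdeg_perm h, sdeg_append, sub_eq_zero]
  exact ksgn_smul_congr (by push_cast; grind) _

/-- The derivation rule for `n_{1,1}(x; -)` is built into `muTree`: splitting the word `x :: U` puts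
`x` on `a` or on `b`. -/
theorem muRaw_topTerms_one_two (x : PTree α .sp) (a b : PTree α .pl)
    (U : List (TreeEntry k α)) :
    muRaw 0 U (topTerms k (scons x snil) (pcons a (pcons b pnil))) = 0 := by
  have e : muRaw 0 U (topTerms k (scons x snil) (pcons a (pcons b pnil)))
      = (shuf k (treeEntry k x :: U) fun A B => ksgn k (sdeg B * a.deg) •
          productMap k α (muTree k a 0 A) (muTree k b 0 B))
        - (shuf k U fun A B => ksgn k (sdeg B * (-1 + x.deg + a.deg)) •
          productMap k α (muTree k a 0 (treeEntry k x :: A)) (muTree k b 0 B))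
        + ksgn k (5 + -a.deg + x.deg * a.deg) • shuf k U fun A B => ksgn k (sdeg B * a.deg) •
          productMap k α (muTree k a 0 A) (muTree k b 0 (treeEntry k x :: B)) := by
    simp only [topTerms, unshuffles, closedTerm, cuts, openSum, openTerm,
      Finsupp.linearCombination_single, map_add, one_smul, len, PTree.append, map_smul]
    norm_num [muTree_product, muTree_brace, muTree_pvert_eq_zero', len, deg]
    rw [ksgn_even (n := 6) (by decide), ksgn_odd (n := 3) (by decide), ksgn_zero, one_smul,
      neg_one_smul, one_smul, one_smul]
    abel
  rw [e, shuf, ← shuf_smul, ← shuf_sub, ← shuf_add, ← shuf_zero (k := k) U]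
  refine shuf_congr U fun A B _ => ?_
  simp only [ksgn_smul_smul, sdeg, treeEntry]
  rw [ksgn_congr k (a := 5 + -a.deg + x.deg * a.deg + sdeg B * a.deg)
      (b := (x.deg - 1 + sdeg B) * a.deg + 1) (by push_cast; grind), ksgn_add k _ 1, ksgn_one,
    ksgn_congr k (a := (x.deg - 1) * sdeg B + sdeg B * a.deg)
      (b := sdeg B * (-1 + x.deg + a.deg)) (by push_cast; grind)]
  module

theorem muRaw_closedTerm_two (x y : PTree α .sp) (g : PTree α .pls) (U : List (TreeEntry k α)) :
    muRaw 0 U (Finsupp.linearCombination k (closedTerm k g)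
        (unshuffles k (scons x (scons y snil))))
      = ksgn k (g.len + 2) •
        muTree k (pvert (scons (vert .l (scons x (scons y snil))) snil) g) 0 U := by
  have e : Finsupp.linearCombination k (closedTerm k g) (unshuffles k (scons x (scons y snil)))
      = single (pvert (scons (vert .l (scons x (scons y snil))) snil) g) (ksgn k (g.len + 2)) := by
    simp only [unshuffles, closedTerm, Finsupp.linearCombination_single, map_add, one_smul,
      len, map_smul]
    norm_num
  rw [e, Finsupp.linearCombination_single]

/-- The terms `n_{1,1}(x; n_{1,0}(y))`, its exchange, and `n_{1,0}(l_2(x,y))` cancel by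
`eulerian_cons_add_eulerian_cons`. -/
theorem muRaw_topTerms_two_zero (x y : PTree α .sp) (U : List (TreeEntry k α))
    (hU : (spatialLie k α).Homog U) :
    muRaw 0 U (topTerms k (scons x (scons y snil)) pnil) = 0 := by
  have e : muRaw 0 U (Finsupp.linearCombination k (fun z => openSum k z pnil)
        (unshuffles k (scons x (scons y snil))))
      = ksgn k (x.deg * y.deg) • centralMap k α
          (eulerian k (bracketMap k α) (treeEntry k y :: U) (collapseTree k x))
        + centralMap k α
          (eulerian k (bracketMap k α) (treeEntry k x :: U) (collapseTree k y)) := by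
    simp only [unshuffles, cuts, openSum, openTerm, Finsupp.linearCombination_single, map_add,
      one_smul, len, PTree.append, map_smul]
    norm_num [muTree_product, muTree_brace, muTree_central, muTree_pvert_eq_zero', len, deg,
      ksgn_zero]
  have h := (spatialLie k α).eulerian_cons_add_eulerian_cons (treeEntry k x) (treeEntry k y) U hU
    (collapseTree_mem k x) (collapseTree_mem k y)
  rw [map_add, muRaw_closedTerm_two, e, muTree_central, collapseTree_bracket,
    ksgn_even (by simp [len]; decide), one_smul, ← map_smul, ← map_add, ← map_add,
    ← map_zero (centralMap k α), ← h]
  congr 1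
  simp only [spatialLie, treeEntry]
  abel

/-- The two iterated actions of `x` and `y` on `a` differ by the action of their bracket, which is
`muTree_enveloping` at the front of the word. -/
theorem muRaw_topTerms_two_one (x y : PTree α .sp) (a : PTree α .pl) (U : List (TreeEntry k α))
    (hU : (spatialLie k α).Homog U) :
    muRaw 0 U (topTerms k (scons x (scons y snil)) (pcons a pnil)) = 0 := by
  have e : muRaw 0 U (Finsupp.linearCombination k (fun z => openSum k z (pcons a pnil))
        (unshuffles k (scons x (scons y snil))))
      = ksgn k (x.deg * y.deg) • ksgn k (2 + -y.deg) •
          muTree k a 0 (treeEntry k x :: treeEntry k y :: U)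
        + ksgn k (2 + -x.deg) • muTree k a 0 (treeEntry k y :: treeEntry k x :: U) := by
    simp only [unshuffles, cuts, openSum, openTerm, Finsupp.linearCombination_single, map_add,
      one_smul, len, PTree.append, map_smul]
    norm_num [muTree_product, muTree_brace, muTree_pvert_eq_zero', len, deg, shuf_zero, ksgn_zero]
  have h : muTree k a 0 (treeEntry k y :: treeEntry k x :: U)
      = ksgn k ((x.deg - 1) * (y.deg - 1)) • muTree k a 0 (treeEntry k x :: treeEntry k y :: U)
        + ksgn k x.deg • muTree k a 0
          ((spatialLie k α).brEntry (treeEntry k x) (treeEntry k y) :: U) :=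
    muTree_enveloping a 0 (U.length + 2) [] (treeEntry k x) (treeEntry k y) U (by simp)
      (Homog.cons (collapseTree_mem k y) (Homog.cons (collapseTree_mem k x) hU))
  have e' : treeEntry k (vert .l (scons x (scons y snil)))
      = (spatialLie k α).brEntry (treeEntry k x) (treeEntry k y) := by
    rw [treeEntry, collapseTree_bracket]
    simp only [brEntry, treeEntry, labels, add_zero, deg, len]
    congr 1
    push_cast
    ring
  rw [map_add, muRaw_closedTerm_two, e, muTree_brace, e',
    ksgn_odd (by simp [len]; decide), h]
  simp only [smul_add, ksgn_smul_smul]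
  rw [ksgn_even (n := 2 + -x.deg + x.deg) (by push_cast; grind),
    ksgn_congr k (a := 2 + -x.deg + (x.deg - 1) * (y.deg - 1))
      (b := x.deg * y.deg + (2 + -y.deg) + 1) (by push_cast; grind), ksgn_add k _ 1, ksgn_one]
  module

end TopTerms

/-! ### Vanishing of the morphism on all differentials. -/

section ChainMap

open PTree ShiftedLie

open Finsupp (single)

variable {k : Type*} [Field k] {α : Type} [CharZero k]

theorem muTree_pvert_of_soleValue {f : PTree α .sps} (h0 : f.len ≠ 0) (h : soleValue k f = 0)
    (g : PTree α .pls) (j : ℕ) (U : List (TreeEntry k α)) : muTree k (pvert f g) j U = 0 := by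
  rw [muTree_pvert, h, eulerian_zero, map_zero, if_neg h0, soleEntry, h, muTree_entry_zero]
  simp

/-- A term `n_{1+b,m}(l_a, …)` survives only if `a = 2`, `b = 0` and `m ≤ 1`: otherwise either `l_a`
or the root corolla has value zero. -/
theorem muRaw_closedTerm (f : PTree α .sps) (g : PTree α .pls)
    (h : ¬ (f.len = 2 ∧ g.len ≤ 1)) (U : List (TreeEntry k α)) :
    muRaw 0 U (Finsupp.linearCombination k (closedTerm k g) (unshuffles k f)) = 0 := by
  refine map_linearCombination_eq_zero _ _ _ fun z hz => ?_
  have hl := ((Finsupp.mem_supported k _).1 (unshuffles_supp (k := k) f)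
    (Finsupp.mem_support_iff.2 hz)).1
  rw [closedTerm]
  split_ifs with h'
  · rw [Finsupp.linearCombination_single]
    convert smul_zero _
    by_cases hc : z.2.len = 0 ∧ z.1.len ≠ 2
    · refine muTree_pvert_of_soleValue (by simp [len]) ?_ g 0 U
      rw [soleValue_scons, if_pos hc.1]
      exact collapseTree_vert_eq_zero k fun h => hc.2 h.2
    · refine muTree_pvert_eq_zero' ?_ (Or.inl (by simp [len])) ?_ 0 U <;> simp only [len] <;> omega
  · exact map_zero _

theorem muTree_one_eq_zero_of (g₁ g₂ : PTree α .pls) (a : PTree α .pl) (U : List (TreeEntry k α))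
    (ha : ∀ V, muTree k a 0 V = 0) : muTree k (g₁.append (pcons a g₂)) 1 U = 0 := by
  by_cases h : (g₁.append (pcons a g₂)).len = 1
  · rw [len_append] at h
    have h' : g₁.len = 0 := by simp only [len] at h; omega
    rw [eq_pnil h', PTree.append, muTree_pcons_one, ha, ite_self]
  · exact muTree_one_eq_zero k h U

theorem muTree_two_eq_zero_of (g₁ g₂ : PTree α .pls) (a : PTree α .pl) (U : List (TreeEntry k α))
    (ha : ∀ V, muTree k a 0 V = 0) : muTree k (g₁.append (pcons a g₂)) 2 U = 0 := by
  cases g₁ with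
  | pnil =>
    rw [PTree.append, muTree_pcons k _ _ (by decide), ← shuf_zero (k := k) U]
    exact shuf_congr U fun A B _ => by rw [ha, map_zero, LinearMap.zero_apply, smul_zero]
  | pcons b g =>
    rw [PTree.append, muTree_pcons k _ _ (by decide), ← shuf_zero (k := k) U]
    exact shuf_congr U fun A B _ => by
      rw [muTree_one_eq_zero_of g g₂ a B ha, map_zero, smul_zero]

/-- Both corollae must be among `n_{1,0}`, `n_{0,2}`, `n_{1,1}`, and the outer one has a planar
input. The possible total arities are `(1,1)`, `(0,3)`, `(1,2)`, `(2,0)` and `(2,1)`. -/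
theorem muRaw_openTerm (x y : PTree α .sps) (g₁ g₂ g₃ : PTree α .pls) (U : List (TreeEntry k α))
    (h : ¬ (x.len + y.len = 1 ∧ g₁.len + g₂.len + g₃.len = 1)
      ∧ ¬ (x.len + y.len = 0 ∧ g₁.len + g₂.len + g₃.len = 3)
      ∧ ¬ (x.len + y.len = 1 ∧ g₁.len + g₂.len + g₃.len = 2)
      ∧ ¬ (x.len + y.len = 2 ∧ g₁.len + g₂.len + g₃.len = 0)
      ∧ ¬ (x.len + y.len = 2 ∧ g₁.len + g₂.len + g₃.len = 1)) :
    muRaw 0 U (openTerm k x y g₁ g₂ g₃) = 0 := by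
  rw [openTerm]
  split_ifs with h'
  · rw [Finsupp.linearCombination_single]
    convert smul_zero _
    have hl : (g₁.append (pcons (pvert y g₂) g₃)).len = g₁.len + 1 + g₃.len := by
      rw [len_append]
      simp only [len]
      omega
    by_cases hi : (y.len = 1 ∧ g₂.len = 0) ∨ (y.len = 0 ∧ g₂.len = 2) ∨ (y.len = 1 ∧ g₂.len = 1)
    · rcases hi with hi | hi | hi <;>
        refine muTree_pvert_eq_zero' ?_ ?_ ?_ 0 U <;> rw [hl] <;> omega
    · have hz : ∀ V : List (TreeEntry k α), muTree k (pvert y g₂) 0 V = 0 :=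
        fun V => muTree_pvert_eq_zero (fun e => hi (Or.inl e)) (fun e => hi (Or.inr (Or.inl e)))
          (fun e => hi (Or.inr (Or.inr e))) 0 V
      rw [muTree_pvert, if_neg (by omega), muTree_two_eq_zero_of _ _ _ _ hz,
        muTree_one_eq_zero_of _ _ _ _ hz, ite_self, add_zero, add_zero]
  · exact map_zero _

theorem muRaw_topTerms (f : PTree α .sps) (g : PTree α .pls) (U : List (TreeEntry k α))
    (hU : (spatialLie k α).Homog U) : muRaw 0 U (topTerms k f g) = 0 := by
  by_cases h11 : f.len = 1 ∧ g.len = 1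
  · obtain ⟨x, f', rfl, hf⟩ := eq_scons h11.1
    obtain ⟨a, g', rfl, hg⟩ := eq_pcons h11.2
    rw [eq_snil hf, eq_pnil hg]
    exact muRaw_topTerms_one_one x a U hU
  by_cases h03 : f.len = 0 ∧ g.len = 3
  · obtain ⟨a, g', rfl, hg⟩ := eq_pcons h03.2
    obtain ⟨b, g'', rfl, hg'⟩ := eq_pcons hg
    obtain ⟨c, g''', rfl, hg''⟩ := eq_pcons hg'
    rw [eq_snil h03.1, eq_pnil hg'']
    exact muRaw_topTerms_zero_three a b c U
  by_cases h12 : f.len = 1 ∧ g.len = 2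
  · obtain ⟨x, f', rfl, hf⟩ := eq_scons h12.1
    obtain ⟨a, g', rfl, hg⟩ := eq_pcons h12.2
    obtain ⟨b, g'', rfl, hg'⟩ := eq_pcons hg
    rw [eq_snil hf, eq_pnil hg']
    exact muRaw_topTerms_one_two x a b U
  by_cases h20 : f.len = 2 ∧ g.len = 0
  · obtain ⟨x, f', rfl, hf⟩ := eq_scons h20.1
    obtain ⟨y, f'', rfl, hf'⟩ := eq_scons hf
    rw [eq_snil hf', eq_pnil h20.2]
    exact muRaw_topTerms_two_zero x y U hU
  by_cases h21 : f.len = 2 ∧ g.len = 1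
  · obtain ⟨x, f', rfl, hf⟩ := eq_scons h21.1
    obtain ⟨y, f'', rfl, hf'⟩ := eq_scons hf
    obtain ⟨a, g', rfl, hg⟩ := eq_pcons h21.2
    rw [eq_snil hf', eq_pnil hg]
    exact muRaw_topTerms_two_one x y a U hU
  rw [map_add, muRaw_closedTerm f g (by omega), zero_add]
  refine map_linearCombination_eq_zero _ _ _ fun z hz => ?_
  refine map_linearCombination_eq_zero _ _ _ fun w hw => ?_
  refine map_linearCombination_eq_zero _ _ _ fun v hv => ?_
  have h1 := ((Finsupp.mem_supported k _).1 (unshuffles_supp (k := k) f)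
    (Finsupp.mem_support_iff.2 hz)).1
  have h2 := ((Finsupp.mem_supported k _).1 (cuts_supp (k := k) g)
    (Finsupp.mem_support_iff.2 hw)).1
  have h3 := ((Finsupp.mem_supported k _).1 (cuts_supp (k := k) w.2)
    (Finsupp.mem_support_iff.2 hv)).1
  exact muRaw_openTerm _ _ _ _ _ U (by omega)

/-- Terms changing the root vertex vanish by `muRaw_topTerms`. In the others one input is replaced
by its differential, which is killed by induction and propagates like a relator. -/
theorem dRaw_killed {κ : Kind} (t : PTree α κ) : Killed k (dRaw k t) := by
  induction t with
  | leaf a => exact collapseRaw_dRaw (leaf a)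
  | vert w f _ => exact collapseRaw_dRaw (vert w f)
  | snil => exact soleRaw_dRaw snil
  | scons t f _ _ => exact soleRaw_dRaw (scons t f)
  | edge =>
    intro U _
    rw [dRaw, map_zero]
  | pnil =>
    intro j U _
    rw [dRaw, map_zero]
  | pcons a g iha ihg =>
    intro j U hU
    rw [dRaw, map_add, map_smul,
      muRaw_pcons_left (d := a.deg + 1) (fun t ht => ((Finsupp.mem_supported k _).1
        (dRaw_supp (k := k) a) (Finsupp.mem_support_iff.2 ht)).2.1) g j U
        fun A _ h => iha A (hU.left h),
      muRaw_pcons_right (dRaw_len_ne_zero g (Or.inr rfl)) a j U fun _ B h => ihg 1 B (hU.right h),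
      smul_zero, add_zero]
  | pvert f g _ ih =>
    intro U hU
    have h := fun t ht => (Finsupp.mem_supported k _).1
        (dRaw_supp (k := k) f) ((Finsupp.mem_support_iff (a := t)).2 ht)
    rw [dRaw, map_add, muRaw_topTerms f g U hU, map_smul, map_add, map_smul,
      muRaw_pvert_left (d := f.deg + 1) (L := f.labels)
        (fun t ht => ⟨dRaw_len_ne_zero f (Or.inl rfl) t ht, (h t ht).2.1, (h t ht).2.2.1⟩)
        (soleRaw_dRaw f),
      muRaw_pvert_right (dRaw_len_ne_zero g (Or.inr rfl)) f 0 U (ih 2 U hU)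
        (ih 1 _ (Homog.cons (soleValue_mem k f) hU)),
      smul_zero, add_zero, smul_zero, add_zero]

end ChainMap

/-! ### Naturality of the Eulerian idempotent under insertion of an element of arbitrary degree. -/

section Twisted

open Finset

variable {k : Type*} [Field k] {Γ Γ' G G' M : Type*} [AddCommGroup G] [Module k G]
  [AddCommGroup G'] [Module k G'] [AddCommGroup M] [Module k M] [AddCommMonoid Γ]

namespace ShiftedLie

/-- Maps compatible with the brackets up to the Koszul sign of an element of degree `deg` which is
inserted in at most one place; `cnt` counts the places. -/
structure Twist (𝔏 : ShiftedLie k Γ G) (br : G' →ₗ[k] G' →ₗ[k] G') (Γ' : Type*) where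
  cnt : Γ →+ ℕ
  deg : ℤ
  lab : Γ → Γ'
  map : ℕ → G →ₗ[k] G'
  map_br : ∀ {K L : Γ} {a b : ℤ} {x y : G}, x ∈ 𝔏.part K a → y ∈ 𝔏.part L b →
    cnt K + cnt L ≤ 1 → map (cnt (K + L)) (𝔏.br x y)
      = ksgn k (deg * (cnt K * b)) • br (map (cnt K) x) (map (cnt L) y)

namespace Twist

variable {𝔏 : ShiftedLie k Γ G} {br : G' →ₗ[k] G' →ₗ[k] G'} (φ : 𝔏.Twist br Γ')

/-- The image of an entry. -/
def entry (x : Entry Γ G) : Entry Γ' G' :=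
  ⟨φ.lab x.lab, x.deg + φ.deg * φ.cnt x.lab, φ.map (φ.cnt x.lab) x.val⟩

/-- The number of places in a list of entries. -/
def count (U : List (Entry Γ G)) : ℕ := φ.cnt (U.map Entry.lab).sum

/-- The total degree of what follows the place, in a list of entries. -/
def tail : List (Entry Γ G) → ℤ
  | [] => 0
  | x :: U => tail U + φ.count U * (x.deg - 1)

/-- The total degree of what follows the place, in a list of entries followed by an element of
degree `D`. -/
def after (U : List (Entry Γ G)) (D : ℤ) : ℤ := φ.tail U + φ.count U * D

@[simp] theorem count_nil : φ.count [] = 0 := by simp [count]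

@[simp] theorem count_cons (x : Entry Γ G) (U : List (Entry Γ G)) :
    φ.count (x :: U) = φ.cnt x.lab + φ.count U := by simp [count]

theorem count_perm {A B U : List (Entry Γ G)} (h : (A ++ B).Perm U) :
    φ.count A + φ.count B = φ.count U := by
  rw [count, count, count, ← map_add, ← List.sum_append, ← List.map_append,
    (h.map Entry.lab).sum_eq]

theorem sdeg_map (U : List (Entry Γ G)) :
    sdeg (U.map φ.entry) = sdeg U + φ.deg * φ.count U := by
  induction U with
  | nil => simp [sdeg]
  | cons x U ih =>
    rw [List.map_cons, sdeg, sdeg, ih, count_cons, entry]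
    push_cast
    ring

/-- Inserting an element changes the degree of the entry holding the place, hence the shuffle signs.
The change equals the difference between what follows the place in `U` and what follows it after
splitting into `A` and `B`. -/
theorem shuf_map_entry (U : List (Entry Γ G)) (hU : φ.count U ≤ 1) (D : ℤ)
    (Φ : List (Entry Γ' G') → List (Entry Γ' G') → M) :
    (shuf k U fun A B => ksgn k (φ.deg * (φ.after A (sdeg B + D) + φ.after B D)) •
        Φ (A.map φ.entry) (B.map φ.entry))
      = ksgn k (φ.deg * φ.after U D) • shuf k (U.map φ.entry) Φ := by
  induction U generalizing D Φ with
  | nil => simp [shuf, after, tail]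
  | cons x U ih =>
    have hU' := hU
    rw [count_cons] at hU'
    have e : φ.after (x :: U) D = φ.cnt x.lab * D + φ.after U (D + (x.deg - 1)) := by
      rw [after, after, tail, count_cons]
      push_cast
      ring
    rw [List.map_cons, shuf, shuf, e, mul_add, ksgn_add, mul_smul, ← ih (by omega), ← shuf_smul]
    refine shuf_congr U fun A B h => ?_
    have hc := φ.count_perm h
    -- The place cannot lie both in `x` and in the part `B` which `x` passes; otherwise the signs
    -- would involve the square of `φ.deg`.
    have hx : φ.cnt x.lab = 0 ∨ φ.count B = 0 := by omega
    rw [smul_add, smul_add]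
    simp only [ksgn_smul_smul, sdeg_map, after, tail, count_cons, entry, sdeg, List.map_cons]
    clear ih
    congr 1
    · refine ksgn_smul_congr ?_ _
      rcases hx with hx | hx <;> rw [hx] <;> push_cast <;> grind
    · refine ksgn_smul_congr ?_ _
      push_cast
      grind

/-- Since `psi` is built from brackets and shuffles, `map_br` and `shuf_map_entry` suffice. The
label of an element determines whether it holds the place, hence which of the maps `φ.map 0`, `φ.map
1` applies. -/
theorem map_psi : ∀ (U : List (Entry Γ G)) (N : ℕ) {z : G} {L : Γ} {d : ℤ} (_ : 𝔏.Homog U)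
    (_ : z ∈ 𝔏.part L d) (_ : φ.count U + φ.cnt L ≤ 1),
    φ.map (φ.count U + φ.cnt L) (psi 𝔏.br U z N)
      = ksgn k (φ.deg * φ.after U d) • psi br (U.map φ.entry) (φ.map (φ.cnt L) z) N := by
  refine list_length_induction fun U ih => ?_
  intro N z L d hU hz hc
  match U with
  | [] => simp [after, tail, ksgn_zero]
  | x :: U =>
    rw [count_cons] at hc
    have key := φ.shuf_map_entry U (by omega) (d + (x.deg - 1)) fun A B =>
      ksgn k (sdeg A + sdeg B * (1 + (φ.entry x).deg)) •
        br (lam br A (φ.entry x).val N) (psi br B (φ.map (φ.cnt L) z) N)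
    have e : φ.after (x :: U) d = φ.cnt x.lab * d + φ.after U (d + (x.deg - 1)) := by
      rw [after, after, tail, count_cons]
      push_cast
      ring
    rw [psi_cons, List.map_cons, psi_cons, e, mul_add, ksgn_add, mul_smul, ← key, ← shuf_map,
      ← shuf_smul]
    refine shuf_congr U fun A B h => ?_
    have hl := perm_length_le h
    have hc' := φ.count_perm h
    have hA := hU.tail.left h
    have hB := hU.tail.right h
    have e1 := φ.map_br (𝔏.lam_mem A hA hU.head N) (𝔏.psi_mem B hB hz N)
      (by rw [map_add, map_add]; change φ.count A + _ + (φ.count B + _) ≤ 1; omega)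
    have e2 : φ.map (φ.count A + φ.cnt x.lab) (lam 𝔏.br A x.val N)
        = ksgn k (φ.deg * φ.after A x.deg)
          • lam br (A.map φ.entry) (φ.map (φ.cnt x.lab) x.val) N := by
      rw [lam, map_sum, lam, smul_sum]
      exact sum_congr rfl fun i _ => ih A (by simp; omega) i hA hU.head (by omega)
    have e3 := ih B (by simp; omega) N hB hz (by omega)
    have e4 : φ.cnt ((A.map Entry.lab).sum + x.lab + ((B.map Entry.lab).sum + L))
        = φ.count (x :: U) + φ.cnt L := by
      rw [map_add, map_add, map_add, count_cons, ← hc']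
      simp only [count]
      omega
    have e5 : φ.cnt ((A.map Entry.lab).sum + x.lab) = φ.count A + φ.cnt x.lab := map_add _ _ _
    have e6 : φ.cnt ((B.map Entry.lab).sum + L) = φ.count B + φ.cnt L := map_add _ _ _
    rw [e4, e5, e6, e2, e3] at e1
    rw [map_smul, e1]
    simp only [map_smul, LinearMap.smul_apply, ksgn_smul_smul, sdeg_map, after, entry]
    have hx : φ.cnt x.lab = 0 ∨ φ.count B = 0 := by omega
    refine ksgn_smul_congr ?_ _
    clear key ih e1 e2 e3
    rcases hx with hx | hx <;> rw [hx] <;> push_cast <;> grind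

theorem map_eulerian [CharZero k] (U : List (Entry Γ G)) {z : G} {L : Γ} {d : ℤ}
    (hU : 𝔏.Homog U) (hz : z ∈ 𝔏.part L d) (hc : φ.count U + φ.cnt L ≤ 1) :
    φ.map (φ.count U + φ.cnt L) (eulerian k 𝔏.br U z)
      = ksgn k (φ.deg * φ.after U d) • eulerian k br (U.map φ.entry) (φ.map (φ.cnt L) z) := by
  rw [eulerian, eulerian, ← map_smul,
    ← linCoeff_map _ (PolyFrom.mono (Nat.zero_le 1) (lam_poly 𝔏.br U z))]
  congr 1
  funext N
  rw [lam, map_sum, Pi.smul_apply, lam, smul_sum]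
  exact sum_congr rfl fun i _ => φ.map_psi U i hU hz hc

end Twist

end ShiftedLie

end Twisted

/-! ### Simultaneous substitution of trees on spatial leaves. -/

namespace PTree

variable {α β : Type}

/-- Graft the trees `f a` on the spatial leaves labelled `a`. -/
def subst (f : α → PTree β .sp) : {κ : Kind} → PTree α κ → PTree β κ
  | _, leaf a => f a
  | _, vert w t => vert w (subst f t)
  | _, snil => snil
  | _, scons s t => scons (subst f s) (subst f t)
  | _, edge => edge
  | _, pvert s t => pvert (subst f s) (subst f t)
  | _, pnil => pnil
  | _, pcons s t => pcons (subst f s) (subst f t)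

/-- The total degree of the vertices that follow a leaf counted by `c`. -/
def afterBy (c : Multiset α →+ ℕ) : {κ : Kind} → PTree α κ → ℤ
  | _, leaf _ => 0
  | _, vert _ f => afterBy c f
  | _, snil => 0
  | _, scons t f => afterBy c t + c t.labels * f.deg + afterBy c f
  | _, edge => 0
  | _, pvert f g => afterBy c f + c f.labels * g.deg + afterBy c g
  | _, pnil => 0
  | _, pcons t g => afterBy c t + c t.labels * g.deg + afterBy c g

theorem map_eq_subst (e : α → β) {κ : Kind} (t : PTree α κ) :
    t.map e = t.subst fun a => leaf (e a) := by
  induction t <;> simp_all [map, subst]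

theorem sub_eq_subst [DecidableEq α] (i : α) (e : α → β) (u : PTree β .sp) {κ : Kind}
    (t : PTree α κ) : sub i e u t = t.subst fun a => if a = i then u else leaf (e a) := by
  induction t <;> simp_all [sub, subst]

theorem afterBy_count [DecidableEq α] (i : α) {κ : Kind} (t : PTree α κ) :
    afterBy (Multiset.countAddMonoidHom i) t = after i t := by
  induction t <;> simp_all [afterBy, after]

theorem len_subst (f : α → PTree β .sp) {κ : Kind} (t : PTree α κ) (h : κ ≠ .sp) :
    (t.subst f).len = t.len := by
  induction t <;> simp_all [subst, len]

theorem labels_subst (f : α → PTree β .sp) {κ : Kind} (t : PTree α κ) :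
    (t.subst f).labels = t.labels.bind fun a => (f a).labels := by
  induction t <;> simp_all [subst, labels]

theorem deg_subst (f : α → PTree β .sp) (c : Multiset α →+ ℕ) (d : ℤ)
    (h : ∀ a, (f a).deg = d * c {a}) {κ : Kind} (t : PTree α κ) :
    (t.subst f).deg = t.deg + d * c t.labels := by
  induction t with
  | leaf a => simp [subst, h, deg, labels]
  | vert w f ih => cases w <;> simp [subst, deg, labels, ih, len_subst]; ring
  | _ => simp_all [subst, deg, labels, len_subst] <;> ring

/-- The equivalence, rather than one implication, is needed so that a forbidden vertex in `t` or `u`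
is detected in the composite and both sides of the grafting formula vanish together. -/
theorem adm_sub [DecidableEq α] {S : Vtx → ℕ → Prop} {P : ℕ → ℕ → Prop} (i : α) (e : α → β)
    (u : PTree β .sp) {κ : Kind} (t : PTree α κ) :
    (sub i e u t).Adm S P ↔ t.Adm S P ∧ (i ∈ t.labels → u.Adm S P) := by
  induction t with
  | leaf a => by_cases h : a = i <;> simp [sub, labels, Adm, h, Ne.symm]
  | _ => simp_all [sub, labels, Adm, len_sub] <;> grind

end PTree

/-! ### Compatibility of the tree map with relabelling and grafting, treated uniformly. -/

section Substitutions

open PTree ShiftedLie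

variable (k : Type*) [Field k] (α β : Type)

/-- Maps on classes of trees which are given by grafting trees on leaves, up to the Koszul sign of
the one tree of degree `deg` which is grafted on a leaf counted by `cnt`. -/
structure Substitution where
  cnt : Multiset α →+ ℕ
  deg : ℤ
  tree : α → PTree β .sp
  deg_tree : ∀ a, (tree a).deg = deg * cnt {a}
  map : ∀ {κ : Kind}, ℕ → SCTrees k α κ →ₗ[k] SCTrees k β κ
  map_collapseTree : ∀ {κ : Kind} (t : PTree α κ), cnt t.labels ≤ 1 →
    map (cnt t.labels) (collapseTree k t)
      = ksgn k (deg * afterBy cnt t) • collapseTree k (t.subst tree)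

variable {k α β}

theorem muTree_spatial [CharZero k] {κ : Kind} (h : κ = .sp ∨ κ = .sps) (t : PTree α κ) (j : ℕ)
    (U : List (TreeEntry k α)) : muTree k t j U = 0 := by
  cases t <;> simp_all [muTree]

theorem muTree_pvert_two [CharZero k] {f : PTree α .sps} {g : PTree α .pls} (hf : f.len = 0)
    (hg : g.len = 2) (j : ℕ) (U : List (TreeEntry k α)) :
    muTree k (pvert f g) j U = muTree k g 2 U := by
  rw [muTree_pvert, if_neg (by omega), if_pos hf, muTree_one_eq_zero k (by omega), add_zero,
    zero_add]

theorem muTree_pvert_one [CharZero k] {f : PTree α .sps} {g : PTree α .pls} (hf : f.len ≠ 0)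
    (hg : g.len = 1) (j : ℕ) (U : List (TreeEntry k α)) :
    muTree k (pvert f g) j U = muTree k g 1 (soleEntry k f :: U) := by
  rw [muTree_pvert, if_neg (by omega), if_neg hf, add_zero, zero_add]

theorem collapseTree_eq_mk {κ : Kind} {t : PTree α κ} (h : t.Adm OCVertex OCCorolla) :
    collapseTree k t = mk k .swissCheese t := if_pos h

theorem collapseTree_central (s : PTree α .sp) :
    collapseTree k (pvert (scons s snil) pnil) = centralMap k α (collapseTree k s) := by
  have h : (pvert (scons s snil) pnil).Adm OCVertex OCCorolla ↔ s.Adm OCVertex OCCorolla := by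
    simp [Adm, OCCorolla, len]
  unfold collapseTree
  by_cases hs : s.Adm OCVertex OCCorolla
  · rw [if_pos (h.2 hs), if_pos hs, centralMap_mk]
  · rw [if_neg fun h' => hs (h.1 h'), if_neg hs, map_zero]

theorem collapseTree_product (s t : PTree α .pl) :
    collapseTree k (pvert snil (pcons s (pcons t pnil)))
      = productMap k α (collapseTree k s) (collapseTree k t) := by
  have h : (pvert snil (pcons s (pcons t pnil))).Adm OCVertex OCCorolla
      ↔ s.Adm OCVertex OCCorolla ∧ t.Adm OCVertex OCCorolla := by
    simp [Adm, OCCorolla, len]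
  unfold collapseTree
  by_cases hs : s.Adm OCVertex OCCorolla
  · by_cases ht : t.Adm OCVertex OCCorolla
    · rw [if_pos (h.2 ⟨hs, ht⟩), if_pos hs, if_pos ht, productMap_mk]
    · rw [if_neg fun h' => ht (h.1 h').2, if_neg ht, map_zero]
  · rw [if_neg fun h' => hs (h.1 h').1, if_neg hs, map_zero, LinearMap.zero_apply]

namespace Substitution

variable (S : Substitution k α β)

/-- On trees this is `map_collapseTree` for the tree with root `l_2`. The sign remains because the
inserted tree, when it sits in `x`, must pass `y`. -/
theorem map_bracketMap {K L : Multiset α} {a b : ℤ} {x y : SCTrees k α .sp}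
    (hx : x ∈ piece k .sp K 0 a) (hy : y ∈ piece k .sp L 0 b) (hc : S.cnt K + S.cnt L ≤ 1) :
    S.map (S.cnt (K + L)) (bracketMap k α x y)
      = ksgn k (S.deg * (S.cnt K * b))
        • bracketMap k β (S.map (S.cnt K) x) (S.map (S.cnt L) y) := by
  refine piece_congr (f := S.map (S.cnt (K + L)) ∘ₗ (bracketMap k α).flip y)
    (g := ksgn k (S.deg * (S.cnt K * b))
      • (bracketMap k β).flip (S.map (S.cnt L) y) ∘ₗ S.map (S.cnt K)) (fun s h1 h2 _ _ => ?_) hx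
  refine piece_congr (f := S.map (S.cnt (K + L)) ∘ₗ bracketMap k α (OpenClosed.mk k _ s))
    (g := ksgn k (S.deg * (S.cnt K * b))
      • bracketMap k β (S.map (S.cnt K) (OpenClosed.mk k _ s)) ∘ₗ S.map (S.cnt L)) (fun t g1 g2 _ g4 => ?_) hy
  subst h2 g2 g4
  have key := S.map_collapseTree (vert .l (scons s (scons t snil))) (by simpa [labels] using hc)
  simp only [LinearMap.comp_apply, LinearMap.smul_apply]
  rw [← collapseTree_eq_mk h1, ← collapseTree_eq_mk g1, S.map_collapseTree s (by omega),
    S.map_collapseTree t (by omega), map_smul, map_smul, LinearMap.smul_apply, ksgn_smul_smul,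
    ksgn_smul_smul, ← collapseTree_bracket, ← collapseTree_bracket]
  simp only [labels, add_zero, subst] at key
  rw [key]
  refine ksgn_smul_congr ?_ _
  simp only [afterBy, PTree.deg]
  clear key
  push_cast
  grind

theorem map_centralMap {L : Multiset α} {d : ℤ} {x : SCTrees k α .sp}
    (hx : x ∈ piece k .sp L 0 d) (hc : S.cnt L ≤ 1) :
    S.map (S.cnt L) (centralMap k α x) = centralMap k β (S.map (S.cnt L) x) := by
  refine piece_congr (f := S.map (S.cnt L) ∘ₗ centralMap k α)
    (g := centralMap k β ∘ₗ S.map (S.cnt L)) (fun s h1 h2 _ _ => ?_) hx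
  subst h2
  have key := S.map_collapseTree (pvert (scons s snil) pnil) (by simpa [labels] using hc)
  simp only [LinearMap.comp_apply]
  rw [← collapseTree_eq_mk h1, S.map_collapseTree s hc, map_smul, ← collapseTree_central,
    ← collapseTree_central]
  simpa [labels, subst, afterBy, PTree.deg] using key

theorem map_productMap {K L : Multiset α} {p q : ℕ} {a b : ℤ} {x y : SCTrees k α .pl}
    (hx : x ∈ piece k .pl K p a) (hy : y ∈ piece k .pl L q b) (hc : S.cnt K + S.cnt L ≤ 1) :
    S.map (S.cnt (K + L)) (productMap k α x y)
      = ksgn k (S.deg * (S.cnt K * b))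
        • productMap k β (S.map (S.cnt K) x) (S.map (S.cnt L) y) := by
  refine piece_congr (f := S.map (S.cnt (K + L)) ∘ₗ (productMap k α).flip y)
    (g := ksgn k (S.deg * (S.cnt K * b))
      • (productMap k β).flip (S.map (S.cnt L) y) ∘ₗ S.map (S.cnt K)) (fun s h1 h2 _ _ => ?_) hx
  refine piece_congr (f := S.map (S.cnt (K + L)) ∘ₗ productMap k α (OpenClosed.mk k _ s))
    (g := ksgn k (S.deg * (S.cnt K * b))
      • productMap k β (S.map (S.cnt K) (OpenClosed.mk k _ s)) ∘ₗ S.map (S.cnt L)) (fun t g1 g2 _ g4 => ?_) hy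
  subst h2 g2 g4
  have key := S.map_collapseTree (pvert snil (pcons s (pcons t pnil)))
    (by simpa [labels] using hc)
  simp only [LinearMap.comp_apply, LinearMap.smul_apply]
  rw [← collapseTree_eq_mk h1, ← collapseTree_eq_mk g1, S.map_collapseTree s (by omega),
    S.map_collapseTree t (by omega), map_smul, map_smul, LinearMap.smul_apply, ksgn_smul_smul,
    ksgn_smul_smul, ← collapseTree_product, ← collapseTree_product]
  simp only [labels, add_zero, zero_add, subst] at key
  rw [key]
  refine ksgn_smul_congr ?_ _
  simp only [afterBy, PTree.deg, labels, map_zero]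
  clear key
  push_cast
  grind

/-- The action on the Lie algebra of spatial trees. -/
def twist : (spatialLie k α).Twist (bracketMap k β) (Multiset β) where
  cnt := S.cnt
  deg := S.deg
  lab L := L.bind fun a => (S.tree a).labels
  map := S.map
  map_br hx hy hc := S.map_bracketMap hx hy hc

theorem map_soleValue (f : PTree α .sps) (hc : S.cnt f.labels ≤ 1) :
    S.map (S.cnt f.labels) (soleValue k f)
      = ksgn k (S.deg * afterBy S.cnt f) • soleValue k (f.subst S.tree) := by
  cases f with
  | snil => simp [soleValue, subst]
  | scons t f =>
    rw [subst, soleValue_scons, soleValue_scons, len_subst _ _ (by simp)]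
    split_ifs with h
    · rw [eq_snil h] at hc ⊢
      simpa [labels, afterBy, PTree.deg] using S.map_collapseTree t (by simpa [labels] using hc)
    · simp

variable [CharZero k]

/-- The twisted entry and the entry of the substituted list have equal labels and degrees, and their
values differ by a sign, which linearity in the entry extracts. -/
theorem muTree_entry_soleEntry {κ : Kind} (t : PTree β κ) (j : ℕ) (f : PTree α .sps)
    (hc : S.cnt f.labels ≤ 1) (U : List (TreeEntry k β)) :
    muTree k t j (S.twist.entry (soleEntry k f) :: U)
      = ksgn k (S.deg * afterBy S.cnt f) • muTree k t j (soleEntry k (f.subst S.tree) :: U) := by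
  have e : S.twist.entry (soleEntry k f) = ⟨(f.subst S.tree).labels, (f.subst S.tree).deg,
      ksgn k (S.deg * afterBy S.cnt f) • soleValue k (f.subst S.tree)⟩ := by
    rw [← S.map_soleValue f hc, labels_subst, deg_subst S.tree S.cnt S.deg S.deg_tree]
    rfl
  rw [e]
  exact (muTree_entryLinear t j _ [] _ _ U le_rfl).map_smul _ _

open Classical in
-- The construction is natural in all its ingredients. The sign is that of moving the inserted tree
-- past everything following its leaf in the word formed by `U` and then `t`.
theorem map_muTree {κ : Kind} (t : PTree α κ) : ∀ (j : ℕ) {U : List (TreeEntry k α)}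
    (_ : (spatialLie k α).Homog U) (_ : S.twist.count U + S.cnt t.labels ≤ 1),
    S.map (S.twist.count U + S.cnt t.labels) (muTree k t j U)
      = ksgn k (S.deg * (S.twist.after U t.deg + afterBy S.cnt t))
        • muTree k (t.subst S.tree) j (U.map S.twist.entry) := by
  induction t with
  | edge =>
    intro j U _ _
    rw [subst, muTree_edge, muTree_edge]
    by_cases h : U = []
    · subst h
      have := S.map_collapseTree (k := k) edge (by simp [labels])
      have h (γ : Type) : collapseTree k (edge : PTree γ .pl) = OpenClosed.mk k .swissCheese edge :=
        if_pos trivial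
      rw [subst, h, h] at this
      simpa [Twist.after, Twist.tail] using this
    · rw [if_neg h, if_neg (by simpa using h), map_zero, smul_zero]
  | pvert f g _ ih =>
    intro j U hU hc
    simp only [labels, map_add] at hc
    have hf := len_subst S.tree f (by simp)
    have hg := len_subst S.tree g (by simp)
    rw [subst]
    by_cases h1 : f.len = 1 ∧ g.len = 0
    · obtain ⟨hf1, hg0⟩ := h1
      obtain rfl := eq_pnil hg0
      obtain ⟨x, f', rfl, hf'⟩ := eq_scons hf1
      obtain rfl := eq_snil hf'
      have hx := collapseTree_mem k x
      have hL : S.cnt ((U.map Entry.lab).sum + x.labels) = S.twist.count U + S.cnt x.labels :=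
        map_add _ _ _
      simp only [labels, map_zero, add_zero] at hc
      have e1 := S.map_centralMap ((spatialLie k α).eulerian_mem U hU hx) (by rw [hL]; exact hc)
      have e2 := S.twist.map_eulerian U hU hx hc
      rw [hL] at e1
      rw [subst, subst, subst, muTree_central, muTree_central]
      simp only [labels, add_zero]
      refine e1.trans ((congrArg _ e2).trans ?_)
      change centralMap k β (_ • eulerian k _ _ (S.map (S.cnt x.labels) (collapseTree k x))) = _
      rw [S.map_collapseTree x (by omega),
        (eulerian_isLinearMap (bracketMap k β) _).map_smul, map_smul, map_smul, ksgn_smul_smul]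
      refine ksgn_smul_congr ?_ _
      simp only [afterBy, PTree.deg, len, labels, twist]
      clear e1 e2
      push_cast
      grind
    by_cases h2 : f.len = 0 ∧ g.len = 2
    · obtain ⟨hf0, hg2⟩ := h2
      obtain rfl := eq_snil hf0
      have e := ih 2 hU (by simpa [labels] using hc)
      rw [muTree_pvert_two hf0 hg2, muTree_pvert_two (hf.trans hf0) (hg.trans hg2)]
      simp only [labels, zero_add]
      rw [e]
      refine ksgn_smul_congr ?_ _
      simp only [afterBy, PTree.deg, len, labels, hg2, map_zero]
      clear e
      push_cast
      grind
    -- For `n_{1,1}` the spatial input joins the word, so a leaf inside `f` changes from being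
    -- counted in the tree to being counted in the word.
    by_cases h3 : f.len = 1 ∧ g.len = 1
    · obtain ⟨hf1, hg1⟩ := h3
      have hU' : (spatialLie k α).Homog (soleEntry k f :: U) := Homog.cons (soleValue_mem k f) hU
      have hn : S.twist.count (soleEntry k f :: U) = S.cnt f.labels + S.twist.count U :=
        S.twist.count_cons _ _
      have e := ih 1 hU' (by rw [hn]; omega)
      rw [muTree_pvert_one (by omega) hg1, muTree_pvert_one (by omega) (hg.trans hg1)]
      rw [List.map_cons, S.muTree_entry_soleEntry _ _ _ (by omega), ksgn_smul_smul] at e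
      have hn' : S.twist.count U + S.cnt (pvert f g).labels
          = S.twist.count (soleEntry k f :: U) + S.cnt g.labels := by
        rw [hn, labels, map_add]
        omega
      rw [hn', e]
      refine ksgn_smul_congr ?_ _
      simp only [afterBy, PTree.deg, hf1, hg1, Twist.after, Twist.tail, hn]
      simp only [soleEntry]
      clear e
      push_cast
      grind
    · rw [muTree_pvert_eq_zero h1 h2 h3, muTree_pvert_eq_zero (by rwa [hf, hg])
        (by rwa [hf, hg]) (by rwa [hf, hg]), map_zero, smul_zero]
  | pcons a g iha ihg =>
    intro j U hU hc
    simp only [labels, map_add] at hc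
    rw [subst]
    by_cases hj : j = 1
    · subst hj
      rw [muTree_pcons_one, muTree_pcons_one, len_subst _ _ (by simp)]
      split_ifs with hg
      · obtain rfl := eq_pnil hg
        simpa [labels, PTree.deg, afterBy] using iha 0 hU (by omega)
      · rw [map_zero, smul_zero]
    · have key := S.twist.shuf_map_entry (k := k) U (by omega) (a.deg + g.deg) fun A B =>
        ksgn k (sdeg B * (a.subst S.tree).deg)
          • productMap k β (muTree k (a.subst S.tree) 0 A) (muTree k (g.subst S.tree) 1 B)
      rw [muTree_pcons k a g hj, muTree_pcons k _ _ hj, mul_add, ksgn_add, PTree.deg,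
        mul_comm (ksgn k _), mul_smul]
      refine Eq.trans ?_ (congrArg _ key)
      rw [← shuf_map, ← shuf_smul]
      refine shuf_congr U fun A B h => ?_
      have hc' := S.twist.count_perm h
      have e1 := iha 0 (hU.left h) (by omega)
      have e2 := ihg 1 (hU.right h) (by omega)
      have e3 := S.map_productMap (muTree_mem a 0 (hU.left h)) (muTree_mem g 1 (hU.right h))
        (by
          rw [map_add, map_add]
          change S.twist.count A + _ + (S.twist.count B + _) ≤ 1
          omega)
      have n1 : S.cnt ((A.map Entry.lab).sum + a.labels) = S.twist.count A + S.cnt a.labels :=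
        map_add _ _ _
      have n2 : S.cnt ((B.map Entry.lab).sum + g.labels) = S.twist.count B + S.cnt g.labels :=
        map_add _ _ _
      have n3 : S.cnt ((A.map Entry.lab).sum + a.labels + ((B.map Entry.lab).sum + g.labels))
          = S.twist.count U + S.cnt (pcons a g).labels := by
        rw [map_add, n1, n2, labels, map_add]
        omega
      rw [n3, n1, n2, e1, e2] at e3
      rw [map_smul, e3]
      simp only [map_smul, LinearMap.smul_apply, ksgn_smul_smul]
      refine ksgn_smul_congr ?_ _
      rw [S.twist.sdeg_map, deg_subst S.tree S.cnt S.deg S.deg_tree]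
      -- The leaf cannot be both in `a` and in the part `B` that moves past `a`.
      have hx : S.cnt a.labels = 0 ∨ S.twist.count B = 0 := by omega
      simp only [afterBy, Twist.after]
      have hd : S.twist.deg = S.deg := rfl
      rw [hd]
      clear e1 e2 e3 key iha ihg
      rcases hx with hx | hx <;> rw [hx] <;> push_cast <;> grind
  | _ => intro j U _ _; simp [muTree_spatial, muTree, subst]

end Substitution

end Substitutions

/-! ### Relabelling and partial composition as substitutions. -/

section Actions

open PTree ShiftedLie

variable {k : Type*} [Field k] {α β : Type} {κ : Kind}

theorem relabel_collapseTree (e : α → β) (t : PTree α κ) :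
    relabel k .swissCheese e (collapseTree k t) = collapseTree k (t.map e) := by
  have h := (map_invariants (S := OCVertex) (P := OCCorolla) e t).2.2
  unfold collapseTree
  by_cases ht : t.Adm OCVertex OCCorolla
  · rw [if_pos ht, if_pos (h.2 ht), relabel_mk]
  · rw [if_neg ht, if_neg fun h' => ht (h.1 h'), map_zero]

theorem graft_collapseTree [DecidableEq α] (i : α) (e : α → β) (t : PTree α κ) (u : PTree β .sp)
    (h : t.labels.count i = 1) :
    graft k .swissCheese i e (collapseTree k t) (collapseTree k u)
      = ksgn k (u.deg * after i t) • collapseTree k (sub i e u t) := by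
  have hi : i ∈ t.labels := Multiset.count_pos.1 (by omega)
  have hs := adm_sub (S := OCVertex) (P := OCCorolla) i e u t
  unfold collapseTree
  by_cases ht : t.Adm OCVertex OCCorolla
  · by_cases hu : u.Adm OCVertex OCCorolla
    · rw [if_pos ht, if_pos hu, if_pos (hs.2 ⟨ht, fun _ => hu⟩), graft_mk, graftRaw_eq _ _ _ _ h,
        mk_single]
    · rw [if_neg hu, if_neg fun h' => hu ((hs.1 h').2 hi), map_zero, smul_zero]
  · rw [if_neg ht, if_neg fun h' => ht (hs.1 h').1, map_zero, LinearMap.zero_apply, smul_zero]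

variable (k) in
/-- Relabelling as substitution. -/
def relabelSubstitution (e : α → β) : Substitution k α β where
  cnt := 0
  deg := 0
  tree a := leaf (e a)
  deg_tree a := by simp [deg]
  map _ := relabel k .swissCheese e
  map_collapseTree t _ := by rw [relabel_collapseTree, map_eq_subst, zero_mul, ksgn_zero, one_smul]

variable (k) in
/-- Composition with a fixed tree as substitution. -/
def graftSubstitution [DecidableEq α] (i : α) (e : α → β) (u : PTree β .sp) :
    Substitution k α β where
  cnt := Multiset.countAddMonoidHom i
  deg := u.deg
  tree a := if a = i then u else leaf (e a)
  deg_tree a := by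
    by_cases h : a = i
    · simp [h]
    · simp [h, deg, Ne.symm h]
  -- On subtrees without the leaf `i` nothing is grafted and only the labels change; the bilinear
  -- composition would give zero there.
  map n := if n = 0 then relabel k .swissCheese e
    else (graft k .swissCheese i e).flip (collapseTree k u)
  map_collapseTree t h := by
    rw [Multiset.coe_countAddMonoidHom] at h ⊢
    rw [afterBy_count, ← sub_eq_subst]
    by_cases h0 : t.labels.count i = 0
    · rw [if_pos h0, relabel_collapseTree, sub_eq_map i e u t h0, after_eq_zero i t h0, mul_zero,
        ksgn_zero, one_smul]
    · rw [if_neg h0, LinearMap.flip_apply, graft_collapseTree i e t u (by omega)]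

variable [CharZero k]

theorem relabel_muTree (e : α → β) (t : PTree α κ) :
    relabel k .swissCheese e (muTree k t 0 []) = muTree k (t.map e) 0 [] := by
  have := (relabelSubstitution k e).map_muTree t 0 Homog.nil (Nat.zero_le 1)
  rw [map_eq_subst]
  simpa [relabelSubstitution, ksgn_zero] using this

/-- Naturality for the empty word, where the only sign left is that of the operadic composition. -/
theorem graft_muTree [DecidableEq α] (i : α) (e : α → β) (t : PTree α κ) (u : PTree β .sp)
    (h : t.labels.count i = 1) :
    graft k .swissCheese i e (muTree k t 0 []) (collapseTree k u)
      = ksgn k (u.deg * after i t) • muTree k (sub i e u t) 0 [] := by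
  have := (graftSubstitution k i e u).map_muTree t 0 Homog.nil
    (by simpa [graftSubstitution] using h.le)
  rw [sub_eq_subst]
  simpa [graftSubstitution, h, afterBy_count, Twist.after, Twist.tail] using this

end Actions

/-! ### The morphism of modules and its values on corollae. -/

section Morphism

open PTree ShiftedLie

variable (k : Type*) [Field k] [CharZero k] {α β : Type}

/-- The value of the morphism on a tree. -/
def muValue : (x : Colour) → PTree α x.kind → SCTrees k α x.kind
  | .spatial, t => collapseTree k t
  | .planar, t => muTree k t 0 []

/-- The morphism on all classes of trees. -/
def muMap : (x : Colour) → Trees k .free α x.kind →ₗ[k] SCTrees k α x.kind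
  | .spatial => collapse k
  | .planar => (RelSpan k .free α .pl).liftQ (muRaw 0 [])
      (RelSpan.le ⊥ _ fun _ hr => hr.killed [] Homog.nil)

theorem muMap_mk (x : Colour) (t : PTree α x.kind) : muMap k x (mk k .free t) = muValue k x t := by
  cases x with
  | spatial => exact collapse_mk k t
  | planar =>
    rw [muMap, mk]
    refine (Submodule.liftQ_apply _ _ _).trans ?_
    rw [Finsupp.linearCombination_single, one_smul, muValue]

/-- The case of the empty word in `dRaw_killed`. -/
theorem muMap_diff (x : Colour) (T : Trees k .free α x.kind) : muMap k x (diff k T) = 0 := by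
  have : muMap k x ∘ₗ diff k = (0 : Trees k .free α x.kind →ₗ[k] _) := by
    refine mk_ext fun t => ?_
    rw [LinearMap.comp_apply, diff, mk, Submodule.mapQ_apply, Finsupp.linearCombination_single,
      one_smul, LinearMap.zero_apply]
    cases x with
    | spatial => exact dRaw_killed t
    | planar => exact dRaw_killed t [] Homog.nil
  exact LinearMap.congr_fun this T

theorem muValue_mem (x : Colour) (t : PTree α x.kind) :
    muValue k x t ∈ piece k x.kind t.labels t.planar t.deg := by
  cases x with
  | spatial => exact mem_piece_of_eq (collapseTree_mem k t) rfl (planar_eq_zero t (Or.inl rfl)) rfl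
  | planar =>
    exact mem_piece_of_eq (muTree_mem (k := k) t 0 Homog.nil) (by simp) rfl (by simp [sdeg])

theorem muMap_relabel (x : Colour) (e : α → β) (T : Trees k .free α x.kind) :
    muMap k x (relabel k .free e T) = relabel k .swissCheese e (muMap k x T) := by
  have : muMap k x ∘ₗ relabel k .free e = relabel k .swissCheese e ∘ₗ muMap k x := by
    refine mk_ext fun t => ?_
    rw [LinearMap.comp_apply, LinearMap.comp_apply, relabel_mk, muMap_mk, muMap_mk]
    cases x with
    | spatial => exact (relabel_collapseTree e t).symm
    | planar => exact (relabel_muTree e t).symm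
  exact LinearMap.congr_fun this T

theorem muMap_graft [DecidableEq α] (x : Colour) (i : α) (e : α → β) (t : PTree α x.kind)
    (h : t.labels.count i = 1) (U : Trees k .free β .sp) :
    muMap k x (graft k .free i e (mk k .free t) U)
      = graft k .swissCheese i e (muValue k x t) (collapse k U) := by
  have : muMap k x ∘ₗ graft k .free i e (mk k .free t)
      = graft k .swissCheese i e (muValue k x t) ∘ₗ collapse k := by
    refine mk_ext fun u => ?_
    rw [LinearMap.comp_apply, LinearMap.comp_apply, graft_mk, graftRaw_eq _ _ _ _ h, mk_single,
      map_smul, muMap_mk, collapse_mk]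
    cases x with
    | spatial => exact (graft_collapseTree i e t u h).symm
    | planar => exact (graft_muTree i e t u h).symm
  exact LinearMap.congr_fun this U

/-- Membership of `T` guarantees that each leaf label occurs exactly once, so every composition is a
genuine grafting. -/
theorem muMap_circ (x : Colour) {p q m : ℕ} {T : Trees k .free (Fin (p + 1)) x.kind}
    (hT : T ∈ OCinf k x (p + 1) q) (i : Fin (p + 1)) (U : Trees k .free (Fin (m + 1)) .sp) :
    muMap k x (circ k .free i m T U) = circ k .swissCheese i m (muMap k x T) (collapse k U) := by
  induction hT using Submodule.span_induction with
  | zero => simp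
  | add a b _ _ ha hb => simp only [map_add, LinearMap.add_apply, ha, hb]
  | smul c a _ ha => simp only [map_smul, LinearMap.smul_apply, ha]
  | mem a ha =>
    obtain ⟨t, ⟨_, h, _⟩, rfl⟩ := ha
    -- The grafted element is renumbered before grafting, and `collapse` commutes with this.
    have e := muMap_relabel k .spatial (inner i m) U
    simp only [muMap] at e
    rw [circ, circ, LinearMap.compl₂_apply, LinearMap.compl₂_apply,
      muMap_graft k x _ _ _ (by rw [h]; exact Multiset.count_univ i), muMap_mk, e]

theorem muMap_mem (x : Colour) {p q : ℕ} {T : Trees k .free (Fin p) x.kind}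
    (hT : T ∈ OCinf k x p q) : muMap k x T ∈ OC k x p q := by
  have : OCinf k x p q ≤ (OC k x p q).comap (muMap k x) := by
    refine Submodule.span_le.2 ?_
    rintro _ ⟨t, ⟨_, h1, h2⟩, rfl⟩
    rw [SetLike.mem_coe, Submodule.mem_comap, muMap_mk]
    exact piece_map _ LinearMap.id (fun s g1 g2 g3 _ => mem_Span g1 ⟨g2.trans h1, g3.trans h2⟩)
      (muValue_mem k x t)
  exact this hT

theorem muMap_degreePart (x : Colour) (n : ℤ) {T : Trees k .free α x.kind}
    (hT : T ∈ degreePart k .free α x.kind n) :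
    muMap k x T ∈ degreePart k .swissCheese α x.kind n := by
  have : degreePart k .free α x.kind n
      ≤ (degreePart k .swissCheese α x.kind n).comap (muMap k x) := by
    refine Submodule.span_le.2 ?_
    rintro _ ⟨t, h, rfl⟩
    rw [SetLike.mem_coe, Submodule.mem_comap, muMap_mk]
    exact piece_map (degreePart k .swissCheese α x.kind n) LinearMap.id
      (fun s _ _ _ g => Submodule.subset_span ⟨s, g.trans h, rfl⟩) (muValue_mem k x t)
  exact this hT

/-- The morphism `OC_∞ → OC`. -/
def muHom : ModuleHom k where
  toFun {x _ _} := (muMap k x).restrict fun _ hT => muMap_mem k x hT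
  map_degree {x _ _} n _ hT := muMap_degreePart k x n hT
  map_perm {x _ _} σ T := Subtype.ext (muMap_relabel k x σ T.1)
  map_d {x _ _} T := Subtype.ext (muMap_diff k x T.1)
  map_right {x _ _ _} T i l := Subtype.ext (muMap_circ k x T.2 i l.1)
  -- On spatial trees the morphism is the projection to `L`, so left and right compatibility are the
  -- same statement.
  map_left l i T := Subtype.ext (muMap_circ k .spatial l.2 i T.1)

variable {k}

theorem muHom_tree {x : Colour} {p q : ℕ} (t : PTree (Fin p) x.kind) (h : t.Adm InfVertex InfCorolla)
    (h' : Full p q t) : ((muHom k).toFun (OCinf.tree t h h')).1 = muValue k x t := muMap_mk k x t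

/-- Without vertices `n_{1,1}` the word stays empty; then the Eulerian idempotent is the identity
and the coproduct has a single trivial term. -/
theorem muTree_eq_mk : ∀ (t : PTree α .pl), t.Adm OCVertex OCCorolla →
    muTree k t 0 [] = mk k .swissCheese t
  | edge, _ => by rw [muTree_edge, if_pos rfl]
  | pvert f g, h => by
    obtain ⟨h1, h2, h3⟩ := h
    rcases h1 with ⟨hf, hg⟩ | ⟨hf, hg⟩
    · obtain rfl := eq_pnil hg
      obtain ⟨x, f', rfl, hf'⟩ := eq_scons hf
      obtain rfl := eq_snil hf'
      rw [muTree_central, eulerian_nil, collapseTree_eq_mk h2.1, centralMap_mk]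
    · obtain rfl := eq_snil hf
      obtain ⟨a, g', rfl, hg'⟩ := eq_pcons hg
      obtain ⟨b, g'', rfl, hg''⟩ := eq_pcons hg'
      obtain rfl := eq_pnil hg''
      rw [muTree_product, shuf, sdeg, zero_mul, ksgn_zero, one_smul, muTree_eq_mk a h3.1,
        muTree_eq_mk b h3.2.1, productMap_mk]

theorem muValue_eq_mk {x : Colour} (t : PTree α x.kind) (h : t.Adm OCVertex OCCorolla) :
    muValue k x t = mk k .swissCheese t := by
  cases x with
  | spatial => exact collapseTree_eq_mk h
  | planar => exact muTree_eq_mk t h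

/-- The only corolla outside `OC` that is not zero by arity is `n_{1,1}`, and there the derivation
acts on a bare edge. -/
theorem muTree_corolla {s : List α} {q : ℕ} (h : ¬ (s.length = 1 ∧ q = 0))
    (h' : ¬ (s.length = 0 ∧ q = 2)) : muTree k (pvert (leaves s) (edges q)) 0 [] = 0 := by
  have hs := (leaves_invariants (S := OCVertex) (P := OCCorolla) s).1
  have hq := (edges_invariants (α := α) (S := OCVertex) (P := OCCorolla) q).1
  by_cases h1 : s.length = 1 ∧ q = 1
  · obtain ⟨h1, rfl⟩ := h1
    obtain ⟨a, rfl⟩ := List.length_eq_one_iff.1 h1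
    rw [leaves, leaves, edges, edges, muTree_brace, muTree_edge, if_neg (by simp)]
  · exact muTree_pvert_eq_zero (by rwa [hs, hq]) (by rwa [hs, hq]) (by rwa [hs, hq]) _ _

theorem muTree_brace_central (a b : α) :
    muTree k (pvert (leaves [a]) (pcons (pvert (leaves [b]) pnil) pnil)) 0 []
      = (-(1 / 2) : k)
        • mk k .swissCheese (pvert (scons (vert .l (leaves [a, b])) snil) pnil) := by
  simp only [leaves]
  rw [muTree_brace, muTree_central, eulerian_singleton, map_smul, treeEntry, collapseTree_leaf,
    collapseTree_leaf, bracketMap_mk, centralMap_mk]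

end Morphism

end OpenClosed

end

/-! ### The theorem. -/

theorem mainTheorem7 (k : Type*) [Field k] [CharZero k] :
    ∃ μ : OpenClosed.ModuleHom k,
      (∀ (x : OpenClosed.Colour) (p q : ℕ) (t : OpenClosed.PTree (Fin p) x.kind)
        (h : t.Adm OpenClosed.OCVertex OpenClosed.OCCorolla) (h' : OpenClosed.Full p q t),
        μ.toFun (OpenClosed.OCinf.tree t (OpenClosed.adm_mono t h) h') =
          OpenClosed.OC.tree t h h') ∧
      μ.toFun OpenClosed.OCinf.n11n10 = (-(1 / 2) : k) • OpenClosed.OC.n10l2 ∧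
      (∀ (p q : ℕ) (h : 2 ≤ 2 * p + q), (p, q) ≠ (1, 0) → (p, q) ≠ (0, 2) →
        μ.toFun (OpenClosed.OCinf.n p q h) = 0) ∧
      (∀ (n : ℕ) (h : 3 ≤ n), μ.toFun (OpenClosed.OCinf.l n (Nat.le_of_succ_le h)) = 0) := by
  refine ⟨OpenClosed.muHom k, fun x p q t h h' => Subtype.ext ?_, Subtype.ext ?_,
    fun p q h h1 h2 => Subtype.ext ?_, fun n h => Subtype.ext ?_⟩
  · exact (OpenClosed.muHom_tree t _ h').trans (OpenClosed.muValue_eq_mk t h)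
  · exact (OpenClosed.muHom_tree (x := .planar) _ _ _).trans (OpenClosed.muTree_brace_central _ _)
  · refine (OpenClosed.muHom_tree (x := .planar) _ _ _).trans (OpenClosed.muTree_corolla ?_ ?_)
    · rw [List.length_finRange]
      exact fun h' => h1 (Prod.ext h'.1 h'.2)
    · rw [List.length_finRange]
      exact fun h' => h2 (Prod.ext h'.1 h'.2)
  · refine (OpenClosed.muHom_tree (x := .spatial) _ _ _).trans
      (OpenClosed.collapseTree_vert_eq_zero k fun h' => ?_)
    have := (OpenClosed.leaves_invariants (S := OpenClosed.OCVertex) (P := OpenClosed.OCCorolla)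
      (List.finRange n)).1
    rw [List.length_finRange] at this
    have := h'.2
    omega
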